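/- Let $I$ be $(0,1)$ or $(0,\infty)$ with Lebesgue measure $m$. Functions are real-valued, measurable, and identified when equal almost everywhere. Put $x^*(t)=\inf\{s\ge 0: m(\{|x|\ge s\})\le t\}$ and $x^*(\infty)=\lim_{t\to\infty}x^*(t)$, and write $y\prec\prec x$ if $\int_0^t y^*(s)\,ds\le\int_0^t x^*(s)\,ds$ for all $t\ge 0$. For $0\le x,y\in L_1$ write $y\prec x$ if $y\prec\prec x$ and $\|y\|_1=\|x\|_1$. A symmetric space $E=E(I)$ is a Banach space of functions on $I$ such that: every $x\in E$ satisfies $m(\{|x|>s\})<\infty$ for some $s$; if $x\in E$ and $|y|\le|x|$, then $y\in E$ and $\|y\|_E\le\|x\|_E$; if $x\in E$ and $y^*=x^*$, then $y\in E$ and $\|y\|_E=\|x\|_E$. It is fully symmetric if, in addition, $x\in E$, $y\in L_1+L_\infty$ and $y\prec\prec x$ imply $y\in E$ and $\|y\|_E\le\|x\|_E$. For $\tau>0$ let $(\sigma_\tau f)(s)=f(s/\tau)$ if $s/\tau\in I$ and $(\sigma_\tau f)(s)=0$ otherwise. For $x\in E$ put $$\varphi(x)=\lim_{s\to\infty}\tfrac1s\|\sigma_s(x^*)\|_E,\qquad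 \varphi_{fin}(x)=\lim_{s\to\infty}\tfrac1s\|\sigma_s(x^*)\chi_{[0,1]}\|_E\quad(\text{the latter for } I=(0,\infty)).$$ For a finite or infinite sequence $\mathcal A=\{A_k\}$ of pairwise disjoint measurable subsets of $I$ of finite measure, with $A_\infty=I\setminus\bigcup_kA_k$, put $$P(x|\mathcal A)=\sum_k\frac1{m(A_k)}\Big(\int_{A_k}x\,dm\Big)\chi_{A_k}+x\chi_{A_\infty}$$ (null sets $A_k$ contribute nothing). Let $\mathfrak A$ be the collection of all such sequences. For $0\le x\in E$ let $Q'(x)$ be the $\|\cdot\|_E$-closed convex hull of the set of extreme points of $\Omega'(x)=\{0\le y\in L_1: y\prec x\}$ if $x\in L_1$, and the $\|\cdot\|_E$-closed convex hull of $\{0\le y: y^*=x^*,\ y\chi_{\{y<y^*(\infty)\}}=0\}$ if $x\notin L_1$. **Theorem.** Let $E$ be a fully symmetric space on $I$ and let $0\le x\in E$. (a) If $I=(0,1)$, or if $I=(0,\infty)$ and $E\not\subseteq L_1$, then the following are equivalent: (i) $P(x|\mathcal A)\in Q'(x)$ for every $\mathcal A\in\mathfrak A$; (ii) $\varphi(x)=0$.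 (b) If $I=(0,\infty)$ and $E\subseteq L_1$, then the following are equivalent: (i) $P(x|\mathcal A)\in Q'(x)$ for every $\mathcal A\in\mathfrak A$; (ii) $\varphi_{fin}(x)=0$. -/

import Mathlib

open MeasureTheory Set Filter Topology
open scoped ENNReal NNReal

noncomputable section

/-- `L₀(I)`: classes modulo a.e. equality of measurable, real-valued functions on `I ⊆ ℝ` with
Lebesgue measure. Only `I = (0,1)` and `I = (0,∞)` are used. -/
abbrev L0 (I : Set ℝ) : Type := ℝ →ₘ[(volume : Measure ℝ).restrict I] ℝ

/-- The decreasing rearrangement `x*(t) = inf {s ≥ 0 : m({|x| ≥ s}) ≤ t}`, with values in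
`[0,∞]` (it is finite for `t > 0` as soon as `x ∈ S₀`). -/
def rearr {I : Set ℝ} (x : L0 I) (t : ℝ) : ℝ≥0∞ :=
  sInf {s : ℝ≥0∞ | (volume : Measure ℝ).restrict I {u | s ≤ ‖x u‖ₑ} ≤ ENNReal.ofReal t}

theorem rearr_antitone {I : Set ℝ} (x : L0 I) : Antitone (rearr x) := fun _ _ hab =>
  sInf_le_sInf fun _ hs => le_trans hs (ENNReal.ofReal_le_ofReal hab)

/-- `x*(∞) = lim_{t → ∞} x*(t)`. -/
def rearrInf {I : Set ℝ} (x : L0 I) : ℝ≥0∞ := ⨅ t : ℝ, rearr x t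

theorem tendsto_rearr_rearrInf {I : Set ℝ} (x : L0 I) :
    Tendsto (rearr x) atTop (𝓝 (rearrInf x)) :=
  tendsto_atTop_iInf (rearr_antitone x)

/-- `S₀`: the functions `x` with `m({|x| > s}) < ∞` for some (finite) `s`. -/
def S0 (I : Set ℝ) : Set (L0 I) :=
  {x | ∃ s : ℝ≥0, (volume : Measure ℝ).restrict I {u | (s : ℝ≥0∞) < ‖x u‖ₑ} < ∞}

/-- `L₁(I)`, as a set of elements of `L₀(I)`. -/
def L1set (I : Set ℝ) : Set (L0 I) :=
  {x | x ∈ Lp ℝ 1 ((volume : Measure ℝ).restrict I)}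

/-- `L₁(I) + L_∞(I)`. -/
def L1addLinf (I : Set ℝ) : Set (L0 I) :=
  {x | ∃ a ∈ Lp ℝ 1 ((volume : Measure ℝ).restrict I),
    ∃ b ∈ Lp ℝ ∞ ((volume : Measure ℝ).restrict I), x = a + b}

/-- Submajorization `y ≺≺ x`: `∫₀ᵗ y* ≤ ∫₀ᵗ x*` for all `t ≥ 0`. -/
def Submajorized {I : Set ℝ} (y x : L0 I) : Prop :=
  ∀ t : ℝ, 0 ≤ t → ∫⁻ s in Ioo 0 t, rearr y s ≤ ∫⁻ s in Ioo 0 t, rearr x s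

/-- A symmetric space on `I`: a Banach space of (classes of) measurable functions, contained in
`S₀`, which is an ideal lattice and whose norm is rearrangement invariant. -/
structure SymmetricSpace (I : Set ℝ) where
  carrier : Submodule ℝ (L0 I)
  norm : Seminorm ℝ carrier
  eq_zero_of_norm_eq_zero : ∀ x : carrier, norm x = 0 → x = 0
  complete : ∀ u : ℕ → carrier,
    (∀ ε : ℝ, 0 < ε → ∃ N : ℕ, ∀ m ≥ N, ∀ n ≥ N, norm (u m - u n) < ε) →
      ∃ x : carrier, Tendsto (fun n => norm (u n - x)) atTop (𝓝 0)
  ideal : ∀ (x : carrier) (y : L0 I), |y| ≤ |(x : L0 I)| →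
    ∃ hy : y ∈ carrier, norm ⟨y, hy⟩ ≤ norm x
  subset_S0 : ∀ x ∈ carrier, x ∈ S0 I
  symmetric : ∀ (x : carrier) (y : L0 I), rearr y = rearr (x : L0 I) →
    ∃ hy : y ∈ carrier, norm ⟨y, hy⟩ = norm x

namespace SymmetricSpace

variable {I : Set ℝ}

/-- `E` is fully symmetric: `x ∈ E`, `y ∈ L₁ + L_∞`, `y ≺≺ x` imply `y ∈ E`, `‖y‖ ≤ ‖x‖`. -/
def IsFullySymmetric (E : SymmetricSpace I) : Prop :=
  ∀ (x : E.carrier) (y : L0 I), y ∈ L1addLinf I → Submajorized y (x : L0 I) →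
    ∃ hy : y ∈ E.carrier, E.norm ⟨y, hy⟩ ≤ E.norm x

open Classical in
/-- The norm of `E`, extended by `∞` to functions outside `E`. -/
def extNorm (E : SymmetricSpace I) (x : L0 I) : ℝ≥0∞ :=
  if h : x ∈ E.carrier then ENNReal.ofReal (E.norm ⟨x, h⟩) else ∞

/-- The norm-closed (in `E`) convex hull of a set of functions. -/
def closedConvHull (E : SymmetricSpace I) (S : Set (L0 I)) : Set (L0 I) :=
  {z | z ∈ E.carrier ∧ ∀ ε : ℝ, 0 < ε →
    ∃ w ∈ convexHull ℝ S, E.extNorm (z - w) < ENNReal.ofReal ε}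

end SymmetricSpace

/-- `Ω'(x) = {0 ≤ y ∈ L₁ : y ≺ x}`, where `y ≺ x` means `y ≺≺ x` and `‖y‖₁ = ‖x‖₁`. -/
def OmegaPrime {I : Set ℝ} (x : L0 I) : Set (L0 I) :=
  {y | 0 ≤ y ∧ y ∈ L1set I ∧ Submajorized y x ∧
    eLpNorm y 1 ((volume : Measure ℝ).restrict I) = eLpNorm x 1 ((volume : Measure ℝ).restrict I)}

/-- The set `{0 ≤ y : y* = x*, y χ_{y < y*(∞)} = 0}`. -/
def equimeasurableSet {I : Set ℝ} (x : L0 I) : Set (L0 I) :=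
  {y | 0 ≤ y ∧ rearr y = rearr x ∧
    ∀ᵐ u ∂((volume : Measure ℝ).restrict I), ENNReal.ofReal (y u) < rearrInf y → y u = 0}

open Classical in
/-- `Q'(x)` for `0 ≤ x ∈ E`: the norm-closed convex hull of the extreme points of `Ω'(x)` when
`x ∈ L₁`, and the norm-closed convex hull of `{0 ≤ y : y* = x*, y χ_{y < y*(∞)} = 0}` otherwise. -/
def QPrime {I : Set ℝ} (E : SymmetricSpace I) (x : L0 I) : Set (L0 I) :=
  if x ∈ L1set I then E.closedConvHull ((OmegaPrime x).extremePoints ℝ)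
  else E.closedConvHull (equimeasurableSet x)

/-- A sequence of disjoint measurable subsets of `I` of finite measure. Finite sequences are those
with `sets k = ∅` for all large `k`. -/
structure AveragingFamily (I : Set ℝ) where
  sets : ℕ → Set ℝ
  subset : ∀ k, sets k ⊆ I
  measurable : ∀ k, MeasurableSet (sets k)
  finite : ∀ k, volume (sets k) < ∞
  disjoint : Pairwise fun j k => Disjoint (sets j) (sets k)

/-- `P(x|𝒜) = ∑ₖ m(Aₖ)⁻¹ (∫_{Aₖ} x) χ_{Aₖ} + x χ_{A_∞}`, `A_∞` the complement of `⋃ₖ Aₖ`,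
as a function (at each point at most one term of the sum is nonzero). -/
def partialAverageFun {I : Set ℝ} (𝒜 : AveragingFamily I) (x : L0 I) (t : ℝ) : ℝ :=
  (∑' k, (𝒜.sets k).indicator (fun _ => (volume.real (𝒜.sets k))⁻¹ * ∫ s in 𝒜.sets k, x s) t) +
    (⋃ k, 𝒜.sets k)ᶜ.indicator x t

theorem partialAverageFun_measurable {I : Set ℝ} (𝒜 : AveragingFamily I) (x : L0 I) :
    Measurable (partialAverageFun 𝒜 x) := by
  have hx : Measurable (x : ℝ → ℝ) := x.measurable
  refine Measurable.add ?_ (hx.indicator (MeasurableSet.iUnion 𝒜.measurable).compl)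
  set g : ℕ → ℝ → ℝ := fun k =>
    (𝒜.sets k).indicator (fun _ => (volume.real (𝒜.sets k))⁻¹ * ∫ s in 𝒜.sets k, x s) with hg
  have hgm : ∀ k, Measurable (g k) := fun k => measurable_const.indicator (𝒜.measurable k)
  have hsum : ∀ t, Summable fun k => g k t := by
    intro t
    by_cases h : ∃ k, t ∈ 𝒜.sets k
    · obtain ⟨k, hk⟩ := h
      refine summable_of_ne_finset_zero (s := {k}) fun j hj => ?_
      have hjk : j ≠ k := by simpa using hj
      exact indicator_of_notMem (fun hjt => Set.disjoint_left.1 (𝒜.disjoint hjk) hjt hk) _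
    · push Not at h
      exact summable_of_ne_finset_zero (s := ∅) fun j _ => indicator_of_notMem (h j) _
  refine measurable_of_tendsto_metrizable (f := fun n t => ∑ k ∈ Finset.range n, g k t)
    (fun n => Finset.measurable_fun_sum _ fun k _ => hgm k) ?_
  exact tendsto_pi_nhds.2 fun t => (hsum t).hasSum.tendsto_sum_nat

/-- The partial averaging operator `P(·|𝒜)` on classes of functions. -/
def partialAverage {I : Set ℝ} (𝒜 : AveragingFamily I) (x : L0 I) : L0 I :=
  AEEqFun.mk (partialAverageFun 𝒜 x) (partialAverageFun_measurable 𝒜 x).aestronglyMeasurable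

/-- The dilation `σ_τ f` of a function `f` on `I`: `(σ_τ f)(s) = f(s/τ)` if `s/τ ∈ I`, and `0`
otherwise. On `(0,∞)` the second case does not occur; on `(0,1)` it is the case `s ≥ τ`. -/
def dilation (I : Set ℝ) (τ : ℝ) (f : ℝ → ℝ) (s : ℝ) : ℝ := I.indicator f (s / τ)

theorem dilation_rearr_measurable {I : Set ℝ} (hI : MeasurableSet I) (x : L0 I) (τ : ℝ) :
    Measurable (dilation I τ fun t => (rearr x t).toReal) :=
  ((rearr_antitone x).measurable.ennreal_toReal.indicator hI).comp (measurable_id.div_const τ)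

/-- `σ_τ(x*)` as an element of `L₀(I)`. -/
def dilatedRearr {I : Set ℝ} (hI : MeasurableSet I) (τ : ℝ) (x : L0 I) : L0 I :=
  AEEqFun.mk (dilation I τ fun t => (rearr x t).toReal)
    (dilation_rearr_measurable hI x τ).aestronglyMeasurable

/-- `σ_τ(x*) χ_{[0,1]}` as an element of `L₀(I)`. -/
def dilatedRearrFin {I : Set ℝ} (hI : MeasurableSet I) (τ : ℝ) (x : L0 I) : L0 I :=
  AEEqFun.mk ((Icc (0 : ℝ) 1).indicator (dilation I τ fun t => (rearr x t).toReal))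
    ((dilation_rearr_measurable hI x τ).indicator measurableSet_Icc).aestronglyMeasurable

/-- `φ(x) = lim_{s → ∞} s⁻¹ ‖σ_s(x*)‖_E` for `x ∈ E`, written with the upper limit in `[0,∞]`:
it equals the limit when that exists, and it vanishes exactly when the limit exists and is `0`. -/
def phi {I : Set ℝ} (hI : MeasurableSet I) (E : SymmetricSpace I) (x : L0 I) : ℝ≥0∞ :=
  limsup (fun s : ℝ => (ENNReal.ofReal s)⁻¹ * E.extNorm (dilatedRearr hI s x)) atTop

/-- `φ_fin(x) = lim_{s → ∞} s⁻¹ ‖σ_s(x*) χ_{[0,1]}‖_E`, in the same way. -/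
def phiFin {I : Set ℝ} (hI : MeasurableSet I) (E : SymmetricSpace I) (x : L0 I) : ℝ≥0∞ :=
  limsup (fun s : ℝ => (ENNReal.ofReal s)⁻¹ * E.extNorm (dilatedRearrFin hI s x)) atTop

end

/-! Submajorization is handled through the duality `∫₀ᵗ f* = min_s (∫ (f - s)₊ + s t)`, with the
minimum at `s = f*(t)` (`decrInt_eq`). Comparing integrals of rearrangements is thus the same as
comparing the excess integrals `∫ (f - s)₊`, which add up over disjoint pieces and respect
convexity. Full symmetry turns every such comparison into a norm inequality
(`extNorm_le_of_submajorized`).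

The set `Q'(x)` is the closed convex hull of the nonnegative functions equimeasurable with `x`. For
`x ∈ L₁` the extreme points of `Ω'(x)` are exactly these functions (`mem_extremePoints_of_rearr_eq`,
`rearr_eq_of_mem_extremePoints`); for `x ∉ L₁` see `mem_closedConvHull_orbitSet`.

(ii) implies (i). On each `Aₖ` the rearrangement of `x` is cut into `n` cells of equal length, and
the cells are permuted cyclically. This gives `n` functions equimeasurable with `x` whose mean is a
Riemann sum for the average of `x` over `Aₖ`. The error comes from the first cell alone: it is at
most `n⁻¹` times the first cell repeated `n` times, whose rearrangement is at most `n⁻¹ σ_n(x*)`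
(`rearr_periodL0_le`), plus its average, which is submajorized by it. In (b) only the part on
`[0,1]` is controlled by `φ_fin`, but there `x ∈ L₁` and the total mass of the first cells tends to
`0`.

(i) implies (ii). Put `X(t) = ∫₀ᵗ x*`, take `ℓ i` with `X(ℓ i) = 4 ^ i` and nested top sets `D i` of
measure `ℓ i`, and average `x` over the blocks `D (i+1) \ D (i-1)`, for `i` of one parity. A convex
combination of `n` functions equimeasurable with `x` keeps at least three quarters of `X(ℓ i)` on
some set of measure at most `16 n ℓ i`. If the gap is long, `ℓ (i+1) ≥ 512 n ℓ i`, the average has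
at most half of `X(ℓ i)` on that set, so the difference must carry a quarter
(`IsTopSystem.realInt_le`). Where there are no long gaps, `X` grows geometrically under a fixed
dilation. In both cases `X(t / R^(J+1)) ≤ 16 G(t) + 4^(-J) X(t)`, where `G` comes from differences
of small norm (`IsLevelSeq.le_add`, `exists_dominating`). The left side governs `s⁻¹ σ_s(x*)`. What
remains is to pass from the admissible `t` to all `t`, which depends on whether `x ∈ L₁` and whether
`x*(∞) = 0`. -/

noncomputable section

/-! ### Decreasing rearrangements on a measure space -/

section Rearrangement

variable {α : Type*} [MeasurableSpace α]

/-- The decreasing rearrangement of a `[0,∞]`-valued function. -/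
def decr (μ : Measure α) (f : α → ℝ≥0∞) (t : ℝ) : ℝ≥0∞ :=
  sInf {s : ℝ≥0∞ | μ {u | s ≤ f u} ≤ ENNReal.ofReal t}

/-- The integral of the decreasing rearrangement over `(0,t)`. -/
def decrInt (μ : Measure α) (f : α → ℝ≥0∞) (t : ℝ) : ℝ≥0∞ :=
  ∫⁻ s in Ioo 0 t, decr μ f s

/-- The integral of the excess `(f - s)₊`. -/
def excess (μ : Measure α) (f : α → ℝ≥0∞) (s : ℝ≥0∞) : ℝ≥0∞ := ∫⁻ u, (f u - s) ∂μ

theorem decr_antitone (μ : Measure α) (f : α → ℝ≥0∞) : Antitone (decr μ f) := fun _ _ hab =>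
  sInf_le_sInf fun _ hs => le_trans hs (ENNReal.ofReal_le_ofReal hab)

theorem measurable_decr (μ : Measure α) (f : α → ℝ≥0∞) : Measurable (decr μ f) :=
  (decr_antitone μ f).measurable

theorem decr_congr_ae {μ : Measure α} {f g : α → ℝ≥0∞} (h : f =ᵐ[μ] g) : decr μ f = decr μ g := by
  funext t
  unfold decr
  congr 1
  ext s
  have : μ {u | s ≤ f u} = μ {u | s ≤ g u} := by
    refine measure_congr ?_
    filter_upwards [h] with u hu
    change (s ≤ f u) = (s ≤ g u)
    rw [hu]
  simp [this]

theorem decr_mono {μ : Measure α} {f g : α → ℝ≥0∞} (h : f ≤ᵐ[μ] g) (t : ℝ) :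
    decr μ f t ≤ decr μ g t := by
  refine sInf_le_sInf fun s hs => le_trans (measure_mono_ae ?_) hs
  filter_upwards [h] with u hu hsu using le_trans (show s ≤ f u from hsu) hu

/-- The sets `{v n ≤ f}` increase to `{s < f}` as `v n` decreases to `s`, so continuity from below
suffices and no measure has to be finite. The non-strict inequality in the definition of `decr`
therefore does not matter. -/
theorem lt_decr_iff {μ : Measure α} {f : α → ℝ≥0∞} {t : ℝ} {s : ℝ≥0∞} :
    s < decr μ f t ↔ ENNReal.ofReal t < μ {u | s < f u} := by
  constructor
  · intro h
    by_contra! hle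
    refine absurd h (not_lt.2 (le_of_forall_gt_imp_ge_of_dense fun s' hs' => ?_))
    exact sInf_le (le_trans (measure_mono fun u hu => lt_of_lt_of_le hs' hu) hle)
  · intro h
    have hs : s ≠ ∞ := by
      rintro rfl
      simp at h
    obtain ⟨v, hv, hvs, hvt⟩ := exists_seq_strictAnti_tendsto' (lt_top_iff_ne_top.2 hs)
    have hU : {u | s < f u} = ⋃ n, {u | v n ≤ f u} := by
      ext u
      simp only [mem_ofPred_eq, mem_iUnion]
      constructor
      · intro hu
        exact ((hvt.eventually (gt_mem_nhds hu)).exists).imp fun n hn => hn.le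
      · rintro ⟨n, hn⟩
        exact lt_of_lt_of_le (hvs n).1 hn
    have hmono : Monotone fun n => {u | v n ≤ f u} := fun m n hmn u hu =>
      le_trans (hv.antitone hmn) hu
    rw [hU, hmono.measure_iUnion, lt_iSup_iff] at h
    obtain ⟨n, hn⟩ := h
    refine lt_of_lt_of_le (hvs n).1 (le_sInf fun σ hσ => ?_)
    by_contra! hlt
    exact absurd (lt_of_lt_of_le hn (le_trans (measure_mono fun u hu => hlt.le.trans hu) hσ))
      (lt_irrefl _)

theorem decr_le_iff {μ : Measure α} {f : α → ℝ≥0∞} {t : ℝ} {s : ℝ≥0∞} :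
    decr μ f t ≤ s ↔ μ {u | s < f u} ≤ ENNReal.ofReal t := by
  rw [← not_lt, lt_decr_iff, not_lt]

theorem measure_decr_lt_le (μ : Measure α) (f : α → ℝ≥0∞) (t : ℝ) :
    μ {u | decr μ f t < f u} ≤ ENNReal.ofReal t := decr_le_iff.1 le_rfl

theorem decr_eq_of_measure_eq {β : Type*} [MeasurableSpace β] {μ : Measure α} {ν : Measure β}
    {f : α → ℝ≥0∞} {g : β → ℝ≥0∞} (h : ∀ s : ℝ≥0∞, s ≠ ∞ → μ {u | s < f u} = ν {u | s < g u}) :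
    decr μ f = decr ν g := by
  funext t
  refine eq_of_forall_ge_iff fun s => ?_
  rw [decr_le_iff, decr_le_iff]
  by_cases hs : s = ∞
  · simp [hs]
  · rw [h s hs]

theorem volume_pos_ofReal_lt (d : ℝ≥0∞) :
    volume {t : ℝ | 0 < t ∧ ENNReal.ofReal t < d} = d := by
  by_cases hd : d = ∞
  · subst hd
    have : {t : ℝ | 0 < t ∧ ENNReal.ofReal t < ∞} = Ioi 0 := by
      ext t; simp
    rw [this, Real.volume_Ioi]
  · have : {t : ℝ | 0 < t ∧ ENNReal.ofReal t < d} = Ioo 0 d.toReal := by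
      ext t
      simp only [mem_ofPred_eq, mem_Ioo]
      exact and_congr_right fun ht => by
        rw [ENNReal.ofReal_lt_iff_lt_toReal ht.le hd]
    rw [this, Real.volume_Ioo, sub_zero, ENNReal.ofReal_toReal hd]

theorem volume_lt_decr (μ : Measure α) (f : α → ℝ≥0∞) (s : ℝ≥0∞) :
    (volume.restrict (Ioi (0 : ℝ))) {t | s < decr μ f t} = μ {u | s < f u} := by
  rw [Measure.restrict_apply (measurableSet_lt measurable_const (measurable_decr μ f)),
    ← volume_pos_ofReal_lt (μ {u | s < f u})]
  congr 1
  ext t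
  simp only [mem_inter_iff, mem_ofPred_eq, mem_Ioi, lt_decr_iff]
  exact and_comm

theorem lintegral_eq_lintegral_measure_lt {μ : Measure α} [SFinite μ] {f : α → ℝ≥0∞}
    (hf : AEMeasurable f μ) :
    ∫⁻ u, f u ∂μ = ∫⁻ s in Ioi (0 : ℝ), μ {u | ENNReal.ofReal s < f u} := by
  wlog hfm : Measurable f generalizing f
  · rw [lintegral_congr_ae hf.ae_eq_mk, this hf.measurable_mk.aemeasurable hf.measurable_mk]
    refine lintegral_congr fun s => measure_congr ?_
    filter_upwards [hf.ae_eq_mk] with u hu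
    change (_ < hf.mk f u) = (_ < f u)
    rw [hu]
  have hS : MeasurableSet {p : α × ℝ | ENNReal.ofReal p.2 < f p.1} :=
    measurableSet_lt (ENNReal.measurable_ofReal.comp measurable_snd) (hfm.comp measurable_fst)
  have h1 : ∀ u, f u = ∫⁻ s in Ioi (0 : ℝ),
      {p : α × ℝ | ENNReal.ofReal p.2 < f p.1}.indicator (fun _ => 1) (u, s) := by
    intro u
    have : (fun s : ℝ => {p : α × ℝ | ENNReal.ofReal p.2 < f p.1}.indicator
        (fun _ => (1 : ℝ≥0∞)) (u, s)) = {s : ℝ | ENNReal.ofReal s < f u}.indicator fun _ => 1 := by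
      funext s
      simp [indicator]
    have hm : MeasurableSet {s : ℝ | ENNReal.ofReal s < f u} :=
      measurableSet_lt ENNReal.measurable_ofReal measurable_const
    rw [this, lintegral_indicator hm]
    simp only [lintegral_const, one_mul, MeasurableSet.univ, Measure.restrict_apply, univ_inter]
    rw [Measure.restrict_apply hm, inter_comm]
    exact (volume_pos_ofReal_lt (f u)).symm
  calc ∫⁻ u, f u ∂μ = ∫⁻ u, (∫⁻ s in Ioi (0 : ℝ),
      {p : α × ℝ | ENNReal.ofReal p.2 < f p.1}.indicator (fun _ => 1) (u, s)) ∂μ :=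
        lintegral_congr h1
    _ = ∫⁻ s in Ioi (0 : ℝ), (∫⁻ u,
      {p : α × ℝ | ENNReal.ofReal p.2 < f p.1}.indicator (fun _ => 1) (u, s) ∂μ) :=
        lintegral_lintegral_swap (measurable_const.indicator hS).aemeasurable
    _ = _ := by
        refine lintegral_congr fun s => ?_
        have : (fun u : α => {p : α × ℝ | ENNReal.ofReal p.2 < f p.1}.indicator
            (fun _ => (1 : ℝ≥0∞)) (u, s)) = {u | ENNReal.ofReal s < f u}.indicator fun _ => 1 := by
          funext u
          simp [indicator]
        rw [this, lintegral_indicator (measurableSet_lt measurable_const hfm)]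
        simp

theorem lintegral_eq_of_measure_lt_eq {β : Type*} [MeasurableSpace β] {μ : Measure α}
    {ν : Measure β} [SFinite μ] [SFinite ν] {f : α → ℝ≥0∞} {g : β → ℝ≥0∞}
    (hf : AEMeasurable f μ) (hg : AEMeasurable g ν)
    (h : ∀ s : ℝ≥0∞, s ≠ ∞ → μ {u | s < f u} = ν {u | s < g u}) :
    ∫⁻ u, f u ∂μ = ∫⁻ u, g u ∂ν := by
  rw [lintegral_eq_lintegral_measure_lt hf, lintegral_eq_lintegral_measure_lt hg]
  exact lintegral_congr fun s => h _ ENNReal.ofReal_ne_top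

theorem excess_eq_of_measure_lt_eq {β : Type*} [MeasurableSpace β] {μ : Measure α}
    {ν : Measure β} [SFinite μ] [SFinite ν] {f : α → ℝ≥0∞} {g : β → ℝ≥0∞}
    (hf : AEMeasurable f μ) (hg : AEMeasurable g ν)
    (h : ∀ s : ℝ≥0∞, s ≠ ∞ → μ {u | s < f u} = ν {u | s < g u}) (a : ℝ≥0∞) :
    excess μ f a = excess ν g a := by
  by_cases ha : a = ∞
  · simp [excess, ha]
  refine lintegral_eq_of_measure_lt_eq (hf.sub aemeasurable_const) (hg.sub aemeasurable_const)
    fun s hs => ?_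
  simp only [lt_tsub_iff_right]
  exact h _ (ENNReal.add_ne_top.2 ⟨hs, ha⟩)

theorem excess_eq_lintegral_decr {μ : Measure α} [SFinite μ] {f : α → ℝ≥0∞}
    (hf : AEMeasurable f μ) (a : ℝ≥0∞) :
    excess μ f a = ∫⁻ t in Ioi (0 : ℝ), (decr μ f t - a) :=
  excess_eq_of_measure_lt_eq hf (measurable_decr μ f).aemeasurable
    (fun s _ => (volume_lt_decr μ f s).symm) a

theorem decrInt_mono (μ : Measure α) (f : α → ℝ≥0∞) : Monotone (decrInt μ f) := fun _ _ h =>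
  lintegral_mono_set (Ioo_subset_Ioo_right h)

theorem decrInt_of_nonpos (μ : Measure α) (f : α → ℝ≥0∞) {t : ℝ} (ht : t ≤ 0) :
    decrInt μ f t = 0 := by
  simp [decrInt, Ioo_eq_empty_of_le ht]

/-- One half of the duality between `decrInt` and `excess`: integrate `f* ≤ (f* - s)₊ + s` over
`(0,t)`. Equality at `s = f*(t)` is `decrInt_eq`. -/
theorem decrInt_le_excess_add {μ : Measure α} [SFinite μ] {f : α → ℝ≥0∞}
    (hf : AEMeasurable f μ) (s : ℝ≥0∞) (t : ℝ) :
    decrInt μ f t ≤ excess μ f s + s * ENNReal.ofReal t := by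
  calc decrInt μ f t ≤ ∫⁻ u in Ioo 0 t, ((decr μ f u - s) + s) :=
        lintegral_mono fun u => le_tsub_add
    _ = (∫⁻ u in Ioo 0 t, (decr μ f u - s)) + s * ENNReal.ofReal t := by
        rw [lintegral_add_right _ measurable_const]
        simp
    _ ≤ _ := by
        rw [excess_eq_lintegral_decr hf]
        gcongr
        exact Ioo_subset_Ioi_self

theorem decrInt_eq_excess_add {μ : Measure α} [SFinite μ] {f : α → ℝ≥0∞}
    (hf : AEMeasurable f μ) {s : ℝ≥0∞} {t : ℝ} (h1 : ∀ u ∈ Ioo 0 t, s ≤ decr μ f u)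
    (h2 : ∀ u, 0 < u → t < u → decr μ f u ≤ s) :
    decrInt μ f t = excess μ f s + s * ENNReal.ofReal t := by
  refine le_antisymm (decrInt_le_excess_add hf s t) ?_
  have hz : ∫⁻ u in Ioi (0 : ℝ) \ Ioc 0 t, (decr μ f u - s) = 0 := by
    refine setLIntegral_eq_zero (measurableSet_Ioi.diff measurableSet_Ioc) fun u hu => ?_
    have hu1 : 0 < u := hu.1
    have hu2 : t < u := by
      by_contra! hle
      exact hu.2 ⟨hu1, hle⟩
    exact tsub_eq_zero_of_le (h2 u hu1 hu2)
  have hsplit : excess μ f s = ∫⁻ u in Ioo 0 t, (decr μ f u - s) := by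
    rw [excess_eq_lintegral_decr hf, ← lintegral_inter_add_sdiff _ (Ioi (0 : ℝ)) measurableSet_Ioc,
      hz, add_zero, inter_eq_right.2 Ioc_subset_Ioi_self]
    exact setLIntegral_congr Ioo_ae_eq_Ioc.symm
  have hc : s * ENNReal.ofReal t = ∫⁻ _ in Ioo 0 t, s := by simp
  rw [hsplit, hc, ← lintegral_add_right _ measurable_const]
  refine setLIntegral_mono (measurable_decr μ f) fun u hu => ?_
  rw [tsub_add_cancel_of_le (h1 u hu)]

theorem decrInt_eq {μ : Measure α} [SFinite μ] {f : α → ℝ≥0∞} (hf : AEMeasurable f μ) (t : ℝ) :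
    decrInt μ f t = excess μ f (decr μ f t) + decr μ f t * ENNReal.ofReal t :=
  decrInt_eq_excess_add hf (fun _ hu => decr_antitone μ f hu.2.le)
    fun _ _ hu => decr_antitone μ f hu.le

theorem setLIntegral_le_decrInt {μ : Measure α} [SFinite μ] {f : α → ℝ≥0∞}
    (hf : AEMeasurable f μ) {B : Set α} {t : ℝ} (hB : μ B ≤ ENNReal.ofReal t) :
    ∫⁻ u in B, f u ∂μ ≤ decrInt μ f t := by
  rw [decrInt_eq hf t]
  set s := decr μ f t
  calc ∫⁻ u in B, f u ∂μ ≤ ∫⁻ u in B, ((f u - s) + s) ∂μ := lintegral_mono fun u => le_tsub_add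
    _ = ∫⁻ u in B, (f u - s) ∂μ + s * μ B := by
        rw [lintegral_add_right _ measurable_const]
        simp
    _ ≤ excess μ f s + s * ENNReal.ofReal t := by
        gcongr
        exact setLIntegral_le_lintegral _ _

theorem decr_mul_le_decrInt (μ : Measure α) (f : α → ℝ≥0∞) (t : ℝ) :
    decr μ f t * ENNReal.ofReal t ≤ decrInt μ f t := by
  calc decr μ f t * ENNReal.ofReal t = ∫⁻ _ in Ioo 0 t, decr μ f t := by simp
    _ ≤ _ := setLIntegral_mono (measurable_decr μ f) fun u hu => decr_antitone μ f hu.2.le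

/-- Submajorization from excess integrals: the minimizing level for `g` is an admissible competitor
in the duality for `f`. -/
theorem decrInt_le_of_excess_le {β : Type*} [MeasurableSpace β] {μ : Measure α} {ν : Measure β}
    [SFinite μ] [SFinite ν] {f : α → ℝ≥0∞} {g : β → ℝ≥0∞}
    (hf : AEMeasurable f μ) (hg : AEMeasurable g ν)
    (h : ∀ s : ℝ≥0∞, s ≠ ∞ → excess μ f s ≤ excess ν g s) (t : ℝ) :
    decrInt μ f t ≤ decrInt ν g t := by
  rw [decrInt_eq hg t]
  by_cases hs : decr ν g t = ∞
  · rcases le_or_gt t 0 with ht | ht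
    · rw [decrInt_of_nonpos μ f ht]; exact zero_le
    · rw [hs, ENNReal.top_mul (by simpa using ht)]; simp
  · refine (decrInt_le_excess_add hf (decr ν g t) t).trans ?_
    gcongr
    exact h _ hs

theorem excess_le_of_decrInt_le {β : Type*} [MeasurableSpace β] {μ : Measure α} {ν : Measure β}
    [SFinite μ] [SFinite ν] {f : α → ℝ≥0∞} {g : β → ℝ≥0∞}
    (hf : AEMeasurable f μ) (hg : AEMeasurable g ν)
    (h : ∀ t : ℝ, 0 ≤ t → decrInt μ f t ≤ decrInt ν g t) {s : ℝ≥0∞} (hs : s ≠ ∞) :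
    excess μ f s ≤ excess ν g s := by
  -- As long as `t ≤ μ{f > s}`, the rearrangement of `f` exceeds `s` on `(0,t)`, so the truncated
  -- subtraction is exact and the finite term `s t` cancels.
  have key : ∀ t : ℝ, ENNReal.ofReal t ≤ μ {u | s < f u} →
      ∫⁻ u in Ioo 0 t, (decr μ f u - s) ≤ excess ν g s := by
    intro t ht
    rcases le_or_gt t 0 with ht0 | ht0
    · simp [Ioo_eq_empty_of_le ht0]
    have h1 : (∫⁻ u in Ioo 0 t, (decr μ f u - s)) + s * ENNReal.ofReal t = decrInt μ f t := by
      have : s * ENNReal.ofReal t = ∫⁻ _ in Ioo 0 t, s := by simp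
      rw [this, ← lintegral_add_right _ measurable_const]
      refine setLIntegral_congr_fun measurableSet_Ioo fun u hu => tsub_add_cancel_of_le ?_
      refine (lt_decr_iff.2 (lt_of_lt_of_le ?_ ht)).le
      exact (ENNReal.ofReal_lt_ofReal_iff ht0).2 hu.2
    have h2 := (h1.le.trans (h t ht0.le)).trans (decrInt_le_excess_add hg s t)
    exact (ENNReal.add_le_add_iff_right (ENNReal.mul_ne_top hs ENNReal.ofReal_ne_top)).1 h2
  rw [excess_eq_lintegral_decr hf]
  have hU : Ioi (0 : ℝ) = ⋃ n : ℕ, Ioo (0 : ℝ) n := by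
    ext t
    simp only [mem_Ioi, mem_iUnion, mem_Ioo]
    exact ⟨fun ht => (exists_nat_gt t).imp fun n hn => ⟨ht, hn⟩, fun ⟨_, hn⟩ => hn.1⟩
  have hmono : Monotone fun n : ℕ => Ioo (0 : ℝ) n := fun m n hmn =>
    Ioo_subset_Ioo_right (by exact_mod_cast hmn)
  rw [hU, setLIntegral_iUnion_of_directed _ hmono.directed_le]
  refine iSup_le fun n => ?_
  by_cases hd : ENNReal.ofReal n ≤ μ {u | s < f u}
  · exact key n hd
  · push Not at hd
    have hdt : μ {u | s < f u} ≠ ∞ := (hd.trans ENNReal.ofReal_lt_top).ne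
    -- Beyond `μ{f > s}` the rearrangement is at most `s` and the integrand vanishes, so `(0,n)` may
    -- be cut down to that length.
    refine le_trans ?_ (key (μ {u | s < f u}).toReal (by rw [ENNReal.ofReal_toReal hdt]))
    rw [← lintegral_indicator measurableSet_Ioo, ← lintegral_indicator measurableSet_Ioo]
    refine lintegral_mono_ae ?_
    have hne : ∀ᵐ u : ℝ, u ≠ (μ {u | s < f u}).toReal := by
      simp [ae_iff]
    filter_upwards [hne] with u hu
    by_cases hmem : u ∈ Ioo 0 (μ {u | s < f u}).toReal
    · rw [indicator_of_mem hmem]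
      exact indicator_le_self _ _ _
    · by_cases hun : u ∈ Ioo (0 : ℝ) n
      · have : (μ {u | s < f u}).toReal ≤ u := by
          by_contra! hlt
          exact hmem ⟨hun.1, hlt⟩
        have hle : decr μ f u ≤ s :=
          decr_le_iff.2 ((ENNReal.le_ofReal_iff_toReal_le hdt hun.1.le).2 this)
        rw [indicator_of_mem hun, tsub_eq_zero_of_le hle]
        exact zero_le
      · rw [indicator_of_notMem hun]
        exact zero_le

theorem excess_congr_ae {μ : Measure α} {f g : α → ℝ≥0∞} (h : f =ᵐ[μ] g) (s : ℝ≥0∞) :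
    excess μ f s = excess μ g s :=
  lintegral_congr_ae (h.mono fun u hu => by simp only [hu])

theorem decrInt_add_le (μ : Measure α) (f : α → ℝ≥0∞) (a b : ℝ) :
    decrInt μ f (a + b) ≤ decrInt μ f a + decr μ f a * ENNReal.ofReal b := by
  have hsub : Ioo 0 (a + b) ⊆ Ioo 0 a ∪ Ico a (a + b) := fun u hu => by
    rcases lt_or_ge u a with h | h
    · exact Or.inl ⟨hu.1, h⟩
    · exact Or.inr ⟨h, hu.2⟩
  calc decrInt μ f (a + b) ≤ ∫⁻ u in Ioo 0 a ∪ Ico a (a + b), decr μ f u := lintegral_mono_set hsub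
    _ ≤ decrInt μ f a + ∫⁻ u in Ico a (a + b), decr μ f u := lintegral_union_le _ _ _
    _ ≤ decrInt μ f a + ∫⁻ _ in Ico a (a + b), decr μ f a := by
        refine add_le_add le_rfl ?_
        exact setLIntegral_mono measurable_const fun u hu => decr_antitone μ f hu.1
    _ = _ := by simp

end Rearrangement

/-! ### Submajorization and norms on classes of functions -/

section Classes

variable {I : Set ℝ}

/-- The properties of the intervals `(0,1)` and `(0,∞)` that are used. -/
structure IsInitialInterval (I : Set ℝ) : Prop where
  measurableSet : MeasurableSet I
  pos : ∀ u ∈ I, 0 < u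
  down : ∀ u ∈ I, ∀ v, 0 < v → v ≤ u → v ∈ I
  volume_le : ∀ u, 0 < u → u ∉ I → volume I ≤ ENNReal.ofReal u
  volume_Ioo_ne_zero : volume.restrict I (Ioo 0 1) ≠ 0

theorem isInitialInterval_Ioo : IsInitialInterval (Ioo (0 : ℝ) 1) where
  measurableSet := measurableSet_Ioo
  pos := fun _ hu => hu.1
  down := fun _ hu _ hv hvu => ⟨hv, hvu.trans_lt hu.2⟩
  volume_le := fun u hu hun => by
    rw [Real.volume_Ioo]
    refine ENNReal.ofReal_le_ofReal ?_
    by_contra! h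
    exact hun ⟨hu, by linarith⟩
  volume_Ioo_ne_zero := by
    rw [Measure.restrict_apply measurableSet_Ioo]
    simp

theorem isInitialInterval_Ioi : IsInitialInterval (Ioi (0 : ℝ)) where
  measurableSet := measurableSet_Ioi
  pos := fun _ hu => hu
  down := fun _ _ _ hv _ => hv
  volume_le := fun u hu hun => absurd hu hun
  volume_Ioo_ne_zero := by
    rw [Measure.restrict_apply measurableSet_Ioo, inter_eq_left.2 Ioo_subset_Ioi_self]
    simp

/-- The decreasing rearrangement integrated over `(0,t)`. -/
abbrev rearrInt (x : L0 I) (t : ℝ) : ℝ≥0∞ := decrInt (volume.restrict I) (fun u => ‖x u‖ₑ) t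

/-- The integral of `(|x| - s)₊`. -/
abbrev exc (x : L0 I) (s : ℝ≥0∞) : ℝ≥0∞ := excess (volume.restrict I) (fun u => ‖x u‖ₑ) s

theorem measurable_mag (x : L0 I) : Measurable fun u => ‖x u‖ₑ := x.measurable.enorm

theorem aemeasurable_mag (x : L0 I) : AEMeasurable (fun u => ‖x u‖ₑ) (volume.restrict I) :=
  (measurable_mag x).aemeasurable

theorem rearr_eq_decr (x : L0 I) : rearr x = decr (volume.restrict I) fun u => ‖x u‖ₑ := rfl

theorem submajorized_of_exc_le {y x : L0 I} (h : ∀ s : ℝ≥0∞, s ≠ ∞ → exc y s ≤ exc x s) :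
    Submajorized y x := fun t _ =>
  decrInt_le_of_excess_le (aemeasurable_mag y) (aemeasurable_mag x) h t

theorem Submajorized.exc_le {y x : L0 I} (h : Submajorized y x) {s : ℝ≥0∞} (hs : s ≠ ∞) :
    exc y s ≤ exc x s :=
  excess_le_of_decrInt_le (aemeasurable_mag y) (aemeasurable_mag x) h hs

/-- The class of a `[0,∞]`-valued measurable function (with the value `∞` replaced by `0`). -/
def ofENN (I : Set ℝ) (f : ℝ → ℝ≥0∞) (hf : Measurable f) : L0 I :=
  AEEqFun.mk (fun u => (f u).toReal) hf.ennreal_toReal.aestronglyMeasurable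

theorem ofENN_coe (f : ℝ → ℝ≥0∞) (hf : Measurable f) :
    (ofENN I f hf : ℝ → ℝ) =ᵐ[volume.restrict I] fun u => (f u).toReal := AEEqFun.coeFn_mk _ _

theorem ofENN_nonneg (f : ℝ → ℝ≥0∞) (hf : Measurable f) : 0 ≤ ofENN I f hf := by
  rw [← AEEqFun.coeFn_le]
  filter_upwards [ofENN_coe (I := I) f hf, AEEqFun.coeFn_zero (α := ℝ) (β := ℝ)
    (μ := volume.restrict I)] with u hu h0
  rw [hu, h0]
  exact ENNReal.toReal_nonneg

theorem mag_ofENN (f : ℝ → ℝ≥0∞) (hf : Measurable f)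
    (h : ∀ᵐ u ∂(volume.restrict I), f u ≠ ∞) :
    (fun u => ‖ofENN I f hf u‖ₑ) =ᵐ[volume.restrict I] f := by
  filter_upwards [ofENN_coe (I := I) f hf, h] with u hu hu'
  rw [hu, Real.enorm_eq_ofReal ENNReal.toReal_nonneg, ENNReal.ofReal_toReal hu']

theorem mag_ofENN_le (f : ℝ → ℝ≥0∞) (hf : Measurable f) :
    (fun u => ‖ofENN I f hf u‖ₑ) ≤ᵐ[volume.restrict I] f := by
  filter_upwards [ofENN_coe (I := I) f hf] with u hu
  simp only [hu, Real.enorm_eq_ofReal ENNReal.toReal_nonneg]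
  exact ENNReal.ofReal_toReal_le

theorem nonneg_iff_ae {x : L0 I} : 0 ≤ x ↔ ∀ᵐ u ∂(volume.restrict I), 0 ≤ x u := by
  rw [← AEEqFun.coeFn_le]
  constructor
  · intro h
    filter_upwards [h, AEEqFun.coeFn_zero (α := ℝ) (β := ℝ) (μ := volume.restrict I)] with u hu h0
    simpa [h0] using hu
  · intro h
    filter_upwards [h, AEEqFun.coeFn_zero (α := ℝ) (β := ℝ) (μ := volume.restrict I)] with u hu h0
    simpa [h0] using hu

theorem abs_le_abs_iff_ae {y x : L0 I} :
    |y| ≤ |x| ↔ ∀ᵐ u ∂(volume.restrict I), ‖y u‖ₑ ≤ ‖x u‖ₑ := by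
  rw [← AEEqFun.coeFn_le]
  have key : ∀ a b : ℝ, |a| ≤ |b| ↔ ‖a‖ₑ ≤ ‖b‖ₑ := fun a b => by
    rw [← Real.norm_eq_abs, ← Real.norm_eq_abs, enorm_le_iff_norm_le]
  constructor
  · intro h
    filter_upwards [h, AEEqFun.coeFn_abs y, AEEqFun.coeFn_abs x] with u hu h1 h2
    rw [h1, h2] at hu
    exact (key _ _).1 hu
  · intro h
    filter_upwards [h, AEEqFun.coeFn_abs y, AEEqFun.coeFn_abs x] with u hu h1 h2
    rw [h1, h2]
    exact (key _ _).2 hu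

theorem mem_L1set_iff {x : L0 I} : x ∈ L1set I ↔ ∫⁻ u in I, ‖x u‖ₑ < ∞ := by
  change x ∈ Lp ℝ 1 (volume.restrict I) ↔ _
  rw [Lp.mem_Lp_iff_eLpNorm_lt_top, eLpNorm_one_eq_lintegral_enorm]

theorem rearr_lt_top {x : L0 I} (hx : x ∈ S0 I) {t : ℝ} (ht : 0 < t) : rearr x t < ∞ := by
  obtain ⟨s, hs⟩ := hx
  set μ := volume.restrict I
  have hanti : Antitone fun n : ℕ => {u | ((s + n : ℝ≥0) : ℝ≥0∞) < ‖x u‖ₑ} := fun m n hmn u hu => by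
    have hu' : ((s + n : ℝ≥0) : ℝ≥0∞) < ‖x u‖ₑ := hu
    refine lt_of_le_of_lt ?_ hu'
    exact_mod_cast add_le_add le_rfl (Nat.cast_le.2 hmn)
  have h0 : ⋂ n : ℕ, {u | ((s + n : ℝ≥0) : ℝ≥0∞) < ‖x u‖ₑ} = ∅ := by
    refine eq_empty_iff_forall_notMem.2 fun u hu => ?_
    obtain ⟨n, hn⟩ := exists_nat_gt ‖x u‖₊
    have := mem_iInter.1 hu n
    have h1 : ((s + n : ℝ≥0) : ℝ≥0∞) < ‖x u‖ₑ := this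
    rw [enorm_eq_nnnorm, ENNReal.coe_lt_coe] at h1
    exact absurd (h1.trans hn) (not_lt.2 (le_add_of_nonneg_left zero_le))
  have hlim := tendsto_measure_iInter_atTop (μ := μ)
    (fun n : ℕ => (measurableSet_lt measurable_const (measurable_mag x)).nullMeasurableSet) hanti
    ⟨0, by simpa using hs.ne⟩
  rw [h0, measure_empty] at hlim
  obtain ⟨n, hn⟩ := (hlim.eventually (gt_mem_nhds (ENNReal.ofReal_pos.2 ht))).exists
  exact lt_of_le_of_lt (decr_le_iff.2 hn.le) ENNReal.coe_lt_top

/-- Clip `y` at the heights `±y*(1)`. The clipped part is bounded, and the rest has `L₁` norm at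
most the excess over `y*(1)`, which is bounded by `∫₀¹ y*`. -/
theorem mem_L1addLinf {y : L0 I} (h1 : rearrInt y 1 < ∞) (h2 : rearr y 1 < ∞) :
    y ∈ L1addLinf I := by
  set c : ℝ := (rearr y 1).toReal with hc
  have hc0 : 0 ≤ c := ENNReal.toReal_nonneg
  have hcE : ENNReal.ofReal c = rearr y 1 := ENNReal.ofReal_toReal h2.ne
  have hκ : Continuous fun r : ℝ => max (-c) (min r c) := by fun_prop
  set b : L0 I := AEEqFun.comp _ hκ y
  have hb := AEEqFun.coeFn_comp _ hκ y
  refine ⟨y - b, ?_, b, ?_, by abel⟩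
  · rw [Lp.mem_Lp_iff_eLpNorm_lt_top, eLpNorm_one_eq_lintegral_enorm]
    have hle : ∫⁻ u in I, ‖(y - b : L0 I) u‖ₑ ≤ exc y (rearr y 1) := by
      refine lintegral_mono_ae ?_
      filter_upwards [AEEqFun.coeFn_sub y b, hb] with u hu hub
      rw [hu, Pi.sub_apply, hub, Function.comp_apply, ← hcE, Real.enorm_eq_ofReal_abs,
        Real.enorm_eq_ofReal_abs, ← ENNReal.ofReal_sub _ hc0]
      rcases le_total (|y u|) c with h | h
      · obtain ⟨h3, h4⟩ := abs_le.1 h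
        rw [min_eq_left h4, max_eq_right h3]
        simp
      · refine ENNReal.ofReal_le_ofReal ?_
        rcases le_total 0 (y u) with h0 | h0
        · rw [abs_of_nonneg h0] at h ⊢
          rw [min_eq_right h, max_eq_right (by linarith), abs_of_nonneg (by linarith)]
        · rw [abs_of_nonpos h0] at h ⊢
          rw [min_eq_left (by linarith), max_eq_left (by linarith), abs_of_nonpos (by linarith)]
          linarith
    refine lt_of_le_of_lt hle (lt_of_le_of_lt ?_ h1)
    rw [rearrInt, decrInt_eq (aemeasurable_mag y)]
    exact le_self_add
  · rw [Lp.mem_Lp_iff_eLpNorm_lt_top]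
    refine lt_of_le_of_lt (eLpNorm_exponent_top.trans_le (eLpNormEssSup_le_of_ae_bound (C := c) ?_))
      ENNReal.ofReal_lt_top
    filter_upwards [hb] with u hub
    rw [hub, Function.comp_apply, Real.norm_eq_abs, abs_le]
    exact ⟨le_max_left _ _, max_le (by linarith) (min_le_right _ _)⟩

theorem rearr_lt_top_of_rearrInt {x : L0 I} {t : ℝ} (ht : 0 < t) (h : rearrInt x t < ∞) :
    rearr x t < ∞ := by
  have := (decr_mul_le_decrInt (volume.restrict I) (fun u => ‖x u‖ₑ) t).trans_lt h
  refine lt_top_iff_ne_top.2 fun htop => ?_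
  rw [rearr_eq_decr] at htop
  rw [htop, ENNReal.top_mul (by simpa using ht)] at this
  exact absurd this (lt_irrefl _)

theorem lintegral_eq_exc_zero (x : L0 I) : ∫⁻ u in I, ‖x u‖ₑ = exc x 0 := by
  simp [excess]

theorem rearr_eq_iff_exc {x y : L0 I} (h : rearr y = rearr x) (s : ℝ≥0∞) : exc y s = exc x s := by
  rw [exc, exc, excess_eq_lintegral_decr (aemeasurable_mag y),
    excess_eq_lintegral_decr (aemeasurable_mag x)]
  rw [rearr_eq_decr, rearr_eq_decr] at h
  rw [h]

theorem measure_lt_eq_of_rearr_eq {x y : L0 I} (h : rearr y = rearr x) (s : ℝ≥0∞) :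
    volume.restrict I {u | s < ‖y u‖ₑ} = volume.restrict I {u | s < ‖x u‖ₑ} := by
  rw [← volume_lt_decr _ (fun u => ‖y u‖ₑ), ← volume_lt_decr _ (fun u => ‖x u‖ₑ),
    ← rearr_eq_decr, ← rearr_eq_decr, h]

end Classes

/-! ### The extended norm and the consequences of full symmetry. -/

namespace SymmetricSpace

variable {I : Set ℝ} {E : SymmetricSpace I}

theorem extNorm_of_mem {x : L0 I} (h : x ∈ E.carrier) :
    E.extNorm x = ENNReal.ofReal (E.norm ⟨x, h⟩) := by
  simp [extNorm, h]

theorem extNorm_of_notMem {x : L0 I} (h : x ∉ E.carrier) : E.extNorm x = ∞ := by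
  simp [extNorm, h]

theorem extNorm_ne_top_iff {x : L0 I} : E.extNorm x ≠ ∞ ↔ x ∈ E.carrier := by
  by_cases h : x ∈ E.carrier
  · simp [extNorm_of_mem h, h]
  · simp [extNorm_of_notMem h, h]

theorem extNorm_lt_top {x : L0 I} (h : x ∈ E.carrier) : E.extNorm x < ∞ :=
  lt_top_iff_ne_top.2 (extNorm_ne_top_iff.2 h)

theorem extNorm_zero : E.extNorm (0 : L0 I) = 0 := by
  rw [extNorm_of_mem E.carrier.zero_mem]
  have : (⟨0, E.carrier.zero_mem⟩ : E.carrier) = 0 := rfl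
  rw [this, map_zero, ENNReal.ofReal_zero]

theorem extNorm_add_le (x y : L0 I) : E.extNorm (x + y) ≤ E.extNorm x + E.extNorm y := by
  by_cases hx : x ∈ E.carrier
  · by_cases hy : y ∈ E.carrier
    · rw [extNorm_of_mem hx, extNorm_of_mem hy, extNorm_of_mem (E.carrier.add_mem hx hy),
        ← ENNReal.ofReal_add (apply_nonneg _ _) (apply_nonneg _ _)]
      exact ENNReal.ofReal_le_ofReal (map_add_le_add E.norm ⟨x, hx⟩ ⟨y, hy⟩)
    · simp [extNorm_of_notMem hy]
  · simp [extNorm_of_notMem hx]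

theorem extNorm_smul_of_mem {x : L0 I} (hx : x ∈ E.carrier) (c : ℝ) :
    E.extNorm (c • x) = ENNReal.ofReal |c| * E.extNorm x := by
  rw [extNorm_of_mem hx, extNorm_of_mem (E.carrier.smul_mem c hx),
    ← ENNReal.ofReal_mul (abs_nonneg _)]
  have : (⟨c • x, E.carrier.smul_mem c hx⟩ : E.carrier) = c • ⟨x, hx⟩ := rfl
  rw [this, map_smul_eq_mul, Real.norm_eq_abs]

theorem extNorm_smul_le {c : ℝ} (hc : c ≠ 0) (x : L0 I) :
    E.extNorm (c • x) ≤ ENNReal.ofReal |c| * E.extNorm x := by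
  by_cases hx : x ∈ E.carrier
  · exact (extNorm_smul_of_mem hx c).le
  · rw [extNorm_of_notMem hx, ENNReal.mul_top (by simpa using hc)]
    exact le_top

theorem extNorm_mono {y x : L0 I} (h : ∀ᵐ u ∂(volume.restrict I), ‖y u‖ₑ ≤ ‖x u‖ₑ) :
    E.extNorm y ≤ E.extNorm x := by
  by_cases hx : x ∈ E.carrier
  · obtain ⟨hy, hle⟩ := E.ideal ⟨x, hx⟩ y (abs_le_abs_iff_ae.2 h)
    rw [extNorm_of_mem hx, extNorm_of_mem hy]
    exact ENNReal.ofReal_le_ofReal hle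
  · simp [extNorm_of_notMem hx]

theorem extNorm_sub_le (x y z : L0 I) :
    E.extNorm (x - z) ≤ E.extNorm (x - y) + E.extNorm (y - z) := by
  simpa using extNorm_add_le (E := E) (x - y) (y - z)

theorem extNorm_sum_le {ι : Type*} (s : Finset ι) (f : ι → L0 I) :
    E.extNorm (∑ i ∈ s, f i) ≤ ∑ i ∈ s, E.extNorm (f i) :=
  Finset.le_sum_of_subadditive _ extNorm_zero.le extNorm_add_le _ _

theorem extNorm_eq_of_rearr_eq {x y : L0 I} (h : rearr y = rearr x) :
    E.extNorm y = E.extNorm x := by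
  have key : ∀ a b : L0 I, rearr a = rearr b → E.extNorm a ≤ E.extNorm b := fun a b hab => by
    by_cases hb : b ∈ E.carrier
    · obtain ⟨ha, heq⟩ := E.symmetric ⟨b, hb⟩ a hab
      rw [extNorm_of_mem ha, extNorm_of_mem hb, heq]
    · simp [extNorm_of_notMem hb]
  exact le_antisymm (key _ _ h) (key _ _ h.symm)

theorem mem_of_rearr_eq {x y : L0 I} (hx : x ∈ E.carrier) (h : rearr y = rearr x) :
    y ∈ E.carrier := (E.symmetric ⟨x, hx⟩ y h).1

/-- If `∫₀ᵗ x*` were infinite, all multiples of the characteristic function of `(0,1)` would be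
submajorized by `x`. Their norms would be bounded by that of `x`, so this function would have norm
`0`, hence be `0`. -/
theorem rearrInt_lt_top (hI : IsInitialInterval I) (hE : E.IsFullySymmetric) {x : L0 I}
    (hx : x ∈ E.carrier) (t : ℝ) : rearrInt x t < ∞ := by
  set μ := volume.restrict I
  have hfin : ∀ t : ℝ, 0 < t → rearr x t < ∞ := fun t ht => rearr_lt_top (E.subset_S0 x hx) ht
  by_contra! htop
  rw [top_le_iff] at htop
  have ht : 0 < t := by
    by_contra! hle
    simp [rearrInt, decrInt_of_nonpos _ _ hle] at htop
  -- `x*` is bounded on `(r, r + t)`, so an infinite integral can only come from the neighbourhood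
  -- of `0` and is then infinite on every `(0,r)`.
  have hall : ∀ r : ℝ, 0 < r → rearrInt x r = ∞ := by
    intro r hr
    have h1 := decrInt_add_le μ (fun u => ‖x u‖ₑ) r t
    have h2 := decrInt_mono μ (fun u => ‖x u‖ₑ) (show t ≤ r + t by linarith)
    have h3 := h2.trans h1
    rw [← rearr_eq_decr] at h3
    by_contra hne
    have : rearrInt x r + rearr x r * ENNReal.ofReal t < ∞ :=
      ENNReal.add_lt_top.2 ⟨lt_top_iff_ne_top.2 hne, ENNReal.mul_lt_top (hfin r hr)
        ENNReal.ofReal_lt_top⟩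
    exact absurd (lt_of_le_of_lt h3 this) (by rw [not_lt]; exact htop.ge)
  set e : L0 I := ofENN I ((Ioo 0 1).indicator 1) (measurable_one.indicator measurableSet_Ioo)
  have hcoe : (e : ℝ → ℝ) =ᵐ[μ] (Ioo 0 1).indicator 1 := by
    filter_upwards [ofENN_coe (I := I) ((Ioo 0 1).indicator 1)
      (measurable_one.indicator measurableSet_Ioo)] with u hu
    rw [hu]
    by_cases h : u ∈ Ioo (0 : ℝ) 1 <;> simp [h]
  have hmem : ∀ k : ℕ, ((k : ℝ) • e) ∈ L1addLinf I := by
    intro k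
    refine ⟨0, zero_mem _, _, ?_, (zero_add _).symm⟩
    rw [Lp.mem_Lp_iff_eLpNorm_lt_top]
    refine lt_of_le_of_lt (eLpNorm_exponent_top.trans_le
      (eLpNormEssSup_le_of_ae_bound (C := k) ?_)) ENNReal.ofReal_lt_top
    filter_upwards [AEEqFun.coeFn_smul (k : ℝ) e, hcoe] with u hu hu'
    rw [hu, Pi.smul_apply, hu']
    by_cases h : u ∈ Ioo (0 : ℝ) 1 <;> simp [h]
  have hsub : ∀ k : ℕ, Submajorized ((k : ℝ) • e) x := by
    intro k r hr
    rcases hr.eq_or_lt with h0 | h0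
    · simp [← h0]
    · change _ ≤ rearrInt x r
      rw [hall r h0]; exact le_top
  have hk : ∀ k : ℕ, ∃ he : ((k : ℝ) • e) ∈ E.carrier, E.norm ⟨_, he⟩ ≤ E.norm ⟨x, hx⟩ := fun k =>
    hE ⟨x, hx⟩ _ (hmem k) (hsub k)
  have he : e ∈ E.carrier := by
    obtain ⟨h, -⟩ := hk 1
    simpa using h
  have hnorm : E.norm ⟨e, he⟩ = 0 := by
    by_contra hne
    have hpos : 0 < E.norm ⟨e, he⟩ := lt_of_le_of_ne (apply_nonneg _ _) (Ne.symm hne)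
    obtain ⟨k, hk'⟩ := exists_nat_gt (E.norm ⟨x, hx⟩ / E.norm ⟨e, he⟩)
    obtain ⟨h, hle⟩ := hk k
    have heq : (⟨(k : ℝ) • e, h⟩ : E.carrier) = (k : ℝ) • ⟨e, he⟩ := rfl
    rw [heq, map_smul_eq_mul, Real.norm_natCast] at hle
    rw [div_lt_iff₀ hpos] at hk'
    linarith
  have h0 := E.eq_zero_of_norm_eq_zero ⟨e, he⟩ hnorm
  have h0' : e = 0 := congrArg Subtype.val h0
  apply hI.volume_Ioo_ne_zero
  have hz : ∀ᵐ u ∂μ, u ∉ Ioo (0 : ℝ) 1 := by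
    filter_upwards [hcoe, AEEqFun.coeFn_zero (α := ℝ) (β := ℝ) (μ := μ)] with u hu hu0 hmem
    rw [h0', hu0] at hu
    simp [hmem] at hu
  exact measure_eq_zero_iff_ae_notMem.2 hz

/-- The side condition `y ∈ L₁ + L_∞` in full symmetry is automatic: `∫₀¹ y* ≤ ∫₀¹ x* < ∞`. -/
theorem extNorm_le_of_submajorized (hI : IsInitialInterval I) (hE : E.IsFullySymmetric)
    {y x : L0 I} (h : Submajorized y x) : E.extNorm y ≤ E.extNorm x := by
  by_cases hx : x ∈ E.carrier
  · have h1 : rearrInt y 1 < ∞ := (h 1 zero_le_one).trans_lt (rearrInt_lt_top hI hE hx 1)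
    obtain ⟨hy, hle⟩ := hE ⟨x, hx⟩ y (mem_L1addLinf h1 (rearr_lt_top_of_rearrInt one_pos h1)) h
    rw [extNorm_of_mem hx, extNorm_of_mem hy]
    exact ENNReal.ofReal_le_ofReal hle
  · simp [extNorm_of_notMem hx]

end SymmetricSpace

/-! ### Initial segments of sets of positive reals -/

section Cumulative

/-- The measure of the part of `C` to the left of `ρ`. -/
def cumul (C : Set ℝ) (ρ : ℝ) : ℝ := volume.real (C ∩ Iio ρ)

variable {C : Set ℝ}

theorem volume_inter_Iio_lt_top (hC : C ⊆ Ioi 0) (ρ : ℝ) : volume (C ∩ Iio ρ) < ∞ :=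
  lt_of_le_of_lt (measure_mono (show C ∩ Iio ρ ⊆ Ioo 0 ρ from fun _ hu => ⟨hC hu.1, hu.2⟩))
    measure_Ioo_lt_top

theorem ofReal_cumul (hC : C ⊆ Ioi 0) (ρ : ℝ) :
    ENNReal.ofReal (cumul C ρ) = volume (C ∩ Iio ρ) :=
  ENNReal.ofReal_toReal (volume_inter_Iio_lt_top hC ρ).ne

theorem cumul_nonneg (C : Set ℝ) (ρ : ℝ) : 0 ≤ cumul C ρ := measureReal_nonneg

theorem cumul_mono (hC : C ⊆ Ioi 0) : Monotone (cumul C) := fun _ b hab =>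
  measureReal_mono (inter_subset_inter_right _ (Iio_subset_Iio hab))
    (volume_inter_Iio_lt_top hC b).ne

theorem cumul_of_nonpos (hC : C ⊆ Ioi 0) {ρ : ℝ} (hρ : ρ ≤ 0) : cumul C ρ = 0 := by
  have : C ∩ Iio ρ = ∅ := eq_empty_iff_forall_notMem.2 fun u hu =>
    absurd (show 0 < u from hC hu.1) (not_lt.2 ((show u < ρ from hu.2).le.trans hρ))
  simp [cumul, this]

theorem cumul_sub_le (hC : C ⊆ Ioi 0) {a b : ℝ} (hab : a ≤ b) : cumul C b - cumul C a ≤ b - a := by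
  have hsub : C ∩ Iio b ⊆ (C ∩ Iio a) ∪ Ico a b := fun u hu => by
    rcases lt_or_ge u a with h | h
    · exact Or.inl ⟨hu.1, h⟩
    · exact Or.inr ⟨h, hu.2⟩
  have h1 : cumul C b ≤ volume.real ((C ∩ Iio a) ∪ Ico a b) :=
    measureReal_mono hsub (measure_union_lt_top (volume_inter_Iio_lt_top hC a) (by simp)).ne
  have h2 := measureReal_union_le (μ := volume) (C ∩ Iio a) (Ico a b)
  rw [Real.volume_real_Ico_of_le hab] at h2
  unfold cumul at *
  linarith

theorem continuous_cumul (hC : C ⊆ Ioi 0) : Continuous (cumul C) := by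
  refine LipschitzWith.continuous (K := 1) (LipschitzWith.of_dist_le_mul fun a b => ?_)
  rw [NNReal.coe_one, one_mul]
  wlog hab : a ≤ b generalizing a b
  · rw [dist_comm, dist_comm a]
    exact this b a (le_of_not_ge hab)
  rw [dist_comm, dist_comm a, Real.dist_eq, Real.dist_eq,
    abs_of_nonneg (sub_nonneg.2 (cumul_mono hC hab)), abs_of_nonneg (sub_nonneg.2 hab)]
  exact cumul_sub_le hC hab

/-- Intermediate values of the continuous function `cumul C`. The inequality is strict because the
full measure of an unbounded set may be reached only in the limit. -/
theorem exists_volume_inter_Iio_eq (hC : C ⊆ Ioi 0) {v : ℝ≥0∞} (hv : v < volume C) :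
    ∃ ρ, volume (C ∩ Iio ρ) = v := by
  have hU : C = ⋃ n : ℕ, C ∩ Iio (n : ℝ) := by
    rw [← inter_iUnion]
    refine (inter_eq_left.2 fun u _ => ?_).symm
    obtain ⟨n, hn⟩ := exists_nat_gt u
    exact mem_iUnion.2 ⟨n, hn⟩
  have hmono : Monotone fun n : ℕ => C ∩ Iio (n : ℝ) := fun m n h =>
    inter_subset_inter_right _ (Iio_subset_Iio (by exact_mod_cast h))
  rw [hU, hmono.measure_iUnion, lt_iSup_iff] at hv
  obtain ⟨n, hn⟩ := hv
  have hvt : v ≠ ∞ := (hn.trans (volume_inter_Iio_lt_top hC n)).ne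
  have hmem : v.toReal ∈ Icc (cumul C 0) (cumul C n) := by
    rw [cumul_of_nonpos hC le_rfl]
    exact ⟨ENNReal.toReal_nonneg, (ENNReal.toReal_le_toReal hvt
      (volume_inter_Iio_lt_top hC n).ne).2 hn.le⟩
  obtain ⟨ρ, -, hρ⟩ := intermediate_value_Icc (Nat.cast_nonneg n)
    (continuous_cumul hC).continuousOn hmem
  exact ⟨ρ, by rw [← ofReal_cumul hC, hρ, ENNReal.ofReal_toReal hvt]⟩

theorem exists_pos_split (hC : C ⊆ Ioi 0) (hCm : MeasurableSet C) (h0 : volume C ≠ 0)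
    (htop : volume C ≠ ∞) :
    ∃ C₁ C₂ : Set ℝ, MeasurableSet C₁ ∧ MeasurableSet C₂ ∧ C₁ ⊆ C ∧ C₂ ⊆ C ∧ Disjoint C₁ C₂ ∧
      volume C₁ ≠ 0 ∧ volume C₂ ≠ 0 := by
  have hhalf : volume C / 2 < volume C := ENNReal.half_lt_self h0 htop
  obtain ⟨ρ, hρ⟩ := exists_volume_inter_Iio_eq hC hhalf
  refine ⟨C ∩ Iio ρ, C \ Iio ρ, hCm.inter measurableSet_Iio, hCm.diff measurableSet_Iio,
    inter_subset_left, sdiff_subset, disjoint_sdiff_inter.symm, ?_, fun h => ?_⟩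
  · rw [hρ]
    simpa using h0
  · have := measure_inter_add_sdiff (μ := volume) C (measurableSet_Iio (a := ρ))
    rw [h, hρ, add_zero] at this
    exact hhalf.ne this

end Cumulative

/-! ### Extreme points of `Ω'(x)` -/

section Extreme

variable {I : Set ℝ}

theorem exc_ofReal {z : L0 I} (hz : 0 ≤ z) {s : ℝ} (hs : 0 ≤ s) :
    exc z (ENNReal.ofReal s) = ∫⁻ u in I, ENNReal.ofReal (z u - s) := by
  refine lintegral_congr_ae ?_
  filter_upwards [nonneg_iff_ae.1 hz] with u hu
  rw [Real.enorm_eq_ofReal hu, ENNReal.ofReal_sub _ hs]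

theorem eLpNorm_one_eq_exc (z : L0 I) : eLpNorm z 1 (volume.restrict I) = exc z 0 := by
  rw [eLpNorm_one_eq_lintegral_enorm, lintegral_eq_exc_zero]

theorem exc_lt_top {z : L0 I} (hz : z ∈ L1set I) (s : ℝ≥0∞) : exc z s < ∞ :=
  lt_of_le_of_lt (lintegral_mono fun _ => tsub_le_self) (mem_L1set_iff.1 hz)

theorem mem_L1set_of_rearr_eq {x z : L0 I} (hx : x ∈ L1set I) (h : rearr z = rearr x) :
    z ∈ L1set I := by
  rw [mem_L1set_iff, lintegral_eq_exc_zero, rearr_eq_iff_exc h, ← lintegral_eq_exc_zero]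
  exact mem_L1set_iff.1 hx

theorem mem_OmegaPrime_iff {x y : L0 I} : y ∈ OmegaPrime x ↔
    0 ≤ y ∧ y ∈ L1set I ∧ (∀ s : ℝ≥0∞, s ≠ ∞ → exc y s ≤ exc x s) ∧ exc y 0 = exc x 0 := by
  unfold OmegaPrime
  simp only [mem_ofPred_eq, eLpNorm_one_eq_exc]
  exact and_congr_right fun _ => and_congr_right fun _ => and_congr_left fun _ =>
    ⟨fun h s hs => h.exc_le hs, submajorized_of_exc_le⟩

/-- If `z = α a + β b`, convexity gives `(z - q)₊ ≤ α (a - q)₊ + β (b - q)₊`. The integrals satisfy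
the opposite inequality, because the excesses of `a` and `b` are at most that of `x`, which equals
the finite excess of `z`. So equality holds almost everywhere for all rational `q ≥ 0` at once, and
a rational strictly between `a u` and `b u` would violate it. -/
theorem mem_extremePoints_of_rearr_eq {x z : L0 I} (hx : x ∈ L1set I) (hz : 0 ≤ z)
    (h : rearr z = rearr x) : z ∈ (OmegaPrime x).extremePoints ℝ := by
  have hexc := rearr_eq_iff_exc h
  have hzL := mem_L1set_of_rearr_eq hx h
  rw [mem_extremePoints_iff_left]
  refine ⟨mem_OmegaPrime_iff.2 ⟨hz, hzL, fun s _ => (hexc s).le, hexc 0⟩, ?_⟩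
  rintro a ha b hb ⟨α, β, hα, hβ, hαβ, hab⟩
  rw [mem_OmegaPrime_iff] at ha hb
  have ha0 := nonneg_iff_ae.1 ha.1
  have hb0 := nonneg_iff_ae.1 hb.1
  have hz_eq : ∀ᵐ u ∂(volume.restrict I), z u = α * a u + β * b u := by
    rw [← hab]
    filter_upwards [AEEqFun.coeFn_add (α • a) (β • b), AEEqFun.coeFn_smul α a,
      AEEqFun.coeFn_smul β b] with u h1 h2 h3
    rw [h1, Pi.add_apply, h2, h3]
    simp
  have key : ∀ q : ℚ, 0 ≤ (q : ℝ) → ∀ᵐ u ∂(volume.restrict I),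
      ENNReal.ofReal (z u - q) =
        ENNReal.ofReal α * ENNReal.ofReal (a u - q) + ENNReal.ofReal β * ENNReal.ofReal (b u - q) := by
    intro q hq
    have hma : Measurable fun u => ENNReal.ofReal (a u - q) :=
      (a.measurable.sub_const _).ennreal_ofReal
    have hmb : Measurable fun u => ENNReal.ofReal (b u - q) :=
      (b.measurable.sub_const _).ennreal_ofReal
    refine ae_eq_of_ae_le_of_lintegral_le ?_ ?_ ?_ ?_
    · filter_upwards [hz_eq] with u hu
      rw [← ENNReal.ofReal_mul hα.le, ← ENNReal.ofReal_mul hβ.le, hu]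
      refine le_trans (ENNReal.ofReal_le_ofReal (le_of_eq ?_)) ENNReal.ofReal_add_le
      linear_combination (-(q : ℝ)) * hαβ.symm
    · rw [← exc_ofReal hz hq]
      exact (exc_lt_top hzL _).ne
    · exact ((hma.const_mul _).add (hmb.const_mul _)).aemeasurable
    · rw [lintegral_add_left (hma.const_mul _), lintegral_const_mul _ hma,
        lintegral_const_mul _ hmb, ← exc_ofReal hz hq, ← exc_ofReal ha.1 hq, ← exc_ofReal hb.1 hq,
        hexc]
      calc _ ≤ ENNReal.ofReal α * exc x (ENNReal.ofReal q) +
            ENNReal.ofReal β * exc x (ENNReal.ofReal q) := by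
              gcongr
              · exact ha.2.2.1 _ ENNReal.ofReal_ne_top
              · exact hb.2.2.1 _ ENNReal.ofReal_ne_top
        _ = exc x (ENNReal.ofReal q) := by
              rw [← add_mul, ← ENNReal.ofReal_add hα.le hβ.le, hαβ, ENNReal.ofReal_one, one_mul]
  have key' : ∀ᵐ u ∂(volume.restrict I), ∀ q : ℚ, 0 ≤ (q : ℝ) →
      ENNReal.ofReal (z u - q) =
        ENNReal.ofReal α * ENNReal.ofReal (a u - q) +
          ENNReal.ofReal β * ENNReal.ofReal (b u - q) :=
    ae_all_iff.2 fun q => by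
      by_cases hq : 0 ≤ (q : ℝ)
      · filter_upwards [key q hq] with u hu _ using hu
      · exact ae_of_all _ fun u h => absurd h hq
  have strict : ∀ p r α β : ℝ, 0 < α → 0 < β → α + β = 1 → 0 ≤ p → p < r →
      (∀ q : ℚ, 0 ≤ (q : ℝ) → ENNReal.ofReal ((α * p + β * r) - q) =
        ENNReal.ofReal α * ENNReal.ofReal (p - q) + ENNReal.ofReal β * ENNReal.ofReal (r - q)) →
      False := by
    intro p r α β hα hβ hαβ hp hpr hq
    obtain ⟨q, hpq, hqr⟩ := exists_rat_btwn hpr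
    have h1 := hq q (hp.trans hpq.le)
    rw [ENNReal.ofReal_of_nonpos (by linarith : p - q ≤ 0), mul_zero, zero_add,
      ← ENNReal.ofReal_mul hβ.le] at h1
    have h2 : 0 < β * (r - q) := mul_pos hβ (by linarith)
    have h3 : 0 < (α * p + β * r) - q := by
      rw [← ENNReal.ofReal_pos, h1, ENNReal.ofReal_pos]
      exact h2
    have h4 := (ENNReal.ofReal_eq_ofReal_iff h3.le h2.le).1 h1
    have h5 : α * (p - q) = 0 := by
      have : α * p + β * r - q = α * (p - q) + β * (r - q) := by
        linear_combination (-(q : ℝ)) * hαβ.symm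
      linarith
    rcases mul_eq_zero.1 h5 with h6 | h6 <;> linarith
  refine AEEqFun.ext ?_
  filter_upwards [key', hz_eq, ha0, hb0] with u hq hu hau hbu
  rcases lt_trichotomy (a u) (b u) with hlt | heq | hlt
  · exact (strict (a u) (b u) α β hα hβ hαβ hau hlt fun q hq0 => by rw [← hu]; exact hq q hq0).elim
  · rw [hu, ← heq, ← add_mul, hαβ, one_mul]
  · refine (strict (b u) (a u) β α hβ hα (by linarith) hbu hlt fun q hq0 => ?_).elim
    rw [add_comm (β * b u), ← hu, hq q hq0, add_comm]

/-- `∫ (z - |s|)₊` as a real number. -/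
def realExc (I : Set ℝ) (z : ℝ → ℝ) (s : ℝ) : ℝ := ∫ u in I, max (z u - |s|) 0

theorem integrable_max_sub {μ : Measure ℝ} {z : ℝ → ℝ} (hz : Integrable z μ) (s : ℝ) :
    Integrable (fun u => max (z u - |s|) 0) μ := by
  refine hz.norm.mono' ((hz.aestronglyMeasurable.sub aestronglyMeasurable_const).sup
    aestronglyMeasurable_const) (ae_of_all _ fun u => ?_)
  rw [Real.norm_eq_abs, Real.norm_eq_abs, abs_of_nonneg (le_max_right _ _)]
  exact max_le ((sub_le_self _ (abs_nonneg _)).trans (le_abs_self _)) (abs_nonneg _)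

/-- Continuity on the whole line relies on the absolute value in `realExc`: for `s < 0` the function
`max (z - s) 0` need not be integrable over a set of infinite measure. -/
theorem continuous_realExc {z : ℝ → ℝ} (hz : Integrable z (volume.restrict I)) :
    Continuous (realExc I z) := by
  refine continuous_of_dominated (bound := fun u => ‖z u‖)
    (fun s => (integrable_max_sub hz s).aestronglyMeasurable) (fun s => ae_of_all _ fun u => ?_)
    hz.norm (ae_of_all _ fun u => by fun_prop)
  rw [Real.norm_eq_abs, Real.norm_eq_abs, abs_of_nonneg (le_max_right _ _)]
  exact max_le ((sub_le_self _ (abs_nonneg _)).trans (le_abs_self _)) (abs_nonneg _)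

theorem integrable_of_mem_L1set {z : L0 I} (hz : z ∈ L1set I) :
    Integrable z (volume.restrict I) :=
  ⟨z.aestronglyMeasurable, mem_L1set_iff.1 hz⟩

theorem exc_eq_realExc {z : L0 I} (h0 : 0 ≤ z) (hz : z ∈ L1set I) {s : ℝ} (hs : 0 ≤ s) :
    exc z (ENNReal.ofReal s) = ENNReal.ofReal (realExc I z s) := by
  rw [exc_ofReal h0 hs, realExc, ofReal_integral_eq_lintegral_ofReal
    (integrable_max_sub (integrable_of_mem_L1set hz) s) (ae_of_all _ fun u => le_max_right _ _)]
  refine lintegral_congr fun u => ?_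
  rw [abs_of_nonneg hs]
  rcases le_total (z u - s) 0 with h | h
  · rw [max_eq_right h, ENNReal.ofReal_of_nonpos h, ENNReal.ofReal_zero]
  · rw [max_eq_left h]

theorem realExc_nonneg (z : ℝ → ℝ) (s : ℝ) : 0 ≤ realExc I z s :=
  integral_nonneg fun _ => le_max_right _ _

theorem realExc_congr {z w : ℝ → ℝ} (h : z =ᵐ[volume.restrict I] w) (s : ℝ) :
    realExc I z s = realExc I w s :=
  integral_congr_ae (h.mono fun u hu => by simp only [hu])

theorem mem_OmegaPrime_iff_realExc {x y : L0 I} (hx0 : 0 ≤ x) (hx : x ∈ L1set I) :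
    y ∈ OmegaPrime x ↔ 0 ≤ y ∧ y ∈ L1set I ∧ (∀ s : ℝ, 0 ≤ s → realExc I y s ≤ realExc I x s) ∧
      realExc I y 0 = realExc I x 0 := by
  rw [mem_OmegaPrime_iff]
  refine and_congr_right fun hy0 => and_congr_right fun hy => and_congr ?_ ?_
  · constructor
    · intro h s hs
      have := h (ENNReal.ofReal s) ENNReal.ofReal_ne_top
      rw [exc_eq_realExc hy0 hy hs, exc_eq_realExc hx0 hx hs] at this
      exact (ENNReal.ofReal_le_ofReal_iff (realExc_nonneg _ _)).1 this
    · intro h s hs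
      rw [← ENNReal.ofReal_toReal hs, exc_eq_realExc hy0 hy ENNReal.toReal_nonneg,
        exc_eq_realExc hx0 hx ENNReal.toReal_nonneg]
      exact ENNReal.ofReal_le_ofReal (h _ ENNReal.toReal_nonneg)
  · have h1 := exc_eq_realExc hy0 hy le_rfl
    have h2 := exc_eq_realExc hx0 hx le_rfl
    rw [ENNReal.ofReal_zero] at h1 h2
    rw [h1, h2, ENNReal.ofReal_eq_ofReal_iff (realExc_nonneg _ _) (realExc_nonneg _ _)]

/-- A perturbation with zero mean that stays between two levels. -/
theorem realExc_perturb_le {z h : ℝ → ℝ} (hz : Integrable z (volume.restrict I))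
    (hh : Integrable h (volume.restrict I)) {α β : ℝ}
    (hb : ∀ u, h u ≠ 0 → α ≤ z u ∧ z u ≤ β ∧ α ≤ z u + h u ∧ z u + h u ≤ β)
    (hh0 : ∫ u in I, h u = 0) {δ : ℝ} (hδ : ∫ u in I, |h u| ≤ δ) {g : ℝ → ℝ}
    (hg : ∀ s, 0 ≤ s → realExc I z s ≤ g s)
    (hgδ : ∀ s ∈ Icc α β, realExc I z s + δ ≤ g s) {s : ℝ} (hs : 0 ≤ s) :
    realExc I (fun u => z u + h u) s ≤ g s := by
  have hint := integrable_max_sub hz s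
  rcases lt_or_ge s α with h1 | h1
  · refine le_trans (le_of_eq ?_) (hg s hs)
    calc realExc I (fun u => z u + h u) s = ∫ u in I, (max (z u - |s|) 0 + h u) := by
          refine integral_congr_ae (ae_of_all _ fun u => ?_)
          by_cases h0 : h u = 0
          · simp [h0]
          · obtain ⟨k1, -, k3, -⟩ := hb u h0
            rw [abs_of_nonneg hs]
            simp only
            rw [max_eq_left (by linarith), max_eq_left (by linarith)]
            ring
      _ = _ := by rw [integral_add hint hh, hh0, add_zero, realExc]
  rcases lt_or_ge β s with h2 | h2
  -- Above `β`, neither `z` nor `z + h` contributes on the support of `h`.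
  · refine le_trans (le_of_eq (integral_congr_ae (ae_of_all _ fun u => ?_))) (hg s hs)
    by_cases h0 : h u = 0
    · simp [h0]
    · obtain ⟨-, k2, -, k4⟩ := hb u h0
      rw [abs_of_nonneg hs]
      simp only
      rw [max_eq_right (by linarith), max_eq_right (by linarith)]
  -- Between the levels the excess grows by at most `∫ |h| ≤ δ`, which the gap `δ` absorbs.
  · refine le_trans ?_ (hgδ s ⟨h1, h2⟩)
    calc realExc I (fun u => z u + h u) s ≤ ∫ u in I, (max (z u - |s|) 0 + |h u|) := by
          refine integral_mono (integrable_max_sub (hz.add hh) s) (hint.add hh.abs) fun u => ?_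
          have := le_abs_self (h u)
          have h3 := le_max_left (z u - |s|) 0
          have h4 := le_max_right (z u - |s|) 0
          exact max_le (by linarith) (by have := abs_nonneg (h u); linarith)
      _ ≤ _ := by rw [integral_add hint hh.abs]; exact add_le_add le_rfl hδ

/-- The margin `η` leaves room for a perturbation of size `η` inside `[α, β]`. On `C` one has `y ≥
η`, so Markov's inequality gives `C` finite measure. -/
theorem exists_pos_subset_Icc {y : L0 I} (hI : IsInitialInterval I) (hy : y ∈ L1set I) {α β : ℝ}
    (hα : 0 ≤ α) (h : volume.restrict I {u | α < y u ∧ y u < β} ≠ 0) :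
    ∃ η > 0, ∃ C ⊆ I, MeasurableSet C ∧ volume C ≠ 0 ∧ volume C ≠ ∞ ∧
      ∀ u ∈ C, α + η ≤ y u ∧ y u ≤ β - η := by
  have hU : {u | α < y u ∧ y u < β} ⊆
      ⋃ n : ℕ, {u | α + 1 / (n + 1 : ℝ) ≤ y u ∧ y u ≤ β - 1 / (n + 1 : ℝ)} := by
    intro u hu
    have h1 : α < y u := hu.1
    have h2 : y u < β := hu.2
    obtain ⟨n, hn⟩ := exists_nat_one_div_lt (lt_min (sub_pos.2 h1) (sub_pos.2 h2))
    have h3 := (lt_min_iff.1 hn).1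
    have h4 := (lt_min_iff.1 hn).2
    exact mem_iUnion.2 ⟨n, by constructor <;> linarith⟩
  have hne : volume.restrict I
      (⋃ n : ℕ, {u | α + 1 / (n + 1 : ℝ) ≤ y u ∧ y u ≤ β - 1 / (n + 1 : ℝ)}) ≠ 0 := fun h0 =>
    h (measure_mono_null hU h0)
  rw [Ne, measure_iUnion_null_iff, not_forall] at hne
  obtain ⟨n, hn⟩ := hne
  have hη : (0 : ℝ) < 1 / (n + 1 : ℝ) := by positivity
  set η : ℝ := 1 / (n + 1 : ℝ)
  have hm : MeasurableSet {u | α + η ≤ y u ∧ y u ≤ β - η} :=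
    (measurableSet_le measurable_const y.measurable).inter
      (measurableSet_le y.measurable measurable_const)
  rw [Measure.restrict_apply hm] at hn
  refine ⟨η, hη, _, inter_subset_right, hm.inter hI.measurableSet, hn, ?_, fun u hu => hu.1⟩
  have h1 := meas_ge_le_lintegral_div (μ := volume.restrict I) (aemeasurable_mag y)
    (ε := ENNReal.ofReal η) (by simpa using hη) ENNReal.ofReal_ne_top
  have h2 : volume ({u | α + η ≤ y u ∧ y u ≤ β - η} ∩ I) ≤
      volume.restrict I {u | ENNReal.ofReal η ≤ ‖y u‖ₑ} := by
    rw [← Measure.restrict_apply hm]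
    refine measure_mono fun u hu => ?_
    have : α + η ≤ y u := hu.1
    change ENNReal.ofReal η ≤ ‖y u‖ₑ
    rw [Real.enorm_eq_ofReal (by linarith)]
    exact ENNReal.ofReal_le_ofReal (by linarith)
  refine (lt_of_le_of_lt (h2.trans h1) (ENNReal.div_lt_top (mem_L1set_iff.1 hy).ne ?_)).ne
  simpa using hη

theorem add_mk_mem_OmegaPrime {x y : L0 I} (hx0 : 0 ≤ x) (hx : x ∈ L1set I)
    (hy : y ∈ OmegaPrime x) {α β η δ : ℝ} (hα : 0 ≤ α) (hη : 0 ≤ η)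
    (hδ : ∀ s ∈ Icc α β, realExc I y s + δ ≤ realExc I x s) {k : ℝ → ℝ} (hk : Measurable k)
    (hkI : Integrable k (volume.restrict I))
    (hb : ∀ u, k u ≠ 0 → (α + η ≤ y u ∧ y u ≤ β - η) ∧ |k u| ≤ η) (hk0 : ∫ u in I, k u = 0)
    (hkδ : ∫ u in I, |k u| ≤ δ) :
    y + AEEqFun.mk k hk.aestronglyMeasurable ∈ OmegaPrime x := by
  obtain ⟨hy0, hyL, hle, heq⟩ := (mem_OmegaPrime_iff_realExc hx0 hx).1 hy
  have hyI := integrable_of_mem_L1set hyL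
  have hcoe : (y + AEEqFun.mk k hk.aestronglyMeasurable : L0 I) =ᵐ[volume.restrict I]
      fun u => y u + k u := by
    filter_upwards [AEEqFun.coeFn_add y (AEEqFun.mk k hk.aestronglyMeasurable),
      AEEqFun.coeFn_mk k (hk.aestronglyMeasurable (μ := volume.restrict I))] with u h1 h2
    rw [h1, Pi.add_apply, h2]
  have hnn : ∀ᵐ u ∂(volume.restrict I), 0 ≤ y u + k u := by
    filter_upwards [nonneg_iff_ae.1 hy0] with u hu
    by_cases h0 : k u = 0
    · rw [h0, add_zero]; exact hu
    · obtain ⟨⟨h1, -⟩, h2⟩ := hb u h0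
      have := neg_le_of_abs_le h2
      linarith
  have hint : Integrable (fun u => y u + k u) (volume.restrict I) := hyI.add hkI
  rw [mem_OmegaPrime_iff_realExc hx0 hx]
  refine ⟨nonneg_iff_ae.2 ?_, ?_, fun s hs => ?_, ?_⟩
  · filter_upwards [hcoe, hnn] with u hu h
    rw [hu]; exact h
  · rw [mem_L1set_iff, lintegral_congr_ae (hcoe.mono fun u hu => by rw [hu])]
    exact hint.2
  · rw [realExc_congr hcoe]
    refine realExc_perturb_le (α := α) (β := β) hyI hkI (fun u hu => ?_) hk0 hkδ hle hδ hs
    obtain ⟨⟨h1, h2⟩, h3⟩ := hb u hu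
    obtain ⟨h4, h5⟩ := abs_le.1 h3
    refine ⟨?_, ?_, ?_, ?_⟩ <;> linarith
  · rw [← heq, realExc_congr hcoe]
    have e1 : realExc I (fun u => y u + k u) 0 = ∫ u in I, (y u + k u) :=
      integral_congr_ae (hnn.mono fun u hu => by simp [hu])
    have e2 : realExc I y 0 = ∫ u in I, y u :=
      integral_congr_ae ((nonneg_iff_ae.1 hy0).mono fun u hu => by simp [hu])
    rw [e1, e2, integral_add hyI hkI, hk0, add_zero]

/-- On the compact interval `[α, β]` the excess of `y` stays below that of `x` by some `δ > 0`. If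
`y` took values in `(α, β)` on a set of positive measure, a small amount of mass could be moved
between two disjoint parts of that set in either direction without leaving `Ω'(x)`, and `y` would be
a proper midpoint. -/
theorem measure_between_eq_zero {x y : L0 I} (hI : IsInitialInterval I) (hx0 : 0 ≤ x)
    (hx : x ∈ L1set I) (hy : y ∈ (OmegaPrime x).extremePoints ℝ) {α β : ℝ} (hα : 0 ≤ α)
    (hαβ : α ≤ β) (hlt : ∀ s ∈ Icc α β, realExc I y s < realExc I x s) :
    volume.restrict I {u | α < y u ∧ y u < β} = 0 := by
  by_contra hne
  have hyΩ := hy.1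
  obtain ⟨hy0, hyL, hle, heq⟩ := (mem_OmegaPrime_iff_realExc hx0 hx).1 hyΩ
  have hyI := integrable_of_mem_L1set hyL
  have hxI := integrable_of_mem_L1set hx
  obtain ⟨η, hη, C, hCI, hCm, hC0, hCt, hC⟩ := exists_pos_subset_Icc hI hyL hα hne
  obtain ⟨C₁, C₂, hC₁m, hC₂m, hC₁, hC₂, hdisj, h₁, h₂⟩ :=
    exists_pos_split (fun u hu => hI.pos u (hCI hu)) hCm hC0 hCt
  obtain ⟨s₀, hs₀, hmin⟩ := isCompact_Icc.exists_isMinOn (nonempty_Icc.2 hαβ)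
    (((continuous_realExc (I := I) hxI).sub (continuous_realExc hyI)).continuousOn)
  set δ : ℝ := realExc I x s₀ - realExc I y s₀ with hδ
  have hδ0 : 0 < δ := sub_pos.2 (hlt s₀ hs₀)
  have hδle : ∀ s ∈ Icc α β, realExc I y s + δ ≤ realExc I x s := fun s hs => by
    have : δ ≤ realExc I x s - realExc I y s := hmin hs
    linarith
  set m₁ : ℝ := volume.real C₁
  set m₂ : ℝ := volume.real C₂
  have ht₁ : volume C₁ ≠ ∞ := ((measure_mono hC₁).trans_lt (lt_top_iff_ne_top.2 hCt)).ne
  have ht₂ : volume C₂ ≠ ∞ := ((measure_mono hC₂).trans_lt (lt_top_iff_ne_top.2 hCt)).ne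
  have hm₁ : 0 < m₁ := ENNReal.toReal_pos h₁ ht₁
  have hm₂ : 0 < m₂ := ENNReal.toReal_pos h₂ ht₂
  -- The first two bounds give `|h| ≤ η`, the third gives `∫ |h| ≤ 2 ε m₁ m₂ ≤ δ`.
  obtain ⟨ε, hε, hε1, hε2, hε3⟩ : ∃ ε > 0, ε * m₁ ≤ η ∧ ε * m₂ ≤ η ∧ 2 * (ε * m₁ * m₂) ≤ δ := by
    refine ⟨min (η / m₁) (min (η / m₂) (δ / (2 * (m₁ * m₂)))), by positivity, ?_, ?_, ?_⟩
    · rw [← le_div_iff₀ hm₁]; exact min_le_left _ _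
    · rw [← le_div_iff₀ hm₂]; exact (min_le_right _ _).trans (min_le_left _ _)
    · rw [show ∀ a : ℝ, 2 * (a * m₁ * m₂) = a * (2 * (m₁ * m₂)) from fun a => by ring,
        ← le_div_iff₀ (by positivity)]
      exact (min_le_right _ _).trans (min_le_right _ _)
  -- Each set is weighted by the measure of the other one, so that `∫ h = 0`.
  set h : ℝ → ℝ := fun u => C₁.indicator (fun _ => ε * m₂) u - C₂.indicator (fun _ => ε * m₁) u
    with hh
  have hC₁I : volume.restrict I C₁ = volume C₁ :=
    Measure.restrict_eq_self _ (hC₁.trans hCI)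
  have hC₂I : volume.restrict I C₂ = volume C₂ :=
    Measure.restrict_eq_self _ (hC₂.trans hCI)
  have hi₁ : Integrable (C₁.indicator fun _ => ε * m₂) (volume.restrict I) :=
    (integrable_indicator_iff hC₁m).2 (integrableOn_const (by rw [hC₁I]; exact ht₁) enorm_ne_top)
  have hi₂ : Integrable (C₂.indicator fun _ => ε * m₁) (volume.restrict I) :=
    (integrable_indicator_iff hC₂m).2 (integrableOn_const (by rw [hC₂I]; exact ht₂) enorm_ne_top)
  have hhI : Integrable h (volume.restrict I) := hi₁.sub hi₂
  have hI₁ : ∫ u in I, C₁.indicator (fun _ => ε * m₂) u = ε * m₁ * m₂ := by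
    rw [integral_indicator_const _ hC₁m, Measure.real, hC₁I, smul_eq_mul]
    change m₁ * _ = _
    ring
  have hI₂ : ∫ u in I, C₂.indicator (fun _ => ε * m₁) u = ε * m₁ * m₂ := by
    rw [integral_indicator_const _ hC₂m, Measure.real, hC₂I, smul_eq_mul]
    change m₂ * _ = _
    ring
  have hh0 : ∫ u in I, h u = 0 := by
    rw [hh, integral_sub hi₁ hi₂, hI₁, hI₂, sub_self]
  have hhabs : ∫ u in I, |h u| ≤ δ := by
    refine le_trans ?_ hε3
    rw [two_mul, ← add_zero (ε * m₁ * m₂ + ε * m₁ * m₂), add_zero]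
    nth_rewrite 1 [← hI₁]
    rw [← hI₂, ← integral_add hi₁ hi₂]
    refine integral_mono hhI.abs (hi₁.add hi₂) fun u => ?_
    have e1 : 0 ≤ C₁.indicator (fun _ => ε * m₂) u := indicator_nonneg (fun _ _ => by positivity) u
    have e2 : 0 ≤ C₂.indicator (fun _ => ε * m₁) u := indicator_nonneg (fun _ _ => by positivity) u
    simp only [hh]
    exact abs_le.2 ⟨by linarith, by linarith⟩
  have hb : ∀ u, h u ≠ 0 → u ∈ C ∧ |h u| ≤ η := by
    intro u hu
    by_cases k1 : u ∈ C₁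
    · have k2 : u ∉ C₂ := fun k2 => disjoint_left.1 hdisj k1 k2
      refine ⟨hC₁ k1, ?_⟩
      simp only [hh, indicator_of_mem k1, indicator_of_notMem k2, sub_zero]
      rwa [abs_of_pos (by positivity)]
    · by_cases k2 : u ∈ C₂
      · refine ⟨hC₂ k2, ?_⟩
        simp only [hh, indicator_of_notMem k1, indicator_of_mem k2, zero_sub, abs_neg]
        rwa [abs_of_pos (by positivity)]
      · exact absurd (by simp [hh, k1, k2]) hu
  have hhm : Measurable h :=
    (measurable_const.indicator hC₁m).sub (measurable_const.indicator hC₂m)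
  have hplus := add_mk_mem_OmegaPrime hx0 hx hyΩ hα hη.le hδle hhm hhI
    (fun u hu => ⟨hC u (hb u hu).1, (hb u hu).2⟩) hh0 hhabs
  have hminus := add_mk_mem_OmegaPrime hx0 hx hyΩ hα hη.le hδle hhm.neg hhI.neg
    (fun u hu => ⟨hC u (hb u (by simpa using hu)).1, by
      simpa using (hb u (by simpa using hu)).2⟩)
    (by simp only [Pi.neg_apply]; rw [integral_neg, hh0, neg_zero])
    (by simpa only [Pi.neg_apply, abs_neg] using hhabs)
  have hseg : y ∈ openSegment ℝ (y + AEEqFun.mk h hhm.aestronglyMeasurable)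
      (y + AEEqFun.mk (-h) hhm.neg.aestronglyMeasurable) := by
    refine ⟨1 / 2, 1 / 2, by norm_num, by norm_num, by norm_num, ?_⟩
    rw [AEEqFun.neg_mk h hhm.aestronglyMeasurable |>.symm]
    module
  have := (mem_extremePoints_iff_left.1 hy).2 _ hplus _ hminus hseg
  have hz : (AEEqFun.mk h hhm.aestronglyMeasurable : L0 I) = 0 := by simpa using this
  rw [AEEqFun.zero_def, AEEqFun.mk_eq_mk] at hz
  apply h₁
  rw [← hC₁I]
  refine measure_eq_zero_iff_ae_notMem.2 ?_
  filter_upwards [hz] with u hu k1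
  have k2 : u ∉ C₂ := fun k2 => disjoint_left.1 hdisj k1 k2
  simp only [hh, indicator_of_mem k1, indicator_of_notMem k2, sub_zero] at hu
  have : 0 < ε * m₂ := by positivity
  exact this.ne' hu

/-- Between two consecutive contact points of the excess functions, `y` takes no values, so its
excess is affine there, while that of `x` is convex. Since the two agree at the endpoints, the
excess of `x` cannot be the larger one inside. -/
theorem realExc_eq_of_mem_extremePoints {x y : L0 I} (hI : IsInitialInterval I) (hx0 : 0 ≤ x)
    (hx : x ∈ L1set I) (hy : y ∈ (OmegaPrime x).extremePoints ℝ) {s₀ : ℝ} (hs₀ : 0 ≤ s₀) :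
    realExc I y s₀ = realExc I x s₀ := by
  obtain ⟨hy0, hyL, hle, heq⟩ := (mem_OmegaPrime_iff_realExc hx0 hx).1 hy.1
  have hyI := integrable_of_mem_L1set hyL
  have hxI := integrable_of_mem_L1set hx
  have hcy := continuous_realExc (I := I) hyI
  have hcx := continuous_realExc (I := I) hxI
  refine le_antisymm (hle s₀ hs₀) ?_
  by_contra! hlt
  -- `S` is the contact set; `s₁` is its last point before `s₀` and exists because `0 ∈ S` by
  -- equality of the `L₁` norms.
  set S : Set ℝ := {s | 0 ≤ s ∧ realExc I x s ≤ realExc I y s} with hS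
  have hSc : IsClosed S := isClosed_Ici.inter (isClosed_le hcx hcy)
  have hs₀S : s₀ ∉ S := fun h => absurd h.2 (not_le.2 hlt)
  have h0S : (0 : ℝ) ∈ S ∩ Iic s₀ := ⟨⟨le_rfl, heq.ge⟩, hs₀⟩
  have hbdd : BddAbove (S ∩ Iic s₀) := ⟨s₀, fun s hs => hs.2⟩
  have hs₁ := (hSc.inter isClosed_Iic).csSup_mem ⟨0, h0S⟩ hbdd
  set s₁ := sSup (S ∩ Iic s₀)
  have hs₁0 : 0 ≤ s₁ := hs₁.1.1
  have hs₁lt : s₁ < s₀ := lt_of_le_of_ne hs₁.2 fun h => hs₀S (h ▸ hs₁.1)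
  have hgap₁ : ∀ s, s₁ < s → s ≤ s₀ → realExc I y s < realExc I x s := fun s h1 h2 => by
    by_contra! h3
    exact absurd (le_csSup hbdd ⟨⟨hs₁0.trans h1.le, h3⟩, h2⟩) (not_le.2 h1)
  have nogap : ∀ b, (∀ s, s₀ ≤ s → s < b → realExc I y s < realExc I x s) →
      ∀ᵐ u ∂(volume.restrict I), ¬ (s₁ < y u ∧ y u < b) := by
    intro b hb
    -- The strict inequality fails at contact points and `measure_between_eq_zero` needs it on a
    -- closed interval, so the interval is shrunk by `1 / (n + 1)` at each end.
    have hn : ∀ n : ℕ, ∀ᵐ u ∂(volume.restrict I),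
        ¬ (s₁ + 1 / (n + 1 : ℝ) < y u ∧ y u < b - 1 / (n + 1 : ℝ)) := by
      intro n
      have hpos : (0 : ℝ) < 1 / (n + 1 : ℝ) := by positivity
      rcases le_or_gt (s₁ + 1 / (n + 1 : ℝ)) (b - 1 / (n + 1 : ℝ)) with hle' | hgt
      · refine measure_eq_zero_iff_ae_notMem.1
          (measure_between_eq_zero hI hx0 hx hy (by linarith) hle' fun s hs => ?_)
        rcases le_total s s₀ with h | h
        · exact hgap₁ s (by linarith [hs.1]) h
        · exact hb s h (by linarith [hs.2])
      · exact ae_of_all _ fun u hu => by linarith [hu.1, hu.2]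
    filter_upwards [ae_all_iff.2 hn] with u hu hub
    obtain ⟨n, hn⟩ := exists_nat_one_div_lt (lt_min (sub_pos.2 hub.1) (sub_pos.2 hub.2))
    have h3 := (lt_min_iff.1 hn).1
    have h4 := (lt_min_iff.1 hn).2
    exact hu n ⟨by linarith, by linarith⟩
  by_cases hne : (S ∩ Ici s₀).Nonempty
  · have hbelow : BddBelow (S ∩ Ici s₀) := ⟨s₀, fun s hs => hs.2⟩
    have hs₂ := (hSc.inter isClosed_Ici).csInf_mem hne hbelow
    set s₂ := sInf (S ∩ Ici s₀)
    have hs₂lt : s₀ < s₂ := lt_of_le_of_ne hs₂.2 fun h => hs₀S (h ▸ hs₂.1)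
    have hav := nogap s₂ fun s h1 h2 => by
      by_contra! h3
      exact absurd (csInf_le hbelow ⟨⟨hs₀.trans h1, h3⟩, h1⟩) (not_le.2 h2)
    set θ : ℝ := (s₂ - s₀) / (s₂ - s₁) with hθ
    have hd : 0 < s₂ - s₁ := by linarith
    have hθ0 : 0 ≤ θ := div_nonneg (by linarith) hd.le
    have hθ1 : 0 ≤ 1 - θ := by
      rw [hθ, sub_nonneg, div_le_one hd]; linarith
    have hs₀eq : s₀ = θ * s₁ + (1 - θ) * s₂ := by
      have : θ * (s₂ - s₁) = s₂ - s₀ := div_mul_cancel₀ _ hd.ne'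
      linarith
    have hxconv : realExc I x s₀ ≤ θ * realExc I x s₁ + (1 - θ) * realExc I x s₂ := by
      unfold realExc
      rw [← integral_const_mul, ← integral_const_mul,
        ← integral_add ((integrable_max_sub hxI _).const_mul _)
          ((integrable_max_sub hxI _).const_mul _)]
      refine integral_mono (integrable_max_sub hxI _) (((integrable_max_sub hxI _).const_mul _).add
          ((integrable_max_sub hxI _).const_mul _)) fun u => ?_
      rw [abs_of_nonneg hs₀, abs_of_nonneg hs₁0, abs_of_nonneg (hs₁0.trans (by linarith))]
      have a1 := mul_le_mul_of_nonneg_left (le_max_left (x u - s₁) 0) hθ0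
      have a2 := mul_le_mul_of_nonneg_left (le_max_left (x u - s₂) 0) hθ1
      have a3 := mul_nonneg hθ0 (le_max_right (x u - s₁) 0)
      have a4 := mul_nonneg hθ1 (le_max_right (x u - s₂) 0)
      refine max_le ?_ (by linarith)
      rw [hs₀eq]
      linarith
    have hyaff : realExc I y s₀ = θ * realExc I y s₁ + (1 - θ) * realExc I y s₂ := by
      unfold realExc
      rw [← integral_const_mul, ← integral_const_mul,
        ← integral_add ((integrable_max_sub hyI _).const_mul _)
          ((integrable_max_sub hyI _).const_mul _)]
      refine integral_congr_ae (hav.mono fun u hu => ?_)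
      simp only
      rw [abs_of_nonneg hs₀, abs_of_nonneg hs₁0, abs_of_nonneg (hs₁0.trans (by linarith))]
      rcases le_or_gt (y u) s₁ with h | h
      · rw [max_eq_right (by linarith), max_eq_right (by linarith), max_eq_right (by linarith)]
        ring
      · have h' : s₂ ≤ y u := not_lt.1 fun h2 => hu ⟨h, h2⟩
        rw [max_eq_left (by linarith), max_eq_left (by linarith), max_eq_left (by linarith)]
        linarith
    have b1 := mul_le_mul_of_nonneg_left hs₁.1.2 hθ0
    have b2 := mul_le_mul_of_nonneg_left hs₂.1.2 hθ1
    linarith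
  · have hall : ∀ s, s₀ ≤ s → realExc I y s < realExc I x s := fun s h1 => by
      by_contra! h3
      exact hne ⟨s, ⟨hs₀.trans h1, h3⟩, h1⟩
    -- Without a contact point to the right, `y ≤ s₁` almost everywhere, so the excess of `y` at
    -- `s₁` is `0`. Then so is that of `x` at `s₁`, and by monotonicity at `s₀`.
    have hav : ∀ᵐ u ∂(volume.restrict I), y u ≤ s₁ := by
      filter_upwards [ae_all_iff.2 fun n : ℕ => nogap n fun s h1 _ => hall s h1] with u hu
      by_contra! h
      obtain ⟨n, hn⟩ := exists_nat_gt (y u)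
      exact hu n ⟨h, hn⟩
    have hy₁ : realExc I y s₁ = 0 := by
      refine integral_eq_zero_of_ae (hav.mono fun u hu => ?_)
      simp only [abs_of_nonneg hs₁0]
      exact max_eq_right (by linarith)
    have hmono : realExc I x s₀ ≤ realExc I x s₁ := by
      refine integral_mono (integrable_max_sub hxI _) (integrable_max_sub hxI _) fun u => ?_
      simp only [abs_of_nonneg hs₁0, abs_of_nonneg hs₀]
      exact max_le_max (by linarith) le_rfl
    have := realExc_nonneg (I := I) y s₀
    have := hs₁.1.2
    linarith

/-- The difference quotient of the excess on `[s, v]` is at least `μ{|y| > v}` and at most `μ{|x| >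
s}`; then `v` decreases to `s`. Integrability allows the excess at `v` to be cancelled. -/
theorem measure_lt_le_of_exc_eq {x y : L0 I} (hx : x ∈ L1set I)
    (h : ∀ s : ℝ≥0∞, s ≠ ∞ → exc y s = exc x s) (s : ℝ≥0∞) :
    volume.restrict I {u | s < ‖y u‖ₑ} ≤ volume.restrict I {u | s < ‖x u‖ₑ} := by
  by_cases hs : s = ∞
  · simp [hs]
  obtain ⟨v, hv, hvs, hvt⟩ := exists_seq_strictAnti_tendsto' (lt_top_iff_ne_top.2 hs)
  have hU : {u | s < ‖y u‖ₑ} = ⋃ n, {u | v n < ‖y u‖ₑ} := by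
    ext u
    simp only [mem_ofPred_eq, mem_iUnion]
    constructor
    · intro hu
      exact (hvt.eventually (gt_mem_nhds hu)).exists
    · rintro ⟨n, hn⟩
      exact (hvs n).1.trans hn
  have hmono : Monotone fun n => {u | v n < ‖y u‖ₑ} := fun m n hmn u hu =>
    lt_of_le_of_lt (hv.antitone hmn) hu
  rw [hU, hmono.measure_iUnion]
  refine iSup_le fun n => ?_
  have hn1 := (hvs n).1
  have hnt : v n ≠ ∞ := (hvs n).2.ne
  have hsub : ∀ (z : L0 I) (r : ℝ≥0∞), MeasurableSet {u | r < ‖z u‖ₑ} := fun z r =>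
    measurableSet_lt measurable_const (measurable_mag z)
  have hlow : exc y (v n) + (v n - s) * volume.restrict I {u | v n < ‖y u‖ₑ} ≤ exc y s := by
    rw [← lintegral_indicator_const (hsub y _)]
    refine (lintegral_add_right _ (measurable_const.indicator (hsub y _))).symm.trans_le ?_
    refine lintegral_mono fun u => ?_
    by_cases hu : v n < ‖y u‖ₑ
    · rw [indicator_of_mem (show u ∈ {u | v n < ‖y u‖ₑ} from hu)]
      exact (tsub_add_tsub_cancel hu.le hn1.le).le
    · rw [indicator_of_notMem (show u ∉ {u | v n < ‖y u‖ₑ} from hu), add_zero]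
      exact tsub_le_tsub_left hn1.le _
  have hup : exc x s ≤ exc x (v n) + (v n - s) * volume.restrict I {u | s < ‖x u‖ₑ} := by
    rw [← lintegral_indicator_const (hsub x _)]
    refine le_trans ?_ (lintegral_add_right _ (measurable_const.indicator (hsub x _))).le
    refine lintegral_mono fun u => ?_
    by_cases hu : s < ‖x u‖ₑ
    · rw [indicator_of_mem (show u ∈ {u | s < ‖x u‖ₑ} from hu)]
      exact tsub_le_tsub_add_tsub
    · rw [tsub_eq_zero_of_le (not_lt.1 hu)]
      exact zero_le
  rw [h s hs, h _ hnt] at hlow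
  have h3 := (ENNReal.add_le_add_iff_left (exc_lt_top hx _).ne).1 (hlow.trans hup)
  refine (ENNReal.mul_le_mul_iff_right ?_ ?_).1 h3
  · exact (tsub_pos_of_lt hn1).ne'
  · exact (tsub_le_self.trans_lt (lt_top_iff_ne_top.2 hnt)).ne

/-- Ryff's theorem: the extreme points of `Ω'(x)` are equimeasurable with `x`. -/
theorem rearr_eq_of_mem_extremePoints {x y : L0 I} (hI : IsInitialInterval I) (hx0 : 0 ≤ x)
    (hx : x ∈ L1set I) (hy : y ∈ (OmegaPrime x).extremePoints ℝ) : rearr y = rearr x := by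
  have hyΩ := (mem_OmegaPrime_iff.1 hy.1)
  have hexc : ∀ s : ℝ≥0∞, s ≠ ∞ → exc y s = exc x s := fun s hs => by
    rw [← ENNReal.ofReal_toReal hs, exc_eq_realExc hyΩ.1 hyΩ.2.1 ENNReal.toReal_nonneg,
      exc_eq_realExc hx0 hx ENNReal.toReal_nonneg,
      realExc_eq_of_mem_extremePoints hI hx0 hx hy ENNReal.toReal_nonneg]
  exact decr_eq_of_measure_eq fun s _ => le_antisymm (measure_lt_le_of_exc_eq hx hexc s)
    (measure_lt_le_of_exc_eq hyΩ.2.1 (fun s hs => (hexc s hs).symm) s)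

end Extreme

/-! ### Cyclic shifts on a set of finite measure -/

section Shifts

variable {C : Set ℝ}

/-- `cumul C` is constant across the gaps of `C`; the leftmost point at which it equals `t`
describes the whole superlevel set. -/
theorem setOf_le_cumul (hC : C ⊆ Ioi 0) {t : ℝ} (ht : 0 < t) (hex : ∃ ρ, cumul C ρ = t) :
    ∃ ρ, cumul C ρ = t ∧ {u | t ≤ cumul C u} = Ici ρ := by
  set S : Set ℝ := {ρ | cumul C ρ = t}
  have hbdd : BddBelow S := ⟨0, fun ρ hρ => by
    by_contra! hneg
    have h1 : cumul C ρ = t := hρ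
    rw [cumul_of_nonpos hC hneg.le] at h1
    exact ht.ne h1⟩
  have hcl : IsClosed S := isClosed_singleton.preimage (continuous_cumul hC)
  have hmem : cumul C (sInf S) = t := hcl.csInf_mem hex hbdd
  refine ⟨sInf S, hmem, ?_⟩
  ext u
  simp only [mem_ofPred_eq, mem_Ici]
  constructor
  · intro hu
    by_contra! hlt
    have h1 : cumul C u = t := le_antisymm (hmem ▸ cumul_mono hC hlt.le) hu
    exact absurd (csInf_le hbdd h1) (not_le.2 hlt)
  · intro hu
    rw [← hmem]
    exact cumul_mono hC hu

/-- `cumul C` is a measure-preserving parametrization of `C` by an interval of the same length, so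
the cells can be taken in an interval even though `C` is an arbitrary measurable set. -/
theorem map_cumul (hC : C ⊆ Ioi 0) (hCm : MeasurableSet C) (hfin : volume C ≠ ∞) :
    (volume.restrict C).map (cumul C) = volume.restrict (Ico 0 (volume.real C)) := by
  have hg : Measurable (cumul C) := (continuous_cumul hC).measurable
  have hle : ∀ u, cumul C u ≤ volume.real C := fun u => measureReal_mono inter_subset_left hfin
  have : IsFiniteMeasure (volume.restrict C) := ⟨by
    rw [Measure.restrict_apply_univ]; exact lt_top_iff_ne_top.2 hfin⟩
  have hVC : volume C = ENNReal.ofReal (volume.real C) := (ENNReal.ofReal_toReal hfin).symm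
  refine Measure.ext_of_Ici _ _ fun t => ?_
  rw [Measure.map_apply hg measurableSet_Ici, Measure.restrict_apply (hg measurableSet_Ici),
    Measure.restrict_apply measurableSet_Ici]
  change volume ({u | t ≤ cumul C u} ∩ C) = _
  rcases le_or_gt t 0 with ht | ht
  · have h1 : {u | t ≤ cumul C u} ∩ C = C :=
      inter_eq_right.2 fun u _ => ht.trans (cumul_nonneg C u)
    have h2 : Ici t ∩ Ico 0 (volume.real C) = Ico 0 (volume.real C) :=
      inter_eq_right.2 fun u hu => ht.trans hu.1
    rw [h1, h2, Real.volume_Ico, sub_zero, ← hVC]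
  · have h2 : Ici t ∩ Ico 0 (volume.real C) = Ico t (volume.real C) := by
      ext u
      simp only [mem_inter_iff, mem_Ici, mem_Ico]
      exact ⟨fun h => ⟨h.1, h.2.2⟩, fun h => ⟨h.1, ht.le.trans h.1, h.2⟩⟩
    rw [h2, Real.volume_Ico]
    by_cases hex : ∃ ρ, cumul C ρ = t
    · obtain ⟨ρ, hρ, hset⟩ := setOf_le_cumul hC ht hex
      have h3 : Ici ρ ∩ C = C \ (C ∩ Iio ρ) := by
        ext u
        simp only [mem_inter_iff, mem_Ici, Set.mem_sdiff, mem_Iio, not_and, not_lt]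
        exact ⟨fun h => ⟨h.2, fun _ => h.1⟩, fun h => ⟨h.2 h.1, h.1⟩⟩
      rw [hset, h3, measure_sdiff inter_subset_left
        (hCm.inter measurableSet_Iio).nullMeasurableSet (volume_inter_Iio_lt_top hC ρ).ne,
        ← ofReal_cumul hC, hρ, hVC, ENNReal.ofReal_sub _ ht.le]
    · have hta : volume.real C ≤ t := by
        by_contra! hlt
        obtain ⟨ρ, hρ⟩ := exists_volume_inter_Iio_eq hC (v := ENNReal.ofReal t) (by
          rw [hVC]; exact (ENNReal.ofReal_lt_ofReal_iff (ht.trans hlt)).2 hlt)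
        exact hex ⟨ρ, by rw [cumul, Measure.real, hρ, ENNReal.toReal_ofReal ht.le]⟩
      have hemp : {u | t ≤ cumul C u} = ∅ := eq_empty_iff_forall_notMem.2 fun u hu =>
        hex ⟨u, le_antisymm ((hle u).trans hta) hu⟩
      rw [hemp, empty_inter, measure_empty, ENNReal.ofReal_of_nonpos (by linarith)]

theorem lintegral_comp_cumul (hC : C ⊆ Ioi 0) (hCm : MeasurableSet C) (hfin : volume C ≠ ∞)
    {Ψ : ℝ → ℝ≥0∞} (hΨ : Measurable Ψ) :
    ∫⁻ u in C, Ψ (cumul C u) = ∫⁻ v in Ico 0 (volume.real C), Ψ v := by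
  rw [← map_cumul hC hCm hfin, lintegral_map hΨ (continuous_cumul hC).measurable]

/-- The number of the cell of length `b` that contains `v`. -/
def cell (b v : ℝ) : ℕ := ⌊v / b⌋₊

theorem measurable_cell (b : ℝ) : Measurable (cell b) :=
  Nat.measurable_floor.comp (measurable_id.div_const b)

theorem cell_eq {b v : ℝ} (hb : 0 < b) {p : ℕ} (hv : v ∈ Ico (p * b) ((p + 1) * b)) :
    cell b v = p := by
  have h0 : 0 ≤ v / b := div_nonneg (le_trans (by positivity) hv.1) hb.le
  rw [cell, Nat.floor_eq_iff h0, le_div_iff₀ hb, div_lt_iff₀ hb]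
  exact hv

theorem measurable_cellwise {b : ℝ} {ψ : ℕ → ℝ → ℝ≥0∞} (hψ : ∀ p, Measurable (ψ p)) :
    Measurable fun v => ψ (cell b v) (v - cell b v * b) := by
  have h1 : Measurable fun q : ℝ × ℕ => ψ q.2 q.1 := measurable_from_prod_countable_left hψ
  exact h1.comp ((measurable_id.sub
    ((measurable_from_top.comp (measurable_cell b)).mul_const b)).prodMk (measurable_cell b))

theorem lintegral_cellwise {b : ℝ} (hb : 0 < b) {ψ : ℕ → ℝ → ℝ≥0∞} (n : ℕ) :
    ∫⁻ v in Ico 0 (n * b), ψ (cell b v) (v - cell b v * b) =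
      ∑ p ∈ Finset.range n, ∫⁻ v in Ico 0 b, ψ p v := by
  induction n with
  | zero => simp
  | succ n ih =>
    have hU : Ico 0 (((n + 1 : ℕ) : ℝ) * b) = Ico 0 (n * b) ∪ Ico (n * b) ((n + 1) * b) := by
      rw [Ico_union_Ico_eq_Ico (by positivity) (by nlinarith)]
      push_cast
      rfl
    have hd : Disjoint (Ico 0 (n * b)) (Ico (n * b) ((n + 1) * b)) :=
      Ico_disjoint_Ico_same
    rw [hU, lintegral_union measurableSet_Ico hd, ih, Finset.sum_range_succ]
    congr 1
    have h1 : ∫⁻ v in Ico (n * b) ((n + 1) * b), ψ (cell b v) (v - cell b v * b) =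
        ∫⁻ v in Ico (n * b) ((n + 1) * b), ψ n (v - n * b) :=
      setLIntegral_congr_fun measurableSet_Ico fun v hv => by simp only [cell_eq hb hv]
    rw [h1, ← lintegral_indicator measurableSet_Ico, ← lintegral_indicator measurableSet_Ico,
      ← lintegral_sub_right_eq_self ((Ico 0 b).indicator (ψ n)) ((n : ℝ) * b)]
    refine lintegral_congr fun v => ?_
    by_cases hv : v ∈ Ico (n * b) ((n + 1) * b)
    · rw [indicator_of_mem hv, indicator_of_mem]
      exact ⟨by linarith [hv.1], by linarith [hv.2]⟩
    · rw [indicator_of_notMem hv, indicator_of_notMem]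
      exact fun h => hv ⟨by linarith [h.1], by linarith [h.2]⟩

theorem sum_range_add_mod {M : Type*} [AddCommMonoid M] (φ : ℕ → M) (n i : ℕ) :
    ∑ p ∈ Finset.range n, φ ((p + i) % n) = ∑ p ∈ Finset.range n, φ p := by
  have hinj : Set.InjOn (fun p => (p + i) % n) (Finset.range n) := by
    intro p hp q hq hpq
    have h1 : p ≡ q [MOD n] := Nat.ModEq.add_right_cancel' i hpq
    exact Nat.ModEq.eq_of_lt_of_lt h1 (by simpa using hp) (by simpa using hq)
  have himg : (Finset.range n).image (fun p => (p + i) % n) = Finset.range n := by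
    refine Finset.eq_of_subset_of_card_le (fun q hq => ?_) (by rw [Finset.card_image_of_injOn hinj])
    obtain ⟨p, hp, rfl⟩ := Finset.mem_image.1 hq
    have := Finset.mem_range.1 hp
    exact Finset.mem_range.2 (Nat.mod_lt _ (by omega))
  conv_rhs => rw [← himg, Finset.sum_image hinj]

/-- Left Riemann sums of a decreasing function; the right sums follow. They are used with `τ` the
offset of a point in its cell, so that the nodes `τ + q b` are the points with the same offset in
the other cells. -/
theorem setLIntegral_le_sum_of_antitone {h : ℝ → ℝ≥0∞} (hh : Antitone h) {b : ℝ} (hb : 0 < b)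
    (τ : ℝ) (n : ℕ) : ∫⁻ v in Ico τ (τ + n * b), h v ≤
      ENNReal.ofReal b * ∑ q ∈ Finset.range n, h (τ + q * b) := by
  induction n with
  | zero => simp
  | succ n ih =>
    have hU : Ico τ (τ + ((n + 1 : ℕ) : ℝ) * b) ⊆
        Ico τ (τ + n * b) ∪ Ico (τ + n * b) (τ + (n + 1) * b) := by
      rw [Ico_union_Ico_eq_Ico (by nlinarith [n.cast_nonneg (α := ℝ)]) (by nlinarith)]
      push_cast
      exact subset_rfl
    refine (lintegral_mono_set hU).trans ((lintegral_union_le _ _ _).trans ?_)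
    rw [Finset.sum_range_succ, mul_add]
    refine add_le_add ih ?_
    refine (setLIntegral_mono measurable_const fun v hv => hh hv.1).trans ?_
    rw [setLIntegral_const, Real.volume_Ico, mul_comm]
    gcongr
    linarith

theorem sum_le_setLIntegral_of_antitone {h : ℝ → ℝ≥0∞} (hh : Antitone h) {b : ℝ} (hb : 0 < b)
    (τ : ℝ) (n : ℕ) : ENNReal.ofReal b * ∑ q ∈ Finset.range n, h (τ + (q + 1) * b) ≤
      ∫⁻ v in Ico τ (τ + n * b), h v := by
  induction n with
  | zero => simp
  | succ n ih =>
    have hU : Ico τ (τ + ((n + 1 : ℕ) : ℝ) * b) =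
        Ico τ (τ + n * b) ∪ Ico (τ + n * b) (τ + (n + 1) * b) := by
      rw [Ico_union_Ico_eq_Ico (by nlinarith [n.cast_nonneg (α := ℝ)]) (by nlinarith)]
      push_cast
      rfl
    rw [hU, lintegral_union measurableSet_Ico Ico_disjoint_Ico_same, Finset.sum_range_succ, mul_add]
    refine add_le_add ih ?_
    refine le_trans ?_ (setLIntegral_mono hh.measurable fun v hv =>
      hh (show v ≤ τ + (n + 1) * b from hv.2.le))
    rw [setLIntegral_const, Real.volume_Ico, mul_comm]
    gcongr
    linarith

/-- The `i`-th cyclic shift of the rearrangement of `f` on `C`, divided into `n` cells. -/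
def shiftFun (C : Set ℝ) (f : ℝ → ℝ≥0∞) (n i : ℕ) (u : ℝ) : ℝ≥0∞ :=
  decr (volume.restrict C) f ((cumul C u - cell (volume.real C / n) (cumul C u) *
    (volume.real C / n)) + ((cell (volume.real C / n) (cumul C u) + i) % n : ℕ) *
      (volume.real C / n))

/-- The first cell of the rearrangement of `f` on `C`, repeated periodically. -/
def periodFun (C : Set ℝ) (f : ℝ → ℝ≥0∞) (n : ℕ) (u : ℝ) : ℝ≥0∞ :=
  decr (volume.restrict C) f (cumul C u - cell (volume.real C / n) (cumul C u) *
    (volume.real C / n))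

theorem lintegral_comp_cell (hC : C ⊆ Ioi 0) (hCm : MeasurableSet C) (hfin : volume C ≠ ∞)
    (h0 : volume C ≠ 0) {n : ℕ} (hn : n ≠ 0) {ψ : ℕ → ℝ → ℝ≥0∞} (hψ : ∀ p, Measurable (ψ p)) :
    ∫⁻ u in C, ψ (cell (volume.real C / n) (cumul C u))
        (cumul C u - cell (volume.real C / n) (cumul C u) * (volume.real C / n)) =
      ∑ p ∈ Finset.range n, ∫⁻ v in Ico 0 (volume.real C / n), ψ p v := by
  have ha : 0 < volume.real C := ENNReal.toReal_pos h0 hfin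
  have hn' : (0 : ℝ) < n := by positivity
  rw [lintegral_comp_cumul hC hCm hfin (measurable_cellwise hψ),
    ← lintegral_cellwise (div_pos ha hn') n, mul_div_cancel₀ _ hn'.ne']

theorem measurable_shiftFun (hC : C ⊆ Ioi 0) (f : ℝ → ℝ≥0∞) (n i : ℕ) :
    Measurable (shiftFun C f n i) :=
  (measurable_cellwise (b := volume.real C / n) (ψ := fun p v =>
    decr (volume.restrict C) f (v + ((p + i) % n : ℕ) * (volume.real C / n)))
    fun _ => (measurable_decr _ _).comp (measurable_id.add_const _)).comp
      (continuous_cumul hC).measurable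

theorem measurable_periodFun (hC : C ⊆ Ioi 0) (f : ℝ → ℝ≥0∞) (n : ℕ) :
    Measurable (periodFun C f n) :=
  (measurable_cellwise (b := volume.real C / n) (ψ := fun _ v =>
    decr (volume.restrict C) f v) fun _ => measurable_decr _ _).comp (continuous_cumul hC).measurable

theorem lintegral_shiftFun (hC : C ⊆ Ioi 0) (hCm : MeasurableSet C) (hfin : volume C ≠ ∞)
    (h0 : volume C ≠ 0) (f : ℝ → ℝ≥0∞) {n : ℕ} (hn : n ≠ 0) (i : ℕ) {Θ : ℝ≥0∞ → ℝ≥0∞}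
    (hΘ : Measurable Θ) : ∫⁻ u in C, Θ (shiftFun C f n i u) =
      ∫⁻ v in Ico 0 (volume.real C), Θ (decr (volume.restrict C) f v) := by
  have ha : 0 < volume.real C := ENNReal.toReal_pos h0 hfin
  have hn' : (0 : ℝ) < n := by positivity
  set b := volume.real C / n
  have hb : 0 < b := div_pos ha hn'
  have hm : ∀ q : ℕ, Measurable fun v => Θ (decr (volume.restrict C) f (v + q * b)) := fun q =>
    hΘ.comp ((measurable_decr _ _).comp (measurable_id.add_const _))
  have h1 := lintegral_comp_cell hC hCm hfin h0 hn
    (ψ := fun p v => Θ (decr (volume.restrict C) f (v + ((p + i) % n : ℕ) * b))) fun p => hm _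
  have h2 := lintegral_cellwise hb
    (ψ := fun p v => Θ (decr (volume.restrict C) f (v + p * b))) n
  rw [sum_range_add_mod (fun q : ℕ =>
    ∫⁻ v in Ico 0 b, Θ (decr (volume.restrict C) f (v + q * b))) n i, ← h2,
    show (n : ℝ) * b = volume.real C from mul_div_cancel₀ _ hn'.ne'] at h1
  refine h1.trans (lintegral_congr fun v => ?_)
  rw [sub_add_cancel]

theorem measure_lt_eq_lintegral {μ : Measure ℝ} {F : ℝ → ℝ≥0∞} (hF : Measurable F) (s : ℝ≥0∞) :
    μ {u | s < F u} = ∫⁻ u, (Ioi s).indicator (fun _ => 1) (F u) ∂μ := by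
  rw [← lintegral_indicator_one (measurableSet_lt measurable_const hF)]
  rfl

theorem decr_restrict_eq_zero (f : ℝ → ℝ≥0∞) (hfin : volume C ≠ ∞) {t : ℝ}
    (ht : volume.real C ≤ t) : decr (volume.restrict C) f t = 0 := by
  refine le_antisymm (decr_le_iff.2 ((measure_mono (subset_univ _)).trans ?_)) zero_le
  rw [Measure.restrict_apply_univ, ← ENNReal.ofReal_toReal hfin]
  exact ENNReal.ofReal_le_ofReal ht

theorem restrict_Ico_le (b : ℝ) :
    (volume : Measure ℝ).restrict (Ico 0 b) ≤ volume.restrict (Ioi 0) := by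
  rw [Measure.restrict_congr_set (Ioo_ae_eq_Ico (μ := volume) (a := (0 : ℝ)) (b := b)).symm]
  exact Measure.restrict_mono Ioo_subset_Ioi_self le_rfl

/-- A cyclic permutation of cells of equal length preserves measure, so the distribution is that of
the rearrangement on `C`. The latter vanishes beyond the length of `C`. -/
theorem measure_lt_shiftFun (hC : C ⊆ Ioi 0) (hCm : MeasurableSet C) (hfin : volume C ≠ ∞)
    (h0 : volume C ≠ 0) {f : ℝ → ℝ≥0∞} {n : ℕ} (hn : n ≠ 0) (i : ℕ) (s : ℝ≥0∞) :
    volume.restrict C {u | s < shiftFun C f n i u} = volume.restrict C {u | s < f u} := by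
  rw [measure_lt_eq_lintegral (measurable_shiftFun hC f n i) s,
    lintegral_shiftFun hC hCm hfin h0 f hn i
      (Θ := (Ioi s).indicator fun _ => 1) (measurable_const.indicator measurableSet_Ioi),
    ← measure_lt_eq_lintegral (measurable_decr _ _), ← volume_lt_decr _ f]
  refine le_antisymm (restrict_Ico_le _ _) ?_
  have hm := measurableSet_lt (measurable_const (a := s)) (measurable_decr (volume.restrict C) f)
  rw [Measure.restrict_apply hm, Measure.restrict_apply hm]
  refine measure_mono fun u hu => ⟨hu.1, (show (0 : ℝ) < u from hu.2).le, ?_⟩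
  by_contra! hle
  have h' : s < decr (volume.restrict C) f u := hu.1
  rw [decr_restrict_eq_zero f hfin hle] at h'
  exact absurd h' not_lt_zero

theorem lintegral_periodFun (hC : C ⊆ Ioi 0) (hCm : MeasurableSet C) (hfin : volume C ≠ ∞)
    (h0 : volume C ≠ 0) (f : ℝ → ℝ≥0∞) {n : ℕ} (hn : n ≠ 0) {Θ : ℝ≥0∞ → ℝ≥0∞}
    (hΘ : Measurable Θ) : ∫⁻ u in C, Θ (periodFun C f n u) =
      n * ∫⁻ v in Ico 0 (volume.real C / n), Θ (decr (volume.restrict C) f v) := by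
  have h1 := lintegral_comp_cell hC hCm hfin h0 hn
    (ψ := fun _ v => Θ (decr (volume.restrict C) f v)) fun p => hΘ.comp (measurable_decr _ _)
  rw [Finset.sum_const, Finset.card_range, nsmul_eq_mul] at h1
  exact h1

theorem measure_lt_periodFun_le (hC : C ⊆ Ioi 0) (hCm : MeasurableSet C) (hfin : volume C ≠ ∞)
    (h0 : volume C ≠ 0) (f : ℝ → ℝ≥0∞) {n : ℕ} (hn : n ≠ 0) (s : ℝ≥0∞) :
    volume.restrict C {u | s < periodFun C f n u} ≤ n * volume.restrict C {u | s < f u} := by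
  rw [measure_lt_eq_lintegral (measurable_periodFun hC f n) s,
    lintegral_periodFun hC hCm hfin h0 f hn
      (Θ := (Ioi s).indicator fun _ => 1) (measurable_const.indicator measurableSet_Ioi),
    ← measure_lt_eq_lintegral (measurable_decr _ _), ← volume_lt_decr _ f]
  gcongr _ * ?_
  exact restrict_Ico_le _ _

theorem natCast_mul_ofReal_div {n : ℕ} (hn : n ≠ 0) (hfin : volume C ≠ ∞) :
    (n : ℝ≥0∞) * ENNReal.ofReal (volume.real C / n) = volume C := by
  have hn' : (0 : ℝ) < n := by positivity
  rw [← ENNReal.ofReal_natCast, ← ENNReal.ofReal_mul hn'.le, mul_div_cancel₀ _ hn'.ne',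
    Measure.real, ENNReal.ofReal_toReal hfin]

theorem sum_shiftFun (C : Set ℝ) (f : ℝ → ℝ≥0∞) (n : ℕ) (u : ℝ) :
    ∑ i ∈ Finset.range n, shiftFun C f n i u = ∑ q ∈ Finset.range n,
      decr (volume.restrict C) f ((cumul C u - cell (volume.real C / n) (cumul C u) *
        (volume.real C / n)) + q * (volume.real C / n)) := by
  refine Eq.trans (Finset.sum_congr rfl fun i _ => ?_) (sum_range_add_mod (fun q : ℕ =>
    decr (volume.restrict C) f ((cumul C u - cell (volume.real C / n) (cumul C u) *
      (volume.real C / n)) + q * (volume.real C / n))) n (cell (volume.real C / n) (cumul C u)))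
  rw [shiftFun, add_comm i]

theorem lintegral_decr_restrict {f : ℝ → ℝ≥0∞} (hf : Measurable f) :
    ∫⁻ v in Ioi (0 : ℝ), decr (volume.restrict C) f v = ∫⁻ u in C, f u := by
  have := excess_eq_lintegral_decr (μ := volume.restrict C) hf.aemeasurable 0
  simpa [excess] using this.symm

/-- At a point with offset `τ` in its cell, the mean of the shifts is `n⁻¹` times the sum of the
values of the rearrangement at `τ + q b`, `q < n`. The term `q = 0` lies in the first cell and is
the value of `periodFun`; the others form a right Riemann sum, which is below the integral. -/
theorem mean_shiftFun_le (hfin : volume C ≠ ∞) (h0 : volume C ≠ 0) {f : ℝ → ℝ≥0∞}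
    (hf : Measurable f) {n : ℕ} (hn : n ≠ 0) (u : ℝ) :
    (n : ℝ≥0∞)⁻¹ * ∑ i ∈ Finset.range n, shiftFun C f n i u ≤
      (n : ℝ≥0∞)⁻¹ * periodFun C f n u + (volume C)⁻¹ * ∫⁻ u in C, f u := by
  rw [sum_shiftFun]
  have ha : 0 < volume.real C := ENNReal.toReal_pos h0 hfin
  have hn' : (0 : ℝ) < n := by positivity
  have hnC := natCast_mul_ofReal_div hn hfin
  have hpf : periodFun C f n u = decr (volume.restrict C) f (cumul C u -
    cell (volume.real C / n) (cumul C u) * (volume.real C / n)) := rfl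
  set b := volume.real C / n
  have hb : 0 < b := div_pos ha hn'
  set τ := cumul C u - cell b (cumul C u) * b
  have hτ : 0 ≤ τ := sub_nonneg.2 ((le_div_iff₀ hb).1
    (Nat.floor_le (div_nonneg (cumul_nonneg C u) hb.le)))
  obtain ⟨m, rfl⟩ := Nat.exists_eq_succ_of_ne_zero hn
  rw [Finset.sum_range_succ', mul_add, add_comm]
  refine add_le_add (by simp [hpf]) ?_
  have h1 := sum_le_setLIntegral_of_antitone (decr_antitone (volume.restrict C) f) hb τ m
  have h2 : ∫⁻ v in Ico τ (τ + m * b), decr (volume.restrict C) f v ≤ ∫⁻ u in C, f u := by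
    rw [← lintegral_decr_restrict hf, restrict_Ioi_eq_restrict_Ici]
    exact lintegral_mono_set fun v hv => hτ.trans hv.1
  have hbne : ENNReal.ofReal b ≠ 0 := by simpa using hb
  rw [← hnC, ENNReal.mul_inv (Or.inr ENNReal.ofReal_ne_top) (Or.inr hbne), mul_assoc]
  gcongr
  rw [← ENNReal.mul_le_iff_le_inv hbne ENNReal.ofReal_ne_top]
  refine le_trans (le_of_eq ?_) (h1.trans h2)
  push_cast
  rfl

/-- The left Riemann sum with nodes `τ + q b` dominates the integral from `τ` on; the missing piece
`(0, τ)` lies in the first cell. -/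
theorem le_mean_shiftFun (hfin : volume C ≠ ∞) (h0 : volume C ≠ 0) {f : ℝ → ℝ≥0∞}
    (hf : Measurable f) {n : ℕ} (hn : n ≠ 0) (u : ℝ) :
    (volume C)⁻¹ * ∫⁻ u in C, f u ≤ (n : ℝ≥0∞)⁻¹ * ∑ i ∈ Finset.range n, shiftFun C f n i u +
      (volume C)⁻¹ * ∫⁻ v in Ico 0 (volume.real C / n), decr (volume.restrict C) f v := by
  rw [sum_shiftFun]
  have ha : 0 < volume.real C := ENNReal.toReal_pos h0 hfin
  have hn' : (0 : ℝ) < n := by positivity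
  have hnC := natCast_mul_ofReal_div hn hfin
  have hnb : n * (volume.real C / n) = volume.real C := mul_div_cancel₀ _ hn'.ne'
  set b := volume.real C / n
  have hb : 0 < b := div_pos ha hn'
  set τ := cumul C u - cell b (cumul C u) * b with hτdef
  have hτ0 : 0 ≤ τ := sub_nonneg.2 ((le_div_iff₀ hb).1
    (Nat.floor_le (div_nonneg (cumul_nonneg C u) hb.le)))
  have hτ : τ < b := by
    have := (div_lt_iff₀ hb).1 (Nat.lt_floor_add_one (cumul C u / b))
    rw [add_mul, one_mul] at this
    rw [hτdef, cell]
    linarith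
  have h1 := setLIntegral_le_sum_of_antitone (decr_antitone (volume.restrict C) f) hb τ n
  have hbne : ENNReal.ofReal b ≠ 0 := by simpa using hb
  have h2 : ∫⁻ u in C, f u ≤ (∫⁻ v in Ico 0 b, decr (volume.restrict C) f v) +
      ∫⁻ v in Ico τ (τ + n * b), decr (volume.restrict C) f v := by
    have h3 : ∫⁻ v in Ici (volume.real C), decr (volume.restrict C) f v = 0 :=
      setLIntegral_eq_zero measurableSet_Ici fun v hv => decr_restrict_eq_zero f hfin hv
    have hsub : Ioi (0 : ℝ) ⊆ (Ico 0 b ∪ Ico τ (τ + n * b)) ∪ Ici (volume.real C) := fun v hv => by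
      have hv0 : (0 : ℝ) < v := hv
      rcases lt_or_ge v b with h | h
      · exact Or.inl (Or.inl ⟨hv0.le, h⟩)
      · rcases lt_or_ge v (volume.real C) with h' | h'
        · exact Or.inl (Or.inr ⟨hτ.le.trans h, by rw [hnb]; linarith⟩)
        · exact Or.inr h'
    rw [← lintegral_decr_restrict hf]
    refine (lintegral_mono_set hsub).trans ((lintegral_union_le _ _ _).trans ?_)
    rw [h3, add_zero]
    exact lintegral_union_le _ _ _
  refine (mul_le_mul_right (h2.trans (add_le_add_right h1 _)) _).trans ?_
  rw [mul_add, add_comm, ← mul_assoc]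
  gcongr
  nth_rewrite 1 [← hnC]
  rw [ENNReal.mul_inv (Or.inr ENNReal.ofReal_ne_top) (Or.inr hbne), mul_assoc,
    ENNReal.inv_mul_cancel hbne ENNReal.ofReal_ne_top, mul_one]

end Shifts

/-! ### Functions defined piecewise on an averaging family -/

section Gluing

variable {I : Set ℝ} (𝒜 : AveragingFamily I)

/-- The function equal to `F k` on the `k`-th set of the family and to `f₀` elsewhere. -/
def glue (F : ℕ → ℝ → ℝ≥0∞) (f₀ : ℝ → ℝ≥0∞) (u : ℝ) : ℝ≥0∞ :=
  (∑' k, (𝒜.sets k).indicator (F k) u) + (⋃ k, 𝒜.sets k)ᶜ.indicator f₀ u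

variable {F : ℕ → ℝ → ℝ≥0∞} {f₀ : ℝ → ℝ≥0∞}

theorem glue_of_mem {k : ℕ} {u : ℝ} (hu : u ∈ 𝒜.sets k) : glue 𝒜 F f₀ u = F k u := by
  rw [glue, tsum_eq_single k, indicator_of_mem hu, indicator_of_notMem, add_zero]
  · exact fun h => h (mem_iUnion.2 ⟨k, hu⟩)
  · intro j hj
    exact indicator_of_notMem (fun hj' => disjoint_left.1 (𝒜.disjoint hj) hj' hu) _

theorem glue_of_notMem {u : ℝ} (hu : u ∉ ⋃ k, 𝒜.sets k) : glue 𝒜 F f₀ u = f₀ u := by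
  have h : ∀ k, (𝒜.sets k).indicator (F k) u = 0 := fun k =>
    indicator_of_notMem (fun hk => hu (mem_iUnion.2 ⟨k, hk⟩)) _
  simp only [glue, h, tsum_zero, zero_add]
  exact indicator_of_mem hu _

theorem measurable_glue (hF : ∀ k, Measurable (F k)) (hf₀ : Measurable f₀) :
    Measurable (glue 𝒜 F f₀) :=
  (Measurable.tsum fun k => (hF k).indicator (𝒜.measurable k)).add
    (hf₀.indicator (MeasurableSet.iUnion 𝒜.measurable).compl)

theorem lintegral_family (g : ℝ → ℝ≥0∞) : ∫⁻ u in I, g u =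
    (∑' k, ∫⁻ u in 𝒜.sets k, g u) + ∫⁻ u in I \ ⋃ k, 𝒜.sets k, g u := by
  rw [← lintegral_iUnion 𝒜.measurable 𝒜.disjoint,
    ← lintegral_inter_add_sdiff g I (MeasurableSet.iUnion 𝒜.measurable),
    inter_eq_right.2 (iUnion_subset 𝒜.subset)]

theorem lintegral_family_le {g h : ℝ → ℝ≥0∞} (hI : MeasurableSet I)
    (h1 : ∀ k, ∫⁻ u in 𝒜.sets k, g u ≤ ∫⁻ u in 𝒜.sets k, h u)
    (h2 : ∀ u ∈ I \ ⋃ k, 𝒜.sets k, g u ≤ h u) : ∫⁻ u in I, g u ≤ ∫⁻ u in I, h u := by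
  rw [lintegral_family 𝒜, lintegral_family 𝒜 h]
  exact add_le_add (ENNReal.tsum_le_tsum h1)
    (setLIntegral_mono' (hI.diff (MeasurableSet.iUnion 𝒜.measurable)) h2)

theorem setLIntegral_glue (k : ℕ) (Θ : ℝ≥0∞ → ℝ≥0∞) :
    ∫⁻ u in 𝒜.sets k, Θ (glue 𝒜 F f₀ u) = ∫⁻ u in 𝒜.sets k, Θ (F k u) :=
  setLIntegral_congr_fun (𝒜.measurable k) fun u hu => by simp only [glue_of_mem 𝒜 hu]

theorem measure_family {S : Set ℝ} (hS : MeasurableSet S) : volume.restrict I S =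
    (∑' k, volume.restrict (𝒜.sets k) S) + volume.restrict (I \ ⋃ k, 𝒜.sets k) S := by
  simp only [← lintegral_indicator_one hS]
  exact lintegral_family 𝒜 _

theorem restrict_glue_lt (k : ℕ) (s : ℝ≥0∞) :
    volume.restrict (𝒜.sets k) {u | s < glue 𝒜 F f₀ u} =
      volume.restrict (𝒜.sets k) {u | s < F k u} := by
  refine measure_congr ?_
  filter_upwards [ae_restrict_mem (𝒜.measurable k)] with u hu
  change (s < glue 𝒜 F f₀ u) = (s < F k u)
  rw [glue_of_mem 𝒜 hu]

theorem restrict_compl_glue_lt (hI : MeasurableSet I) (s : ℝ≥0∞) :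
    volume.restrict (I \ ⋃ k, 𝒜.sets k) {u | s < glue 𝒜 F f₀ u} =
      volume.restrict (I \ ⋃ k, 𝒜.sets k) {u | s < f₀ u} := by
  refine measure_congr ?_
  filter_upwards [ae_restrict_mem (hI.diff (MeasurableSet.iUnion 𝒜.measurable))] with u hu
  change (s < glue 𝒜 F f₀ u) = (s < f₀ u)
  rw [glue_of_notMem 𝒜 hu.2]

/-- A rearrangement may be infinite at `0` even if the function is finite everywhere. Functions
built from `decr` are therefore only almost everywhere finite, and this is read off from their
distribution. -/
theorem ae_ne_top_of_measure_lt_le {μ : Measure ℝ} {f g : ℝ → ℝ≥0∞} {c : ℝ≥0∞} (hc : c ≠ ∞)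
    [IsFiniteMeasure μ] (hf : Measurable f) (hft : ∀ u, f u ≠ ∞)
    (h : ∀ s : ℝ≥0∞, μ {u | s < g u} ≤ c * μ {u | s < f u}) : ∀ᵐ u ∂μ, g u ≠ ∞ := by
  have hanti : Antitone fun n : ℕ => {u | (n : ℝ≥0∞) < f u} := fun m n hmn u hu =>
    lt_of_le_of_lt (show (m : ℝ≥0∞) ≤ n by exact_mod_cast hmn) hu
  have hlim := tendsto_measure_iInter_atTop (μ := μ)
    (fun n : ℕ => (measurableSet_lt measurable_const hf).nullMeasurableSet) hanti
    ⟨0, measure_ne_top _ _⟩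
  have h0 : ⋂ n : ℕ, {u | (n : ℝ≥0∞) < f u} = ∅ := by
    refine eq_empty_iff_forall_notMem.2 fun u hu => ?_
    obtain ⟨n, hn⟩ := ENNReal.exists_nat_gt (hft u)
    exact absurd (mem_iInter.1 hu n) (not_lt.2 hn.le)
  rw [h0, measure_empty] at hlim
  have hlim' := ENNReal.Tendsto.const_mul hlim (Or.inr hc)
  rw [mul_zero] at hlim'
  rw [ae_iff]
  refine le_antisymm (ge_of_tendsto' hlim' fun n => le_trans (measure_mono ?_) (h n)) zero_le
  intro u hu
  have : g u = ∞ := not_not.1 hu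
  change (n : ℝ≥0∞) < g u
  rw [this]
  exact ENNReal.natCast_lt_top n

theorem partialAverage_coe (x : L0 I) :
    (partialAverage 𝒜 x : ℝ → ℝ) =ᵐ[volume.restrict I] partialAverageFun 𝒜 x :=
  AEEqFun.coeFn_mk _ _

theorem partialAverageFun_of_mem (x : L0 I) {k : ℕ} {u : ℝ} (hu : u ∈ 𝒜.sets k) :
    partialAverageFun 𝒜 x u = (volume.real (𝒜.sets k))⁻¹ * ∫ s in 𝒜.sets k, x s := by
  rw [partialAverageFun, tsum_eq_single k, indicator_of_mem hu, indicator_of_notMem, add_zero]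
  · exact fun h => h (mem_iUnion.2 ⟨k, hu⟩)
  · intro j hj
    exact indicator_of_notMem (fun hj' => disjoint_left.1 (𝒜.disjoint hj) hj' hu) _

theorem partialAverageFun_of_notMem (x : L0 I) {u : ℝ} (hu : u ∉ ⋃ k, 𝒜.sets k) :
    partialAverageFun 𝒜 x u = x u := by
  have h : ∀ k, (𝒜.sets k).indicator
      (fun _ => (volume.real (𝒜.sets k))⁻¹ * ∫ s in 𝒜.sets k, x s) u = 0 := fun k =>
    indicator_of_notMem (fun hk => hu (mem_iUnion.2 ⟨k, hk⟩)) _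
  simp only [partialAverageFun, h, tsum_zero, zero_add]
  exact indicator_of_mem hu _

theorem setLIntegral_const_sub_le {C : Set ℝ} {m s : ℝ≥0∞} {f : ℝ → ℝ≥0∞}
    (hC : volume C ≠ ∞) (h : m * volume C ≤ ∫⁻ u in C, f u) :
    ∫⁻ _ in C, (m - s) ≤ ∫⁻ u in C, (f u - s) := by
  rw [setLIntegral_const, ENNReal.sub_mul fun _ _ => hC]
  rw [tsub_le_iff_right]
  refine h.trans ((lintegral_mono fun u => (le_tsub_add : f u ≤ f u - s + s)).trans ?_)
  rw [lintegral_add_right _ measurable_const, setLIntegral_const]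

theorem enorm_average_mul_le (x : L0 I) {C : Set ℝ} (hC : volume C ≠ ∞) :
    ‖(volume.real C)⁻¹ * ∫ s in C, x s‖ₑ * volume C ≤ ∫⁻ u in C, ‖x u‖ₑ := by
  by_cases h0 : volume C = 0
  · simp [h0]
  have ha : 0 < volume.real C := ENNReal.toReal_pos h0 hC
  rw [enorm_mul, enorm_inv ha.ne', Real.enorm_eq_ofReal ha.le, Measure.real,
    ENNReal.ofReal_toReal hC, mul_right_comm, ENNReal.inv_mul_cancel h0 hC, one_mul]
  exact enorm_integral_le_lintegral_enorm _

/-- Jensen's inequality for `(· - s)₊` on each set of the family, summed over the family. -/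
theorem partialAverage_submajorized (hI : MeasurableSet I) (x : L0 I) :
    Submajorized (partialAverage 𝒜 x) x := by
  refine submajorized_of_exc_le fun s _ => ?_
  have h1 : exc (partialAverage 𝒜 x) s = ∫⁻ u in I, (‖partialAverageFun 𝒜 x u‖ₑ - s) :=
    lintegral_congr_ae ((partialAverage_coe 𝒜 x).mono fun u hu => by simp only [hu])
  rw [h1]
  refine lintegral_family_le 𝒜 hI (fun k => ?_) fun u hu => ?_
  · refine le_trans (le_of_eq (setLIntegral_congr_fun (𝒜.measurable k) fun u hu => ?_))
      (setLIntegral_const_sub_le (𝒜.finite k).ne (enorm_average_mul_le x (𝒜.finite k).ne))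
    simp only [partialAverageFun_of_mem 𝒜 x hu]
  · rw [partialAverageFun_of_notMem 𝒜 x hu.2]

theorem partialAverageFun_eq_toReal {x : L0 I} (hx : 0 ≤ x) {k : ℕ} {u : ℝ}
    (hu : u ∈ 𝒜.sets k) : partialAverageFun 𝒜 x u =
      ((volume (𝒜.sets k))⁻¹ * ∫⁻ u in 𝒜.sets k, ‖x u‖ₑ).toReal := by
  rw [partialAverageFun_of_mem 𝒜 x hu, ENNReal.toReal_mul, ENNReal.toReal_inv, ← Measure.real,
    ← integral_norm_eq_lintegral_enorm x.measurable.aestronglyMeasurable]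
  congr 1
  refine integral_congr_ae ?_
  filter_upwards [ae_restrict_of_ae_restrict_of_subset (𝒜.subset k) (nonneg_iff_ae.1 hx)] with v hv
  exact (Real.norm_of_nonneg hv).symm

end Gluing

/-! ### Closed convex hulls of orbits -/

namespace SymmetricSpace

variable {I : Set ℝ} {E : SymmetricSpace I}

theorem mem_closedConvHull_of_mem {S : Set (L0 I)} {z : L0 I} (hz : z ∈ S) (hE : z ∈ E.carrier) :
    z ∈ E.closedConvHull S :=
  ⟨hE, fun ε hε => ⟨z, subset_convexHull ℝ S hz, by
    rw [sub_self, extNorm_zero]; exact ENNReal.ofReal_pos.2 hε⟩⟩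

theorem extNorm_inv_smul_sum_le {n : ℕ} (hn : n ≠ 0) {d : ℕ → L0 I} {ε : ℝ}
    (hd : ∀ i < n, E.extNorm (d i) < ENNReal.ofReal ε) :
    E.extNorm ((n : ℝ)⁻¹ • ∑ i ∈ Finset.range n, d i) ≤ ENNReal.ofReal ε := by
  have hn' : (0 : ℝ) < n := by positivity
  refine (extNorm_smul_le (inv_ne_zero hn'.ne') _).trans ?_
  refine (mul_le_mul_right ((extNorm_sum_le _ _).trans
    (Finset.sum_le_sum fun i hi => (hd i (Finset.mem_range.1 hi)).le)) _).trans ?_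
  rw [Finset.sum_const, Finset.card_range, nsmul_eq_mul, abs_of_pos (inv_pos.2 hn'),
    ← ENNReal.ofReal_natCast n, ← ENNReal.ofReal_mul hn'.le,
    ← ENNReal.ofReal_mul (inv_nonneg.2 hn'.le), inv_mul_cancel_left₀ hn'.ne']

/-- The closed convex hull is convex and closed: half of `ε` is spent on the mean, half on replacing
each `w i` by a point of the convex hull. -/
theorem mem_closedConvHull_of_approx {S : Set (L0 I)} {z : L0 I} (hz : z ∈ E.carrier)
    (h : ∀ ε : ℝ, 0 < ε → ∃ n : ℕ, n ≠ 0 ∧ ∃ w : ℕ → L0 I, (∀ i < n, w i ∈ E.closedConvHull S) ∧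
      E.extNorm (z - (n : ℝ)⁻¹ • ∑ i ∈ Finset.range n, w i) < ENNReal.ofReal ε) :
    z ∈ E.closedConvHull S := by
  refine ⟨hz, fun ε hε => ?_⟩
  obtain ⟨n, hn, w, hw, hzw⟩ := h (ε / 2) (by positivity)
  have hn' : (0 : ℝ) < n := by positivity
  have hv : ∀ i, ∃ v : L0 I, i < n → v ∈ convexHull ℝ S ∧
      E.extNorm (w i - v) < ENNReal.ofReal (ε / 2) := fun i => by
    by_cases hi : i < n
    · obtain ⟨v, hv⟩ := (hw i hi).2 (ε / 2) (by positivity)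
      exact ⟨v, fun _ => hv⟩
    · exact ⟨0, fun h => absurd h hi⟩
  choose v hv using hv
  refine ⟨(n : ℝ)⁻¹ • ∑ i ∈ Finset.range n, v i, ?_, ?_⟩
  · rw [Finset.smul_sum]
    refine (convex_convexHull ℝ S).sum_mem (fun _ _ => inv_nonneg.2 hn'.le) ?_
      fun i hi => (hv i (Finset.mem_range.1 hi)).1
    rw [Finset.sum_const, Finset.card_range, nsmul_eq_mul, mul_inv_cancel₀ hn'.ne']
  · refine (extNorm_sub_le z ((n : ℝ)⁻¹ • ∑ i ∈ Finset.range n, w i) _).trans_lt ?_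
    rw [← smul_sub, ← Finset.sum_sub_distrib,
      show ε = ε / 2 + ε / 2 by ring, ENNReal.ofReal_add (by positivity) (by positivity)]
    have hle := extNorm_inv_smul_sum_le (E := E) hn (d := fun i => w i - v i) fun i hi => (hv i hi).2
    exact ENNReal.add_lt_add_of_lt_of_le (hle.trans_lt ENNReal.ofReal_lt_top).ne hzw hle

end SymmetricSpace

section Orbits

variable {I : Set ℝ}

open Classical in
/-- The set whose closed convex hull is `Q'(x)`. -/
def orbitSet (x : L0 I) : Set (L0 I) :=
  if x ∈ L1set I then (OmegaPrime x).extremePoints ℝ else equimeasurableSet x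

theorem QPrime_eq (E : SymmetricSpace I) (x : L0 I) :
    QPrime E x = E.closedConvHull (orbitSet x) := by
  unfold QPrime orbitSet
  split_ifs <;> rfl

theorem rearr_eq_of_mem_orbitSet {x y : L0 I} (hI : IsInitialInterval I) (hx : 0 ≤ x)
    (hy : y ∈ orbitSet x) : 0 ≤ y ∧ rearr y = rearr x := by
  unfold orbitSet at hy
  split_ifs at hy with h
  · exact ⟨(mem_OmegaPrime_iff.1 hy.1).1, rearr_eq_of_mem_extremePoints hI hx h hy⟩
  · exact ⟨hy.1, hy.2.1⟩

theorem measure_lt_eq_top_of_lt_rearrInf {x : L0 I} {s : ℝ≥0∞} (hs : s < rearrInf x) :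
    volume.restrict I {u | s < ‖x u‖ₑ} = ∞ := by
  by_contra hne
  have h1 : s < rearr x (volume.restrict I {u | s < ‖x u‖ₑ}).toReal := lt_of_lt_of_le hs
    (iInf_le _ _)
  rw [rearr_eq_decr, lt_decr_iff, ENNReal.ofReal_toReal hne] at h1
  exact lt_irrefl _ h1

/-- The class of a constant function. -/
def constL0 (I : Set ℝ) (c : ℝ≥0∞) : L0 I := ofENN I (fun _ => c) measurable_const

theorem rearr_constL0_le (c : ℝ≥0∞) (t : ℝ) : rearr (constL0 I c) t ≤ c := by
  refine decr_le_iff.2 (le_trans (le_of_eq ?_) zero_le)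
  refine measure_eq_zero_iff_ae_notMem.2 ?_
  filter_upwards [mag_ofENN_le (I := I) (fun _ => c) measurable_const] with u hu
  exact not_lt.2 hu

/-- The function that agrees with `z` where `z ≥ c` and takes the values `0` and `c` elsewhere. -/
def truncStep (c θ : ℝ) (z : ℝ → ℝ) (u : ℝ) : ℝ :=
  if c ≤ z u then z u else if θ < z u then c else 0

theorem measurable_truncStep (c θ : ℝ) {z : ℝ → ℝ} (hz : Measurable z) :
    Measurable (truncStep c θ z) :=
  Measurable.ite (measurableSet_le measurable_const hz) hz
    (Measurable.ite (measurableSet_lt measurable_const hz) measurable_const measurable_const)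

/-- Where `z < c`, the number of thresholds `c i / n` below `z` is `⌈n z / c⌉`, so the mean of the
two-valued functions is `z` rounded up to a multiple of `c / n`. -/
theorem abs_sub_mean_truncStep_le {c : ℝ} (hc : 0 < c) {z : ℝ → ℝ} {u : ℝ} (hz : 0 ≤ z u) {n : ℕ}
    (hn : n ≠ 0) : |z u - (n : ℝ)⁻¹ * ∑ i ∈ Finset.range n, truncStep c (c * i / n) z u| ≤
      (n : ℝ)⁻¹ * c := by
  have hn' : (0 : ℝ) < n := by positivity
  by_cases h : c ≤ z u
  · have : ∀ i ∈ Finset.range n, truncStep c (c * i / n) z u = z u := fun i _ => by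
      simp [truncStep, h]
    rw [Finset.sum_congr rfl this, Finset.sum_const, Finset.card_range, nsmul_eq_mul,
      inv_mul_cancel_left₀ hn'.ne', sub_self, abs_zero]
    positivity
  · push Not at h
    set r : ℝ := n * z u / c with hr
    have hr0 : 0 ≤ r := by positivity
    have hrn : r ≤ n := by
      rw [hr, div_le_iff₀ hc]
      exact mul_le_mul_of_nonneg_left h.le hn'.le
    have hval : ∀ i ∈ Finset.range n, truncStep c (c * i / n) z u =
        if i ∈ Finset.range ⌈r⌉₊ then c else 0 := fun i _ => by
      rw [truncStep, if_neg (not_le.2 h)]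
      refine if_congr ?_ rfl rfl
      rw [Finset.mem_range, Nat.lt_ceil, hr, lt_div_iff₀ hc, div_lt_iff₀ hn']
      constructor <;> intro h <;> linarith
    have hsub : Finset.range ⌈r⌉₊ ⊆ Finset.range n :=
      Finset.range_subset_range.2 (Nat.ceil_le.2 hrn)
    rw [Finset.sum_congr rfl hval, Finset.sum_ite_mem, Finset.inter_eq_right.2 hsub,
      Finset.sum_const, Finset.card_range, nsmul_eq_mul]
    have h1 := Nat.le_ceil r
    have h2 := Nat.ceil_lt_add_one hr0
    have hz' : z u = (n : ℝ)⁻¹ * (r * c) := by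
      rw [hr]; field_simp
    rw [hz', ← mul_sub, ← sub_mul, abs_mul, abs_mul, abs_of_pos hc, abs_of_pos (inv_pos.2 hn')]
    have h3 : |r - ⌈r⌉₊| ≤ 1 := abs_le.2 ⟨by linarith, by linarith⟩
    have := mul_le_mul_of_nonneg_right h3 hc.le
    exact mul_le_mul_of_nonneg_left (by linarith) (inv_nonneg.2 hn'.le)

/-- Only values below `c = x*(∞)` are changed. This is invisible at levels `s ≥ c`; at levels `s <
c` both distribution functions are infinite, because `{z > θ}` has infinite measure for `θ < c`. -/
theorem rearr_truncStep {x z : L0 I} (hz : 0 ≤ z) (h : rearr z = rearr x) {c θ : ℝ} (hc : 0 < c)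
    (hcx : ENNReal.ofReal c = rearrInf x) (hθ : θ < c) :
    rearr (AEEqFun.mk (truncStep c θ z)
      (measurable_truncStep c θ z.measurable).aestronglyMeasurable : L0 I) = rearr x := by
  rw [← h, rearr_eq_decr, rearr_eq_decr]
  refine decr_eq_of_measure_eq fun s hs => ?_
  have hcz : ENNReal.ofReal c = rearrInf z := by rw [hcx, rearrInf, rearrInf, h]
  have hcoe := AEEqFun.coeFn_mk (truncStep c θ z)
    (measurable_truncStep c θ z.measurable).aestronglyMeasurable (μ := volume.restrict I)
  rcases le_or_gt (ENNReal.ofReal c) s with hcs | hcs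
  · refine measure_congr ?_
    filter_upwards [hcoe, nonneg_iff_ae.1 hz] with u hu hz0
    refine propext ?_
    change s < ‖_‖ₑ ↔ s < ‖z u‖ₑ
    rw [hu, truncStep]
    split_ifs with h1 h2
    · exact Iff.rfl
    · rw [Real.enorm_eq_ofReal hc.le, Real.enorm_eq_ofReal hz0]
      exact iff_of_false (not_lt.2 hcs)
        (not_lt.2 ((ENNReal.ofReal_le_ofReal (not_le.1 h1).le).trans hcs))
    · rw [Real.enorm_eq_ofReal hz0, enorm_zero]
      exact iff_of_false not_lt_zero
        (not_lt.2 ((ENNReal.ofReal_le_ofReal (not_le.1 h1).le).trans hcs))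
  · rw [measure_lt_eq_top_of_lt_rearrInf (x := z) (hcz ▸ hcs)]
    have hθz : volume.restrict I {u | ENNReal.ofReal θ < ‖z u‖ₑ} = ∞ :=
      measure_lt_eq_top_of_lt_rearrInf (hcz ▸ (ENNReal.ofReal_lt_ofReal_iff hc).2 hθ)
    refine top_le_iff.1 (hθz.ge.trans (measure_mono_ae ?_))
    filter_upwards [hcoe, nonneg_iff_ae.1 hz] with u hu hz0 hθu
    change s < ‖_‖ₑ
    have h1 : ENNReal.ofReal θ < ‖z u‖ₑ := hθu
    rw [Real.enorm_eq_ofReal hz0] at h1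
    have h2 : θ < z u := by
      by_contra! hle
      exact absurd (ENNReal.ofReal_le_ofReal hle) (not_le.2 h1)
    rw [hu, truncStep, if_pos h2]
    split_ifs with h3
    · rw [Real.enorm_eq_ofReal hz0]
      exact hcs.trans_le (ENNReal.ofReal_le_ofReal h3)
    · rwa [Real.enorm_eq_ofReal hc.le]

theorem coeFn_inv_smul_sum {n : ℕ} (w : ℕ → L0 I) :
    ((n : ℝ)⁻¹ • ∑ i ∈ Finset.range n, w i : L0 I) =ᵐ[volume.restrict I]
      fun u => (n : ℝ)⁻¹ * ∑ i ∈ Finset.range n, w i u := by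
  have hsum : ∀ m : ℕ, (∑ i ∈ Finset.range m, w i : L0 I) =ᵐ[volume.restrict I]
      fun u => ∑ i ∈ Finset.range m, w i u := fun m => by
    induction m with
    | zero =>
      filter_upwards [AEEqFun.coeFn_zero (α := ℝ) (β := ℝ) (μ := volume.restrict I)] with u hu
      simpa using hu
    | succ m ih =>
      rw [Finset.sum_range_succ]
      filter_upwards [ih, AEEqFun.coeFn_add (∑ i ∈ Finset.range m, w i) (w m)] with u h1 h2
      rw [h2, Pi.add_apply, h1, Finset.sum_range_succ]
  filter_upwards [hsum n, AEEqFun.coeFn_smul (n : ℝ)⁻¹ (∑ i ∈ Finset.range n, w i)] with u h1 h2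
  rw [h2, Pi.smul_apply, h1, smul_eq_mul]

theorem exists_nat_inv_mul_lt {a : ℝ≥0∞} (ha : a ≠ ∞) {ε : ℝ} (hε : 0 < ε) :
    ∃ n : ℕ, n ≠ 0 ∧ ENNReal.ofReal (n : ℝ)⁻¹ * a < ENNReal.ofReal ε := by
  obtain ⟨n, hn⟩ := exists_nat_gt (a.toReal / ε)
  have hn' : (0 : ℝ) < n := lt_of_le_of_lt (by positivity) hn
  refine ⟨n, by exact_mod_cast hn'.ne', ?_⟩
  rw [← ENNReal.ofReal_toReal ha, ← ENNReal.ofReal_mul (inv_nonneg.2 hn'.le),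
    ENNReal.ofReal_lt_ofReal_iff hε, inv_mul_lt_iff₀ hn']
  exact (div_lt_iff₀ hε).1 hn

namespace SymmetricSpace

variable {E : SymmetricSpace I}

theorem extNorm_constL0_rearrInf_le (hI : IsInitialInterval I) (hE : E.IsFullySymmetric)
    (x : L0 I) : E.extNorm (constL0 I (rearrInf x)) ≤ E.extNorm x :=
  extNorm_le_of_submajorized hI hE fun _ _ => lintegral_mono fun s =>
    (rearr_constL0_le _ s).trans (iInf_le _ s)

theorem rearrInf_lt_top {x : L0 I} (hx : x ∈ E.carrier) : rearrInf x < ∞ :=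
  (iInf_le _ 1).trans_lt (rearr_lt_top (E.subset_S0 x hx) one_pos)

/-- For `x ∉ L₁` the generators may not take values strictly between `0` and `x*(∞)`, while `z` may.
Replacing those values by `0` or `x*(∞)` with equally spaced thresholds gives generators whose mean
approaches `z` uniformly, with error at most `n⁻¹ x*(∞)`; the constant `x*(∞)` belongs to `E`. -/
theorem mem_closedConvHull_orbitSet (hI : IsInitialInterval I) (hE : E.IsFullySymmetric)
    {x z : L0 I} (hx : x ∈ E.carrier) (hz : 0 ≤ z) (h : rearr z = rearr x) :
    z ∈ E.closedConvHull (orbitSet x) := by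
  have hzE := mem_of_rearr_eq hx h
  by_cases hL : x ∈ L1set I
  · refine mem_closedConvHull_of_mem ?_ hzE
    rw [orbitSet, if_pos hL]
    exact mem_extremePoints_of_rearr_eq hL hz h
  rw [orbitSet, if_neg hL]
  have hinf : rearrInf z = rearrInf x := by rw [rearrInf, rearrInf, h]
  by_cases h0 : rearrInf x = 0
  · refine mem_closedConvHull_of_mem ⟨hz, h, ae_of_all _ fun u hu => ?_⟩ hzE
    rw [hinf, h0] at hu
    exact absurd hu not_lt_zero
  set c : ℝ := (rearrInf x).toReal
  have hc : 0 < c := ENNReal.toReal_pos h0 (rearrInf_lt_top hx).ne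
  have hcx : ENNReal.ofReal c = rearrInf x := ENNReal.ofReal_toReal (rearrInf_lt_top hx).ne
  refine mem_closedConvHull_of_approx hzE fun ε hε => ?_
  obtain ⟨n, hn, hnε⟩ := exists_nat_inv_mul_lt (extNorm_lt_top hx).ne hε
  have hn' : (0 : ℝ) < n := by positivity
  set w : ℕ → L0 I := fun i => AEEqFun.mk (truncStep c (c * i / n) z)
    (measurable_truncStep c _ z.measurable).aestronglyMeasurable with hw
  refine ⟨n, hn, w, fun i hi => ?_, ?_⟩
  · have hr : rearr (w i) = rearr x := rearr_truncStep hz h hc hcx (by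
      rw [div_lt_iff₀ hn']
      exact mul_lt_mul_of_pos_left (by exact_mod_cast hi) hc)
    have hcoe := AEEqFun.coeFn_mk (truncStep c (c * i / n) z)
      (measurable_truncStep c _ z.measurable).aestronglyMeasurable (μ := volume.restrict I)
    refine mem_closedConvHull_of_mem ⟨nonneg_iff_ae.2 ?_, hr, ?_⟩ (mem_of_rearr_eq hx hr)
    · filter_upwards [hcoe, nonneg_iff_ae.1 hz] with u hu hz0
      rw [hu, truncStep]
      split_ifs
      exacts [hz0, hc.le, le_rfl]
    · have : rearrInf (w i) = ENNReal.ofReal c := by rw [rearrInf, hr, hcx, rearrInf]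
      rw [this]
      filter_upwards [hcoe] with u hu hlt
      rw [ENNReal.ofReal_lt_ofReal_iff hc, hu] at hlt
      rw [hu]
      revert hlt
      rw [truncStep]
      split_ifs with h1 h2
      · exact fun h3 => absurd h1 (not_le.2 h3)
      · exact fun h3 => absurd h3 (lt_irrefl _)
      · exact fun _ => rfl
  · refine lt_of_le_of_lt ?_ hnε
    refine le_trans (extNorm_mono (x := (n : ℝ)⁻¹ • constL0 I (rearrInf x)) ?_) ?_
    · have hall : ∀ᵐ u ∂(volume.restrict I), ∀ i : ℕ, w i u = truncStep c (c * i / n) z u :=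
        ae_all_iff.2 fun i => AEEqFun.coeFn_mk _ _
      filter_upwards [hall, AEEqFun.coeFn_sub z ((n : ℝ)⁻¹ • ∑ i ∈ Finset.range n, w i),
        coeFn_inv_smul_sum (n := n) w, AEEqFun.coeFn_smul (n : ℝ)⁻¹ (constL0 I (rearrInf x)),
        ofENN_coe (I := I) (fun _ => rearrInf x) measurable_const, nonneg_iff_ae.1 hz]
        with u h1 h2 h3 h4 h5 h6
      rw [h2, Pi.sub_apply, h3, h4, Pi.smul_apply, constL0, h5, smul_eq_mul,
        Finset.sum_congr rfl fun i _ => h1 i, enorm_le_iff_norm_le, Real.norm_eq_abs,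
        Real.norm_eq_abs, abs_of_pos (show 0 < (n : ℝ)⁻¹ * (rearrInf x).toReal from
          mul_pos (inv_pos.2 hn') hc)]
      exact abs_sub_mean_truncStep_le hc h6 hn
    · refine (extNorm_smul_le (inv_ne_zero hn'.ne') _).trans ?_
      rw [abs_of_pos (inv_pos.2 hn')]
      gcongr
      exact extNorm_constL0_rearrInf_le hI hE x

end SymmetricSpace

end Orbits

/-! ### Approximating partial averages by means of shifts -/

section PartialAverages

variable {I : Set ℝ} (𝒜 : AveragingFamily I)

theorem ae_family {P : ℝ → Prop} (h1 : ∀ k, ∀ᵐ u ∂(volume.restrict (𝒜.sets k)), P u)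
    (h2 : ∀ᵐ u ∂(volume.restrict (I \ ⋃ k, 𝒜.sets k)), P u) :
    ∀ᵐ u ∂(volume.restrict I), P u := by
  have h3 : ∀ᵐ u ∂(volume.restrict ((⋃ k, 𝒜.sets k) ∪ (I \ ⋃ k, 𝒜.sets k))), P u :=
    ae_restrict_union_iff _ _ _ |>.2 ⟨(ae_restrict_iUnion_iff _ _).2 h1, h2⟩
  exact ae_restrict_of_ae_restrict_of_subset (fun u hu => by
    by_cases h : u ∈ ⋃ k, 𝒜.sets k
    · exact Or.inl h
    · exact Or.inr ⟨hu, h⟩) h3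

/-- The `i`-th of `n` simultaneous cyclic shifts of `x` on the sets of the family. -/
def shiftENN (x : L0 I) (n i : ℕ) : ℝ → ℝ≥0∞ :=
  glue 𝒜 (fun k => shiftFun (𝒜.sets k) (fun u => ‖x u‖ₑ) n i) fun u => ‖x u‖ₑ

/-- The upper `n`-th parts of `x` on the sets of the family, repeated periodically. -/
def periodENN (x : L0 I) (n : ℕ) : ℝ → ℝ≥0∞ :=
  glue 𝒜 (fun k u => (n : ℝ≥0∞)⁻¹ * periodFun (𝒜.sets k) (fun u => ‖x u‖ₑ) n u) fun _ => 0

/-- The averages of the upper `n`-th parts of `x` on the sets of the family. -/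
def meanENN (x : L0 I) (n : ℕ) : ℝ → ℝ≥0∞ :=
  glue 𝒜 (fun k _ => (volume (𝒜.sets k))⁻¹ * ∫⁻ v in Ico 0 (volume.real (𝒜.sets k) / n),
    decr (volume.restrict (𝒜.sets k)) (fun u => ‖x u‖ₑ) v) fun _ => 0

variable {𝒜}

theorem sets_subset_Ioi (hI : IsInitialInterval I) (k : ℕ) : 𝒜.sets k ⊆ Ioi 0 :=
  fun u hu => hI.pos u (𝒜.subset k hu)

theorem measurable_shiftENN (hI : IsInitialInterval I) (x : L0 I) (n i : ℕ) :
    Measurable (shiftENN 𝒜 x n i) :=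
  measurable_glue 𝒜 (fun k => measurable_shiftFun (sets_subset_Ioi hI k) _ n i) (measurable_mag x)

theorem measurable_periodENN (hI : IsInitialInterval I) (x : L0 I) (n : ℕ) :
    Measurable (periodENN 𝒜 x n) :=
  measurable_glue 𝒜 (fun k => (measurable_periodFun (sets_subset_Ioi hI k) _ n).const_mul _)
    measurable_const

theorem measurable_meanENN (x : L0 I) (n : ℕ) : Measurable (meanENN 𝒜 x n) :=
  measurable_glue 𝒜 (fun _ => measurable_const) measurable_const

/-- The class of `shiftENN`. -/
def shiftL0 (𝒜 : AveragingFamily I) (hI : IsInitialInterval I) (x : L0 I) (n i : ℕ) : L0 I :=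
  ofENN I _ (measurable_shiftENN (𝒜 := 𝒜) hI x n i)

/-- The class of `periodENN`. -/
def periodL0 (𝒜 : AveragingFamily I) (hI : IsInitialInterval I) (x : L0 I) (n : ℕ) : L0 I :=
  ofENN I _ (measurable_periodENN (𝒜 := 𝒜) hI x n)

/-- The class of `meanENN`. -/
def meanL0 (𝒜 : AveragingFamily I) (x : L0 I) (n : ℕ) : L0 I :=
  ofENN I _ (measurable_meanENN (𝒜 := 𝒜) x n)

theorem isFiniteMeasure_restrict_sets (𝒜 : AveragingFamily I) (k : ℕ) :
    IsFiniteMeasure (volume.restrict (𝒜.sets k)) :=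
  ⟨by rw [Measure.restrict_apply_univ]; exact 𝒜.finite k⟩

theorem restrict_sets_shiftENN (hI : IsInitialInterval I) (x : L0 I) {n : ℕ} (hn : n ≠ 0) (i k : ℕ)
    (s : ℝ≥0∞) : volume.restrict (𝒜.sets k) {u | s < shiftENN 𝒜 x n i u} =
      volume.restrict (𝒜.sets k) {u | s < ‖x u‖ₑ} := by
  by_cases h0 : volume (𝒜.sets k) = 0
  · simp [Measure.restrict_eq_zero.2 h0]
  · rw [shiftENN, restrict_glue_lt]
    exact measure_lt_shiftFun (sets_subset_Ioi hI k) (𝒜.measurable k) (𝒜.finite k).ne h0 hn i s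

theorem restrict_sets_periodENN_le (hI : IsInitialInterval I) (x : L0 I) {n : ℕ} (hn : n ≠ 0)
    (k : ℕ) (s : ℝ≥0∞) : volume.restrict (𝒜.sets k) {u | s < periodENN 𝒜 x n u} ≤
      n * volume.restrict (𝒜.sets k) {u | n * s < ‖x u‖ₑ} := by
  by_cases h0 : volume (𝒜.sets k) = 0
  · simp [Measure.restrict_eq_zero.2 h0]
  · rw [periodENN, restrict_glue_lt]
    refine le_trans (measure_mono fun u hu => ?_) (measure_lt_periodFun_le (sets_subset_Ioi hI k)
      (𝒜.measurable k) (𝒜.finite k).ne h0 (fun u => ‖x u‖ₑ) hn (n * s))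
    have hu' : s < (n : ℝ≥0∞)⁻¹ * periodFun (𝒜.sets k) (fun u => ‖x u‖ₑ) n u := hu
    change n * s < periodFun (𝒜.sets k) (fun u => ‖x u‖ₑ) n u
    by_contra! hle
    refine absurd hu' (not_lt.2 ?_)
    rw [ENNReal.inv_mul_le_iff (by exact_mod_cast hn) (ENNReal.natCast_ne_top n)]
    exact hle

theorem shiftENN_ne_top (hI : IsInitialInterval I) (x : L0 I) {n : ℕ} (hn : n ≠ 0) (i : ℕ) :
    ∀ᵐ u ∂(volume.restrict I), shiftENN 𝒜 x n i u ≠ ∞ := by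
  refine ae_family 𝒜 (fun k => ?_) ?_
  · have := isFiniteMeasure_restrict_sets 𝒜 k
    exact ae_ne_top_of_measure_lt_le ENNReal.one_ne_top (measurable_mag x)
      (fun u => enorm_ne_top) fun s => by rw [one_mul, restrict_sets_shiftENN hI x hn i k]
  · filter_upwards [ae_restrict_mem (hI.measurableSet.diff
      (MeasurableSet.iUnion 𝒜.measurable))] with u hu
    rw [shiftENN, glue_of_notMem 𝒜 hu.2]
    exact enorm_ne_top

theorem periodENN_ne_top (hI : IsInitialInterval I) (x : L0 I) {n : ℕ} (hn : n ≠ 0) :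
    ∀ᵐ u ∂(volume.restrict I), periodENN 𝒜 x n u ≠ ∞ := by
  refine ae_family 𝒜 (fun k => ?_) ?_
  · have := isFiniteMeasure_restrict_sets 𝒜 k
    refine ae_ne_top_of_measure_lt_le (ENNReal.natCast_ne_top n) (measurable_mag x)
      (fun u => enorm_ne_top) fun s => (restrict_sets_periodENN_le hI x hn k s).trans ?_
    refine mul_le_mul_right (measure_mono fun u hu => ?_) _
    have hu' : (n : ℝ≥0∞) * s < ‖x u‖ₑ := hu
    exact lt_of_le_of_lt (le_mul_of_one_le_left'
      (by exact_mod_cast Nat.one_le_iff_ne_zero.2 hn)) hu'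
  · filter_upwards [ae_restrict_mem (hI.measurableSet.diff
      (MeasurableSet.iUnion 𝒜.measurable))] with u hu
    rw [periodENN, glue_of_notMem 𝒜 hu.2]
    exact ENNReal.zero_ne_top

theorem rearr_shiftL0 (hI : IsInitialInterval I) (x : L0 I) {n : ℕ} (hn : n ≠ 0) (i : ℕ) :
    rearr (shiftL0 𝒜 hI x n i) = rearr x := by
  rw [rearr_eq_decr, shiftL0, decr_congr_ae (mag_ofENN _ _ (shiftENN_ne_top hI x hn i))]
  refine decr_eq_of_measure_eq fun s _ => ?_
  rw [measure_family 𝒜 (measurableSet_lt measurable_const (measurable_shiftENN hI x n i)),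
    measure_family 𝒜 (measurableSet_lt measurable_const (measurable_mag x))]
  congr 1
  · exact tsum_congr fun k => restrict_sets_shiftENN hI x hn i k s
  · exact restrict_compl_glue_lt 𝒜 hI.measurableSet s

/-- On each set the upper values of `x`, divided by `n`, are repeated at most `n` times, so the
measure above level `s` is at most `n μ{|x| > n s}`. For `n s = x*(t / n)` this is at most `t`. Here
the dilation `σ_n` enters. -/
theorem rearr_periodL0_le (hI : IsInitialInterval I) (x : L0 I) {n : ℕ} (hn : n ≠ 0) (t : ℝ) :
    rearr (periodL0 𝒜 hI x n) t ≤ (n : ℝ≥0∞)⁻¹ * rearr x (t / n) := by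
  have hn' : (0 : ℝ) < n := by positivity
  have hn0 : (n : ℝ≥0∞) ≠ 0 := by exact_mod_cast hn
  refine (decr_mono (mag_ofENN_le _ _) t).trans (decr_le_iff.2 ?_)
  set s := (n : ℝ≥0∞)⁻¹ * rearr x (t / n) with hs
  have hns : n * s = rearr x (t / n) := by
    rw [hs, ENNReal.mul_inv_cancel_left hn0 (ENNReal.natCast_ne_top n)]
  rw [measure_family 𝒜 (measurableSet_lt measurable_const (measurable_periodENN hI x n)),
    periodENN, restrict_compl_glue_lt 𝒜 hI.measurableSet]
  have h0 : {u : ℝ | s < (0 : ℝ≥0∞)} = ∅ := by simp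
  rw [h0, measure_empty, add_zero]
  calc _ ≤ ∑' k, n * volume.restrict (𝒜.sets k) {u | n * s < ‖x u‖ₑ} :=
        ENNReal.tsum_le_tsum fun k => restrict_sets_periodENN_le hI x hn k s
    _ = n * ∑' k, volume.restrict (𝒜.sets k) {u | n * s < ‖x u‖ₑ} := ENNReal.tsum_mul_left
    _ ≤ n * volume.restrict I {u | n * s < ‖x u‖ₑ} := by
        rw [measure_family 𝒜 (measurableSet_lt measurable_const (measurable_mag x))]
        gcongr
        exact le_self_add
    _ ≤ n * ENNReal.ofReal (t / n) := by
        rw [hns]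
        gcongr
        exact measure_decr_lt_le _ _ _
    _ = ENNReal.ofReal t := by
        rw [← ENNReal.ofReal_natCast, ← ENNReal.ofReal_mul hn'.le, mul_div_cancel₀ _ hn'.ne']

theorem setLIntegral_mag_lt_top {x : L0 I} (hX : ∀ t, rearrInt x t < ∞) {C : Set ℝ} (hCI : C ⊆ I)
    (hC : volume C ≠ ∞) : ∫⁻ u in C, ‖x u‖ₑ < ∞ := by
  refine lt_of_le_of_lt ?_ (hX (volume.real C))
  have := setLIntegral_le_decrInt (aemeasurable_mag x) (B := C) (t := volume.real C) (by
    rw [Measure.real, ENNReal.ofReal_toReal hC]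
    exact Measure.restrict_apply_le _ _)
  rwa [Measure.restrict_restrict_of_subset hCI] at this

theorem lintegral_first_cell_le (x : L0 I) (C : Set ℝ) (b : ℝ) :
    ∫⁻ v in Ico 0 b, decr (volume.restrict C) (fun u => ‖x u‖ₑ) v ≤ ∫⁻ u in C, ‖x u‖ₑ := by
  rw [← lintegral_decr_restrict (measurable_mag x)]
  exact lintegral_mono' (restrict_Ico_le b) le_rfl

theorem ae_notMem_null_sets (𝒜 : AveragingFamily I) :
    ∀ᵐ u, ∀ k, volume (𝒜.sets k) = 0 → u ∉ 𝒜.sets k := by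
  refine ae_all_iff.2 fun k => ?_
  by_cases h : volume (𝒜.sets k) = 0
  · exact (measure_eq_zero_iff_ae_notMem.1 h).mono fun u hu _ => hu
  · exact ae_of_all _ fun u h' => absurd h' h

theorem meanENN_ne_top {x : L0 I} (hX : ∀ t, rearrInt x t < ∞) (n : ℕ) :
    ∀ᵐ u ∂(volume.restrict I), meanENN 𝒜 x n u ≠ ∞ := by
  filter_upwards [ae_restrict_of_ae (ae_notMem_null_sets 𝒜)] with u hu
  by_cases hk : u ∈ ⋃ k, 𝒜.sets k
  · obtain ⟨k, hk⟩ := mem_iUnion.1 hk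
    rw [meanENN, glue_of_mem 𝒜 hk]
    refine ENNReal.mul_ne_top (ENNReal.inv_ne_top.2 fun h => hu k h hk) ?_
    exact ((lintegral_first_cell_le x _ _).trans_lt
      (setLIntegral_mag_lt_top hX (𝒜.subset k) (𝒜.finite k).ne)).ne
  · rw [meanENN, glue_of_notMem 𝒜 hk]
    exact ENNReal.zero_ne_top

theorem setLIntegral_periodENN (hI : IsInitialInterval I) (x : L0 I) {n : ℕ} (hn : n ≠ 0) (k : ℕ) :
    ∫⁻ u in 𝒜.sets k, periodENN 𝒜 x n u = ∫⁻ v in Ico 0 (volume.real (𝒜.sets k) / n),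
      decr (volume.restrict (𝒜.sets k)) (fun u => ‖x u‖ₑ) v := by
  by_cases h0 : volume (𝒜.sets k) = 0
  · rw [Measure.restrict_eq_zero.2 h0]
    simp [Measure.real, h0]
  have hn0 : (n : ℝ≥0∞) ≠ 0 := by exact_mod_cast hn
  have h1 := setLIntegral_glue 𝒜 (F := fun k u => (n : ℝ≥0∞)⁻¹ *
    periodFun (𝒜.sets k) (fun u => ‖x u‖ₑ) n u) (f₀ := fun _ => 0) k id
  simp only [id] at h1
  rw [periodENN, h1, lintegral_const_mul _ (measurable_periodFun (sets_subset_Ioi hI k) _ n)]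
  have h2 := lintegral_periodFun (sets_subset_Ioi hI k) (𝒜.measurable k) (𝒜.finite k).ne h0
    (fun u => ‖x u‖ₑ) hn measurable_id
  simp only [id] at h2
  rw [h2, ENNReal.inv_mul_cancel_left hn0 (ENNReal.natCast_ne_top n)]

/-- On each set `meanENN` is the average of `periodENN`, so Jensen's inequality applies set by set
and no separate estimate of its norm is needed. -/
theorem meanL0_submajorized (hI : IsInitialInterval I) {x : L0 I}
    {n : ℕ} (hn : n ≠ 0) : Submajorized (meanL0 𝒜 x n) (periodL0 𝒜 hI x n) := by
  refine submajorized_of_exc_le fun s _ => ?_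
  have h1 : exc (meanL0 𝒜 x n) s ≤ ∫⁻ u in I, (meanENN 𝒜 x n u - s) :=
    lintegral_mono_ae ((mag_ofENN_le _ _).mono fun u hu => tsub_le_tsub_right hu s)
  have h2 : exc (periodL0 𝒜 hI x n) s = ∫⁻ u in I, (periodENN 𝒜 x n u - s) :=
    excess_congr_ae (mag_ofENN _ _ (periodENN_ne_top hI x hn)) s
  rw [h2]
  refine h1.trans (lintegral_family_le 𝒜 hI.measurableSet (fun k => ?_) fun u hu => ?_)
  · have h3 := setLIntegral_glue 𝒜 (F := fun k _ => (volume (𝒜.sets k))⁻¹ *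
      ∫⁻ v in Ico 0 (volume.real (𝒜.sets k) / n),
        decr (volume.restrict (𝒜.sets k)) (fun u => ‖x u‖ₑ) v) (f₀ := fun _ => 0) k (· - s)
    refine h3.le.trans (setLIntegral_const_sub_le (𝒜.finite k).ne ?_)
    rw [setLIntegral_periodENN hI x hn, mul_right_comm]
    exact mul_le_of_le_one_left' (ENNReal.inv_mul_le_one _)
  · rw [meanENN, glue_of_notMem 𝒜 hu.2, zero_tsub]
    exact zero_le

theorem enorm_toReal_sub_le {a b c d : ℝ≥0∞} (ha : a ≠ ∞) (hb : b ≠ ∞) (h1 : a ≤ b + c)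
    (h2 : b ≤ d + a) : ‖a.toReal - b.toReal‖ₑ ≤ d + c := by
  rcases le_total a b with h | h
  · rw [← enorm_neg, neg_sub, ← ENNReal.toReal_sub_of_le h hb,
      Real.enorm_eq_ofReal ENNReal.toReal_nonneg, ENNReal.ofReal_toReal (by finiteness)]
    exact (tsub_le_iff_right.2 h2).trans le_self_add
  · rw [← ENNReal.toReal_sub_of_le h ha,
      Real.enorm_eq_ofReal ENNReal.toReal_nonneg, ENNReal.ofReal_toReal (by finiteness)]
    exact (tsub_le_iff_left.2 h1).trans le_add_self

theorem enorm_partialAverage_sub_le (hI : IsInitialInterval I) {x : L0 I} (hx : 0 ≤ x)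
    (hX : ∀ t, rearrInt x t < ∞) {n : ℕ} (hn : n ≠ 0) :
    ∀ᵐ u ∂(volume.restrict I), ‖(partialAverage 𝒜 x -
      (n : ℝ)⁻¹ • ∑ i ∈ Finset.range n, shiftL0 𝒜 hI x n i : L0 I) u‖ₑ ≤
        ‖(periodL0 𝒜 hI x n + meanL0 𝒜 x n : L0 I) u‖ₑ := by
  have hn0 : (n : ℝ≥0∞) ≠ 0 := by exact_mod_cast hn
  have hsh : ∀ᵐ u ∂(volume.restrict I), ∀ i : ℕ, shiftENN 𝒜 x n i u ≠ ∞ ∧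
      shiftL0 𝒜 hI x n i u = (shiftENN 𝒜 x n i u).toReal := ae_all_iff.2 fun i =>
    (shiftENN_ne_top hI x hn i).and (ofENN_coe _ _)
  filter_upwards [hsh, AEEqFun.coeFn_sub (partialAverage 𝒜 x)
    ((n : ℝ)⁻¹ • ∑ i ∈ Finset.range n, shiftL0 𝒜 hI x n i),
    coeFn_inv_smul_sum (n := n) (shiftL0 𝒜 hI x n),
    AEEqFun.coeFn_add (periodL0 𝒜 hI x n) (meanL0 𝒜 x n),
    ofENN_coe (I := I) _ (measurable_periodENN (𝒜 := 𝒜) hI x n),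
    ofENN_coe (I := I) _ (measurable_meanENN (𝒜 := 𝒜) x n), periodENN_ne_top (𝒜 := 𝒜) hI x hn,
    meanENN_ne_top (𝒜 := 𝒜) hX n, partialAverage_coe 𝒜 x, ae_restrict_of_ae (ae_notMem_null_sets 𝒜),
    nonneg_iff_ae.1 hx] with u h1 h2 h3 h4 h5 h6 h7 h8 h9 h10 h11
  have hsum : (n : ℝ)⁻¹ * ∑ i ∈ Finset.range n, shiftL0 𝒜 hI x n i u =
      ((n : ℝ≥0∞)⁻¹ * ∑ i ∈ Finset.range n, shiftENN 𝒜 x n i u).toReal := by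
    rw [ENNReal.toReal_mul, ENNReal.toReal_inv, ENNReal.toReal_natCast,
      ENNReal.toReal_sum fun i _ => (h1 i).1]
    exact congrArg _ (Finset.sum_congr rfl fun i _ => (h1 i).2)
  have hfin : (n : ℝ≥0∞)⁻¹ * ∑ i ∈ Finset.range n, shiftENN 𝒜 x n i u ≠ ∞ :=
    ENNReal.mul_ne_top (ENNReal.inv_ne_top.2 hn0) (ENNReal.sum_ne_top.2 fun i _ => (h1 i).1)
  have hrhs : ‖(periodL0 𝒜 hI x n + meanL0 𝒜 x n : L0 I) u‖ₑ =
      periodENN 𝒜 x n u + meanENN 𝒜 x n u := by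
    rw [h4, Pi.add_apply, periodL0, meanL0, h5, h6, ← ENNReal.toReal_add h7 h8,
      Real.enorm_eq_ofReal ENNReal.toReal_nonneg, ENNReal.ofReal_toReal (by finiteness)]
  rw [hrhs, h2, Pi.sub_apply, h9, h3, hsum]
  by_cases hk : u ∈ ⋃ k, 𝒜.sets k
  · obtain ⟨k, hk⟩ := mem_iUnion.1 hk
    have h0 : volume (𝒜.sets k) ≠ 0 := fun h => h10 k h hk
    have hft := (𝒜.finite k).ne
    rw [partialAverageFun_eq_toReal 𝒜 hx hk]
    have hsk : ∀ i, shiftENN 𝒜 x n i u = shiftFun (𝒜.sets k) (fun u => ‖x u‖ₑ) n i u :=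
      fun i => glue_of_mem 𝒜 hk
    refine enorm_toReal_sub_le (ENNReal.mul_ne_top (ENNReal.inv_ne_top.2 h0)
      (setLIntegral_mag_lt_top hX (𝒜.subset k) hft).ne) hfin ?_ ?_
    · simp only [hsk]
      rw [meanENN, glue_of_mem 𝒜 hk]
      exact le_mean_shiftFun hft h0 (measurable_mag x) hn u
    · simp only [hsk]
      rw [periodENN, glue_of_mem 𝒜 hk]
      exact mean_shiftFun_le hft h0 (measurable_mag x) hn u
  · have hsk : ∀ i, shiftENN 𝒜 x n i u = ‖x u‖ₑ := fun i => glue_of_notMem 𝒜 hk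
    simp only [hsk]
    rw [Finset.sum_const, Finset.card_range, nsmul_eq_mul,
      ENNReal.inv_mul_cancel_left hn0 (ENNReal.natCast_ne_top n),
      partialAverageFun_of_notMem 𝒜 x hk, toReal_enorm, Real.norm_of_nonneg h11, sub_self,
      enorm_zero]
    exact zero_le

end PartialAverages

/-! ### Sufficiency, reduced to the norms of the repeated first cells. -/

namespace SymmetricSpace

variable {I : Set ℝ} {E : SymmetricSpace I} {𝒜 : AveragingFamily I}

theorem partialAverage_mem_QPrime (hI : IsInitialInterval I) (hE : E.IsFullySymmetric) {x : L0 I}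
    (hx : x ∈ E.carrier) (hx0 : 0 ≤ x)
    (h : ∀ ε : ℝ, 0 < ε → ∃ n : ℕ, n ≠ 0 ∧ E.extNorm (periodL0 𝒜 hI x n) < ENNReal.ofReal ε) :
    partialAverage 𝒜 x ∈ QPrime E x := by
  have hX := rearrInt_lt_top hI hE hx
  rw [QPrime_eq]
  refine mem_closedConvHull_of_approx ?_ fun ε hε => ?_
  · refine extNorm_ne_top_iff.1 ((extNorm_le_of_submajorized hI hE
      (partialAverage_submajorized 𝒜 hI.measurableSet x)).trans_lt (extNorm_lt_top hx)).ne
  · obtain ⟨n, hn, hlt⟩ := h (ε / 2) (half_pos hε)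
    refine ⟨n, hn, shiftL0 𝒜 hI x n, fun i _ => mem_closedConvHull_orbitSet hI hE hx
      (ofENN_nonneg _ _) (rearr_shiftL0 hI x hn i), ?_⟩
    refine (extNorm_mono (enorm_partialAverage_sub_le hI hx0 hX hn)).trans_lt ?_
    refine (extNorm_add_le _ _).trans_lt ?_
    rw [show ε = ε / 2 + ε / 2 by ring, ENNReal.ofReal_add (by positivity) (by positivity)]
    exact ENNReal.add_lt_add hlt ((extNorm_le_of_submajorized hI hE
      (meanL0_submajorized hI hn)).trans_lt hlt)

end SymmetricSpace

theorem ENNReal.le_inv_mul_of_mul_le {a b c : ℝ≥0∞} (h0 : c ≠ 0) (ht : c ≠ ∞) (h : c * a ≤ b) :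
    a ≤ c⁻¹ * b := by
  rw [← ENNReal.inv_mul_cancel_left h0 ht (b := a)]
  gcongr

/-! ### Norm estimates through integrals of rearrangements -/

section IntegralEstimates

variable {I : Set ℝ}

theorem rearr_eq_zero_of_notMem (hI : IsInitialInterval I) (x : L0 I) {u : ℝ} (hu : 0 < u)
    (h : u ∉ I) : rearr x u = 0 := by
  refine le_antisymm (decr_le_iff.2 ((measure_mono (subset_univ _)).trans ?_)) zero_le
  rw [Measure.restrict_apply_univ]
  exact hI.volume_le u hu h

theorem restrict_Ioo_le (t : ℝ) : volume.restrict I (Ioo 0 t) ≤ ENNReal.ofReal t := by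
  refine (Measure.restrict_apply_le _ _).trans ?_
  rw [Real.volume_Ioo, sub_zero]

theorem rearrInt_eq (x : L0 I) (t : ℝ) : rearrInt x t = ∫⁻ u in Ioo 0 t, rearr x u := rfl

theorem setLIntegral_Ioo_restrict (hI : IsInitialInterval I) {g : ℝ → ℝ≥0∞}
    (h : ∀ u, 0 < u → u ∉ I → g u = 0) (t : ℝ) :
    ∫⁻ u in Ioo 0 t, g u = ∫⁻ u in Ioo 0 t, g u ∂(volume.restrict I) := by
  rw [Measure.restrict_restrict measurableSet_Ioo,
    ← lintegral_inter_add_sdiff g (Ioo 0 t) hI.measurableSet,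
    setLIntegral_eq_zero (measurableSet_Ioo.diff hI.measurableSet) (fun u hu => h u hu.1.1 hu.2),
    add_zero]

theorem setLIntegral_le_rearrInt (hI : IsInitialInterval I) {z : L0 I} {g : ℝ → ℝ≥0∞} {t : ℝ}
    (h0 : ∀ u, 0 < u → u ∉ I → g u = 0)
    (h : ∀ᵐ u ∂(volume.restrict I), u < t → g u ≤ ‖z u‖ₑ) :
    ∫⁻ u in Ioo 0 t, g u ≤ rearrInt z t := by
  rw [setLIntegral_Ioo_restrict hI h0]
  refine le_trans ?_ (setLIntegral_le_decrInt (aemeasurable_mag z) (restrict_Ioo_le t))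
  refine lintegral_mono_ae ?_
  filter_upwards [ae_restrict_of_ae h, ae_restrict_mem measurableSet_Ioo] with u hu hut
  exact hu hut.2

theorem rearr_le_of_antitoneOn (hI : IsInitialInterval I) {z : L0 I} {g : ℝ → ℝ≥0∞}
    (hg : AntitoneOn g (Ioi 0)) (h : ∀ᵐ u ∂(volume.restrict I), ‖z u‖ₑ ≤ g u) {t : ℝ}
    (ht : 0 < t) : rearr z t ≤ g t := by
  refine decr_le_iff.2 (le_trans (measure_mono_ae ?_) (restrict_Ioo_le (I := I) t))
  filter_upwards [h, ae_restrict_mem hI.measurableSet] with u hu huI (hlt : g t < ‖z u‖ₑ)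
  have hu0 := hI.pos u huI
  refine ⟨hu0, ?_⟩
  by_contra! hle
  exact absurd (hlt.trans_le (hu.trans (hg (mem_Ioi.2 ht) (mem_Ioi.2 hu0) hle))) (lt_irrefl _)

theorem rearrInt_le_of_antitoneOn (hI : IsInitialInterval I) {z : L0 I} {g : ℝ → ℝ≥0∞}
    (hg : AntitoneOn g (Ioi 0)) (h : ∀ᵐ u ∂(volume.restrict I), ‖z u‖ₑ ≤ g u) (t : ℝ) :
    rearrInt z t ≤ ∫⁻ u in Ioo 0 t, g u :=
  setLIntegral_mono' measurableSet_Ioo fun _ hu => rearr_le_of_antitoneOn hI hg h hu.1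

theorem lintegral_Ioo_comp_div (F : ℝ → ℝ≥0∞) {s : ℝ} (hs : 0 < s) (t : ℝ) :
    ∫⁻ u in Ioo 0 t, F (u / s) = ENNReal.ofReal s * ∫⁻ v in Ioo 0 (t / s), F v := by
  have hmap : Measure.map (fun u => s⁻¹ * u) volume = ENNReal.ofReal s • (volume : Measure ℝ) := by
    rw [Real.map_volume_mul_left (inv_ne_zero hs.ne'), inv_inv, abs_of_pos hs]
  have hemb : MeasurableEmbedding fun u : ℝ => s⁻¹ * u :=
    (Homeomorph.mulLeft₀ s⁻¹ (inv_ne_zero hs.ne')).measurableEmbedding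
  rw [← lintegral_indicator measurableSet_Ioo, ← lintegral_indicator measurableSet_Ioo,
    ← smul_eq_mul (ENNReal.ofReal s), ← lintegral_smul_measure, ← hmap, hemb.lintegral_map]
  refine lintegral_congr fun u => ?_
  have : s⁻¹ * u = u / s := by ring
  rw [this]
  by_cases hu : u ∈ Ioo 0 t
  · rw [indicator_of_mem hu, indicator_of_mem]
    exact ⟨div_pos hu.1 hs, (div_lt_div_iff_of_pos_right hs).2 hu.2⟩
  · rw [indicator_of_notMem hu, indicator_of_notMem]
    rintro ⟨h1, h2⟩
    exact hu ⟨by have := mul_pos h1 hs; rwa [div_mul_cancel₀ _ hs.ne'] at this,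
      (div_lt_div_iff_of_pos_right hs).1 h2⟩

/-- The decreasing rearrangement as an element of `L0 I`. -/
def rearrL0 (x : L0 I) : L0 I := ofENN I (rearr x) (rearr_antitone x).measurable

theorem mag_rearrL0 (hI : IsInitialInterval I) {x : L0 I} (hx : x ∈ S0 I) :
    ∀ᵐ u ∂(volume.restrict I), ‖rearrL0 x u‖ₑ = rearr x u := by
  refine mag_ofENN _ _ ?_
  filter_upwards [ae_restrict_mem hI.measurableSet] with u hu
  exact (rearr_lt_top hx (hI.pos u hu)).ne

theorem rearr_rearrL0 (hI : IsInitialInterval I) {x : L0 I} (hx : x ∈ S0 I) :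
    rearr (rearrL0 x) = rearr x := by
  rw [rearr_eq_decr, decr_congr_ae (mag_rearrL0 hI hx), rearr_eq_decr x]
  refine decr_eq_of_measure_eq fun s _ => ?_
  rw [← volume_lt_decr (volume.restrict I) (fun u => ‖x u‖ₑ), ← rearr_eq_decr]
  have hm : MeasurableSet {u | s < rearr x u} :=
    measurableSet_lt measurable_const (rearr_antitone x).measurable
  rw [Measure.restrict_apply hm, Measure.restrict_apply hm]
  congr 1
  ext u
  refine and_congr_right fun (hu : s < rearr x u) => ⟨hI.pos u, fun h0 => ?_⟩
  by_contra hn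
  rw [rearr_eq_zero_of_notMem hI x h0 hn] at hu
  exact not_lt_zero hu

theorem coeFn_sum_smul {ι : Type*} (s : Finset ι) (c : ι → ℝ) (a : ι → L0 I) :
    ∀ᵐ u ∂(volume.restrict I), (∑ i ∈ s, c i • a i : L0 I) u = ∑ i ∈ s, c i * a i u := by
  classical
  induction s using Finset.induction_on with
  | empty =>
    filter_upwards [AEEqFun.coeFn_zero (α := ℝ) (β := ℝ) (μ := volume.restrict I)] with u hu
    simpa using hu
  | insert j s hj ih =>
    rw [Finset.sum_insert hj]
    filter_upwards [ih, AEEqFun.coeFn_add (c j • a j) (∑ i ∈ s, c i • a i),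
      AEEqFun.coeFn_smul (c j) (a j)] with u h1 h2 h3
    rw [h2, Pi.add_apply, h1, h3, Finset.sum_insert hj, Pi.smul_apply, smul_eq_mul]

theorem mag_dilatedRearr (hI : IsInitialInterval I) {x : L0 I} (hx : x ∈ S0 I) {s : ℝ}
    (hs : 0 < s) : ∀ᵐ u ∂(volume.restrict I),
      ‖dilatedRearr hI.measurableSet s x u‖ₑ = rearr x (u / s) := by
  filter_upwards [AEEqFun.coeFn_mk (dilation I s fun t => (rearr x t).toReal)
    (dilation_rearr_measurable hI.measurableSet x s).aestronglyMeasurable,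
    ae_restrict_mem hI.measurableSet] with u hu huI
  have hu0 : 0 < u / s := div_pos (hI.pos u huI) hs
  rw [dilatedRearr, hu, dilation]
  by_cases h : u / s ∈ I
  · rw [indicator_of_mem h, Real.enorm_eq_ofReal ENNReal.toReal_nonneg,
      ENNReal.ofReal_toReal (rearr_lt_top hx hu0).ne]
  · rw [indicator_of_notMem h, rearr_eq_zero_of_notMem hI x hu0 h, enorm_zero]

theorem mag_dilatedRearrFin (hI : IsInitialInterval I) {x : L0 I} (hx : x ∈ S0 I) {s : ℝ}
    (hs : 0 < s) : ∀ᵐ u ∂(volume.restrict I), ‖dilatedRearrFin hI.measurableSet s x u‖ₑ =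
      (Icc (0 : ℝ) 1).indicator (fun u => rearr x (u / s)) u := by
  filter_upwards [AEEqFun.coeFn_mk ((Icc (0 : ℝ) 1).indicator
      (dilation I s fun t => (rearr x t).toReal))
    ((dilation_rearr_measurable hI.measurableSet x s).indicator
      measurableSet_Icc).aestronglyMeasurable, AEEqFun.coeFn_mk
    (dilation I s fun t => (rearr x t).toReal)
    (dilation_rearr_measurable hI.measurableSet x s).aestronglyMeasurable,
    mag_dilatedRearr hI hx hs] with u hu hu' h
  rw [dilatedRearr, hu'] at h
  rw [dilatedRearrFin, hu]
  by_cases h1 : u ∈ Icc (0 : ℝ) 1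
  · rw [indicator_of_mem h1, indicator_of_mem h1, h]
  · rw [indicator_of_notMem h1, indicator_of_notMem h1, enorm_zero]

theorem antitone_rearr_div (x : L0 I) {s : ℝ} (hs : 0 < s) : Antitone fun u => rearr x (u / s) :=
  fun _ _ hab => rearr_antitone x ((div_le_div_iff_of_pos_right hs).2 hab)

theorem rearrInt_dilatedRearr_le (hI : IsInitialInterval I) {x : L0 I} (hx : x ∈ S0 I)
    {s : ℝ} (hs : 0 < s) (t : ℝ) :
    rearrInt (dilatedRearr hI.measurableSet s x) t ≤ ENNReal.ofReal s * rearrInt x (t / s) := by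
  rw [rearrInt_eq x, ← lintegral_Ioo_comp_div _ hs]
  exact rearrInt_le_of_antitoneOn hI ((antitone_rearr_div x hs).antitoneOn _)
    ((mag_dilatedRearr hI hx hs).mono fun u h => h.le) t

theorem rearrInt_dilatedRearrFin_le (hI : IsInitialInterval I) {x : L0 I} (hx : x ∈ S0 I)
    {s : ℝ} (hs : 0 < s) (t : ℝ) : rearrInt (dilatedRearrFin hI.measurableSet s x) t ≤
      ENNReal.ofReal s * rearrInt x (min t 1 / s) := by
  rw [rearrInt_eq x, ← lintegral_Ioo_comp_div _ hs]
  refine (rearrInt_le_of_antitoneOn hI (g := (Iic (1 : ℝ)).indicator fun u => rearr x (u / s))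
    (fun a _ b _ hab => ?_) ?_ t).trans ?_
  · by_cases hb : b ∈ Iic (1 : ℝ)
    · rw [indicator_of_mem hb, indicator_of_mem (show a ∈ Iic (1 : ℝ) from hab.trans hb)]
      exact antitone_rearr_div x hs hab
    · rw [indicator_of_notMem hb]
      exact zero_le
  · filter_upwards [mag_dilatedRearrFin hI hx hs] with u hu
    rw [hu]
    exact indicator_le_indicator_of_subset (fun _ h => h.2) (fun _ => zero_le) u
  · rw [lintegral_indicator measurableSet_Iic, Measure.restrict_restrict measurableSet_Iic]
    refine (setLIntegral_congr ?_).le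
    have hset : Ioo 0 (min t 1) = Iio 1 ∩ Ioo 0 t := by
      ext u
      simp only [mem_Ioo, mem_inter_iff, mem_Iio, lt_min_iff]
      tauto
    rw [hset]
    exact (Iio_ae_eq_Iic.symm).inter (ae_eq_refl _)

/-- The characteristic function of `I ∩ (-∞, b)`. -/
def indL0 (I : Set ℝ) (b : ℝ) : L0 I :=
  ofENN I ((Iio b).indicator 1) (measurable_one.indicator measurableSet_Iio)

theorem mag_indL0 (b : ℝ) :
    ∀ᵐ u ∂(volume.restrict I), ‖indL0 I b u‖ₑ = (Iio b).indicator 1 u :=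
  mag_ofENN _ _ (ae_of_all _ fun u => by
    by_cases hu : u ∈ Iio b <;> simp [hu])

theorem ofReal_min_le_rearrInt_indL0 (hI : IsInitialInterval I) {b : ℝ} (hb : Ioo 0 b ⊆ I)
    (t : ℝ) : ENNReal.ofReal (min t b) ≤ rearrInt (indL0 I b) t := by
  have h := setLIntegral_le_rearrInt hI (z := indL0 I b) (g := (Ioo 0 b).indicator 1) (t := t)
    (fun u _ hn => indicator_of_notMem (fun h => hn (hb h)) _) ((mag_indL0 b).mono fun u hu _ => by
      rw [hu]
      exact indicator_le_indicator_of_subset (fun _ h => h.2) (fun _ => zero_le) u)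
  refine le_trans (le_of_eq ?_) h
  rw [lintegral_indicator_one measurableSet_Ioo, Measure.restrict_apply measurableSet_Ioo,
    Ioo_inter_Ioo, Real.volume_Ioo]
  simp [min_comm]

theorem rearrInt_indL0_le (hI : IsInitialInterval I) (b t : ℝ) :
    rearrInt (indL0 I b) t ≤ ENNReal.ofReal (min t b) := by
  refine (rearrInt_le_of_antitoneOn hI (g := (Iio b).indicator 1) (fun a _ c _ hac => ?_)
    ((mag_indL0 b).mono fun u hu => hu.le) t).trans ?_
  · by_cases hb : c ∈ Iio b
    · rw [indicator_of_mem hb, indicator_of_mem (show a ∈ Iio b from lt_of_le_of_lt hac hb)]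
      exact le_rfl
    · rw [indicator_of_notMem hb]
      exact zero_le
  · rw [lintegral_indicator_one measurableSet_Iio, Measure.restrict_apply measurableSet_Iio,
      inter_comm, Ioo_inter_Iio, Real.volume_Ioo]
    simp

theorem rearrInt_le_lintegral (x : L0 I) (t : ℝ) : rearrInt x t ≤ ∫⁻ u in I, ‖x u‖ₑ := by
  simpa [excess] using decrInt_le_excess_add (aemeasurable_mag x) 0 t

/-- Concavity of `t ↦ ∫₀ᵗ x*`: beyond `a` its slope is at most `x*(a)`, which is at most the mean of
`x*` over `(0,a)`. -/
theorem ofReal_mul_rearrInt_le (x : L0 I) {a b : ℝ} (ha : 0 ≤ a) (hab : a ≤ b) :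
    ENNReal.ofReal a * rearrInt x b ≤ ENNReal.ofReal b * rearrInt x a := by
  have h1 := decrInt_add_le (volume.restrict I) (fun u => ‖x u‖ₑ) a (b - a)
  rw [add_sub_cancel] at h1
  calc ENNReal.ofReal a * rearrInt x b
      ≤ ENNReal.ofReal a * (rearrInt x a + rearr x a * ENNReal.ofReal (b - a)) := by gcongr; exact h1
    _ = ENNReal.ofReal a * rearrInt x a +
        (rearr x a * ENNReal.ofReal a) * ENNReal.ofReal (b - a) := by ring
    _ ≤ ENNReal.ofReal a * rearrInt x a + rearrInt x a * ENNReal.ofReal (b - a) := by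
        gcongr
        exact decr_mul_le_decrInt _ _ a
    _ = (ENNReal.ofReal a + ENNReal.ofReal (b - a)) * rearrInt x a := by ring
    _ = ENNReal.ofReal b * rearrInt x a := by
        rw [← ENNReal.ofReal_add ha (sub_nonneg.2 hab), add_sub_cancel]

theorem lintegral_eq_zero_of_rearrInt {x : L0 I} {t : ℝ} (ht : 0 < t) (h : rearrInt x t = 0) :
    ∫⁻ u in I, ‖x u‖ₑ = 0 := by
  have h1 := decr_mul_le_decrInt (volume.restrict I) (fun u => ‖x u‖ₑ) t
  have h3 : decrInt (volume.restrict I) (fun u => ‖x u‖ₑ) t = 0 := h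
  rw [h3, nonpos_iff_eq_zero, mul_eq_zero, ENNReal.ofReal_eq_zero, or_iff_left (not_le.2 ht)] at h1
  have h2 := decrInt_eq (aemeasurable_mag x) t
  rw [h3, h1] at h2
  simpa [excess] using h2.symm

end IntegralEstimates

/-! ### Norm bounds from sums of integrals, and the sufficiency of (ii). -/

namespace SymmetricSpace

variable {I : Set ℝ} {E : SymmetricSpace I}

/-- `g` is the combination of the rearrangements, not of the functions `a i`. Decreasing functions
attain their largest integrals over sets of measure `t` simultaneously on `(0,t)`, so no mass is
lost in the sum. -/
theorem exists_extNorm_le_sum (hI : IsInitialInterval I) {ι : Type*} (s : Finset ι) {c : ι → ℝ}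
    (hc : ∀ i ∈ s, 0 < c i) {a : ι → L0 I} (ha : ∀ i ∈ s, a i ∈ E.carrier) :
    ∃ g, E.extNorm g ≤ ∑ i ∈ s, ENNReal.ofReal (c i) * E.extNorm (a i) ∧
      ∀ t, ∑ i ∈ s, ENNReal.ofReal (c i) * rearrInt (a i) t ≤ rearrInt g t := by
  have hS := fun i hi => E.subset_S0 _ (ha i hi)
  refine ⟨∑ i ∈ s, c i • rearrL0 (a i), (extNorm_sum_le _ _).trans (Finset.sum_le_sum
    fun i hi => ?_), fun t => ?_⟩
  · refine (extNorm_smul_le (hc i hi).ne' _).trans_eq ?_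
    rw [abs_of_pos (hc i hi), extNorm_eq_of_rearr_eq (rearr_rearrL0 hI (hS i hi))]
  · have h1 : ∑ i ∈ s, ENNReal.ofReal (c i) * rearrInt (a i) t =
        ∫⁻ u in Ioo 0 t, ∑ i ∈ s, ENNReal.ofReal (c i) * rearr (a i) u := by
      rw [lintegral_finsetSum _ fun i _ => (rearr_antitone (a i)).measurable.const_mul _]
      exact Finset.sum_congr rfl fun i _ =>
        (lintegral_const_mul _ (rearr_antitone (a i)).measurable).symm
    rw [h1]
    refine setLIntegral_le_rearrInt hI (fun u hu hn => Finset.sum_eq_zero fun i _ => by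
      rw [rearr_eq_zero_of_notMem hI _ hu hn, mul_zero]) ?_
    have hall : ∀ᵐ u ∂(volume.restrict I), ∀ i ∈ s, ‖rearrL0 (a i) u‖ₑ = rearr (a i) u ∧
        0 ≤ rearrL0 (a i) u := (Finset.eventually_all s).2 fun i hi =>
      (mag_rearrL0 hI (hS i hi)).and (nonneg_iff_ae.1 (ofENN_nonneg _ _))
    filter_upwards [hall, coeFn_sum_smul s c fun i => rearrL0 (a i)] with u h2 h3 _
    rw [h3, Real.enorm_eq_ofReal (Finset.sum_nonneg fun i hi =>
      mul_nonneg (hc i hi).le (h2 i hi).2), ENNReal.ofReal_sum_of_nonneg fun i hi =>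
      mul_nonneg (hc i hi).le (h2 i hi).2]
    refine Finset.sum_le_sum fun i hi => ?_
    rw [ENNReal.ofReal_mul (hc i hi).le, ← (h2 i hi).1, Real.enorm_eq_ofReal (h2 i hi).2]

theorem extNorm_le_sum (hI : IsInitialInterval I) (hE : E.IsFullySymmetric) {ι : Type*}
    (s : Finset ι) {c : ι → ℝ} (hc : ∀ i ∈ s, 0 < c i) {y : L0 I} {a : ι → L0 I}
    (h : ∀ t, 0 ≤ t → rearrInt y t ≤ ∑ i ∈ s, ENNReal.ofReal (c i) * rearrInt (a i) t) :
    E.extNorm y ≤ ∑ i ∈ s, ENNReal.ofReal (c i) * E.extNorm (a i) := by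
  by_cases ha : ∀ i ∈ s, a i ∈ E.carrier
  · obtain ⟨g, hg, hle⟩ := exists_extNorm_le_sum hI s hc ha
    exact (extNorm_le_of_submajorized hI hE fun t ht => (h t ht).trans (hle t)).trans hg
  · push Not at ha
    obtain ⟨i, hi, hn⟩ := ha
    refine le_trans ?_ (Finset.single_le_sum
      (f := fun i => ENNReal.ofReal (c i) * E.extNorm (a i)) (fun _ _ => zero_le) hi)
    rw [extNorm_of_notMem hn, ENNReal.mul_top (by simpa using hc i hi)]
    exact le_top

theorem extNorm_le_mul (hI : IsInitialInterval I) (hE : E.IsFullySymmetric) {c : ℝ} (hc : 0 < c)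
    {y a : L0 I} (h : ∀ t, 0 ≤ t → rearrInt y t ≤ ENNReal.ofReal c * rearrInt a t) :
    E.extNorm y ≤ ENNReal.ofReal c * E.extNorm a := by
  simpa using extNorm_le_sum hI hE {()} (c := fun _ => c) (a := fun _ => a) (fun _ _ => hc)
    (by simpa using h)

theorem extNorm_le_mul_add (hI : IsInitialInterval I) (hE : E.IsFullySymmetric) {c d : ℝ}
    (hc : 0 < c) (hd : 0 < d) {y a b : L0 I} (h : ∀ t, 0 ≤ t → rearrInt y t ≤
      ENNReal.ofReal c * rearrInt a t + ENNReal.ofReal d * rearrInt b t) :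
    E.extNorm y ≤ ENNReal.ofReal c * E.extNorm a + ENNReal.ofReal d * E.extNorm b := by
  simpa using extNorm_le_sum hI hE Finset.univ (c := ![c, d]) (a := ![a, b])
    (fun i _ => by fin_cases i <;> simp [hc, hd]) (by simpa using h)

theorem exists_nat_of_limsup_eq_zero {F : ℝ → ℝ≥0∞} (h : limsup F atTop = 0) {ε : ℝ}
    (hε : 0 < ε) : ∀ᶠ n : ℕ in atTop, F n < ENNReal.ofReal ε := by
  have h1 : ∀ᶠ s in atTop, F s < ENNReal.ofReal ε :=
    eventually_lt_of_limsup_lt (by rw [h]; simpa using hε)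
  exact tendsto_natCast_atTop_atTop.eventually h1

variable {𝒜 : AveragingFamily I}

theorem mul_rearr_periodL0_le (hI : IsInitialInterval I) (x : L0 I) {n : ℕ} (hn : n ≠ 0) (t : ℝ) :
    ENNReal.ofReal n * rearr (periodL0 𝒜 hI x n) t ≤ rearr x (t / n) := by
  have hn0 : (n : ℝ≥0∞) ≠ 0 := by exact_mod_cast hn
  rw [ENNReal.ofReal_natCast]
  refine (mul_le_mul_right (rearr_periodL0_le hI x hn t) _).trans_eq ?_
  rw [ENNReal.mul_inv_cancel_left hn0 (ENNReal.natCast_ne_top n)]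

theorem partialAverage_mem_of_phi (hI : IsInitialInterval I) (hE : E.IsFullySymmetric) {x : L0 I}
    (hx : x ∈ E.carrier) (hx0 : 0 ≤ x) (h : phi hI.measurableSet E x = 0) :
    partialAverage 𝒜 x ∈ QPrime E x := by
  refine partialAverage_mem_QPrime hI hE hx hx0 fun ε hε => ?_
  obtain ⟨n, hlt, hn⟩ := ((exists_nat_of_limsup_eq_zero h hε).and (eventually_ne_atTop 0)).exists
  have hn' : (0 : ℝ) < n := by positivity
  refine ⟨n, hn, lt_of_le_of_lt ?_ hlt⟩
  rw [← ENNReal.ofReal_inv_of_pos hn']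
  refine extNorm_le_mul hI hE (inv_pos.2 hn') fun t _ => ?_
  rw [ENNReal.ofReal_inv_of_pos hn']
  refine ENNReal.le_inv_mul_of_mul_le (by simpa using hn) ENNReal.ofReal_ne_top ?_
  rw [rearrInt_eq, ← lintegral_const_mul _ (rearr_antitone _).measurable]
  refine setLIntegral_le_rearrInt hI (fun u hu hn => ?_) ?_
  · rw [rearr_eq_zero_of_notMem hI _ hu hn, mul_zero]
  · filter_upwards [mag_dilatedRearr hI (E.subset_S0 x hx) hn'] with u hu _
    rw [hu]
    exact mul_rearr_periodL0_le hI x hn u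

theorem lintegral_periodENN (hI : IsInitialInterval I) (x : L0 I) {n : ℕ} (hn : n ≠ 0) :
    ∫⁻ u in I, periodENN 𝒜 x n u = ∑' k, ∫⁻ v in Ico 0 (volume.real (𝒜.sets k) / n),
      decr (volume.restrict (𝒜.sets k)) (fun u => ‖x u‖ₑ) v := by
  rw [lintegral_family 𝒜, setLIntegral_eq_zero (hI.measurableSet.diff
    (MeasurableSet.iUnion 𝒜.measurable)) (f := periodENN 𝒜 x n)
    fun u hu => glue_of_notMem 𝒜 hu.2, add_zero]
  exact tsum_congr fun k => setLIntegral_periodENN hI x hn k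

/-- Dominated convergence for the counting measure on the family: the first cell of each set shrinks
to length `0`, and its integral is dominated by the integral of `|x|` over the set, which is
summable for `x ∈ L₁`. -/
theorem tendsto_lintegral_periodENN (hI : IsInitialInterval I) {x : L0 I} (hx : x ∈ L1set I) :
    Tendsto (fun n : ℕ => ∫⁻ u in I, periodENN 𝒜 x n u) atTop (𝓝 0) := by
  have h1 : Tendsto (fun n : ℕ => ∑' k, ∫⁻ v in Ico 0 (volume.real (𝒜.sets k) / n),
      decr (volume.restrict (𝒜.sets k)) (fun u => ‖x u‖ₑ) v) atTop (𝓝 0) := by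
    simp only [← lintegral_count]
    have h0 : ∫⁻ _ : ℕ, (0 : ℝ≥0∞) ∂Measure.count = 0 := by simp
    rw [← h0]
    have hsum : ∑' k, ∫⁻ u in 𝒜.sets k, ‖x u‖ₑ ≠ ∞ := by
      refine ne_top_of_le_ne_top (mem_L1set_iff.1 hx).ne ?_
      rw [lintegral_family 𝒜]
      exact le_self_add
    refine tendsto_lintegral_of_dominated_convergence (fun k => ∫⁻ u in 𝒜.sets k, ‖x u‖ₑ)
      (fun n => measurable_from_top) (fun n => ae_of_all _ fun k => lintegral_first_cell_le x _ _)
      (by rwa [lintegral_count]) (ae_of_all _ fun k => ?_)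
    have hfin : ∫⁻ v in Ioi (0 : ℝ), decr (volume.restrict (𝒜.sets k)) (fun u => ‖x u‖ₑ) v ≠ ∞ := by
      rw [lintegral_decr_restrict (measurable_mag x)]
      exact ENNReal.ne_top_of_tsum_ne_top hsum k
    have hlim : Tendsto ((volume.restrict (Ioi (0 : ℝ))) ∘
        fun n : ℕ => Ico 0 (volume.real (𝒜.sets k) / n)) atTop (𝓝 0) := by
      refine tendsto_of_tendsto_of_tendsto_of_le_of_le tendsto_const_nhds
        (h := fun n : ℕ => ENNReal.ofReal (volume.real (𝒜.sets k) / n)) ?_ (fun _ => zero_le)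
        fun n => ?_
      · have := ENNReal.tendsto_ofReal
          (tendsto_const_div_atTop_nhds_zero_nat (volume.real (𝒜.sets k)))
        simpa using this
      · refine (Measure.restrict_apply_le _ _).trans ?_
        rw [Real.volume_Ico, sub_zero]
    have h2 := tendsto_setLIntegral_zero hfin hlim
    refine h2.congr fun n => ?_
    rw [Measure.restrict_restrict measurableSet_Ico]
    refine setLIntegral_congr ?_
    have : Ico 0 (volume.real (𝒜.sets k) / n) ∩ Ioi 0 = Ioo 0 (volume.real (𝒜.sets k) / n) := by
      ext u
      simp only [mem_inter_iff, mem_Ico, mem_Ioi, mem_Ioo]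
      exact ⟨fun h => ⟨h.2, h.1.2⟩, fun h => ⟨⟨h.1.le, h.2⟩, h.1⟩⟩
    rw [this]
    exact Ioo_ae_eq_Ico
  refine h1.congr' ?_
  filter_upwards [eventually_ne_atTop 0] with n hn
  exact (lintegral_periodENN hI x hn).symm

theorem indL0_one_mem (hI : IsInitialInterval I) (hE : E.IsFullySymmetric) {x : L0 I}
    (hx : x ∈ E.carrier) (h : rearrInt x 1 ≠ 0) : indL0 I 1 ∈ E.carrier := by
  refine extNorm_ne_top_iff.1 (ne_top_of_le_ne_top (ENNReal.mul_ne_top ENNReal.ofReal_ne_top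
    (extNorm_lt_top hx).ne) (extNorm_le_mul hI hE (c := (rearrInt x 1).toReal⁻¹)
      (inv_pos.2 (ENNReal.toReal_pos h (rearrInt_lt_top hI hE hx 1).ne)) (a := x) fun t ht => ?_))
  refine (rearrInt_indL0_le hI 1 t).trans ?_
  rw [ENNReal.ofReal_inv_of_pos (ENNReal.toReal_pos h (rearrInt_lt_top hI hE hx 1).ne),
    ENNReal.ofReal_toReal (rearrInt_lt_top hI hE hx 1).ne]
  refine ENNReal.le_inv_mul_of_mul_le h (rearrInt_lt_top hI hE hx 1).ne ?_
  rcases le_total t 1 with h1 | h1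
  · rw [min_eq_left h1, mul_comm]
    simpa using ofReal_mul_rearrInt_le x ht h1
  · rw [min_eq_right h1]
    simpa using decrInt_mono _ _ h1

theorem rearrInt_periodL0_le (hI : IsInitialInterval I) (x : L0 I) (n : ℕ) (t : ℝ) :
    rearrInt (periodL0 𝒜 hI x n) t ≤ ∫⁻ u in I, periodENN 𝒜 x n u :=
  (rearrInt_le_lintegral _ t).trans (lintegral_mono_ae (mag_ofENN_le _ _))

theorem exists_ofReal_mul_lt {N : ℝ≥0∞} (hN : N ≠ ∞) {ε : ℝ} (hε : 0 < ε) :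
    ∃ d : ℝ, 0 < d ∧ ENNReal.ofReal d * N < ENNReal.ofReal ε := by
  refine ⟨ε / (N.toReal + 1), by positivity, ?_⟩
  rw [← ENNReal.ofReal_toReal hN, ← ENNReal.ofReal_mul (by positivity),
    ENNReal.toReal_ofReal ENNReal.toReal_nonneg, ENNReal.ofReal_lt_ofReal_iff hε,
    div_mul_eq_mul_div, div_lt_iff₀ (by positivity)]
  nlinarith [ENNReal.toReal_nonneg (a := N)]

/-- For `t ≤ 1` the truncated dilation dominates. For `t ≥ 1` only the total mass of the repeated
first cells matters; it tends to `0` and is absorbed by a small multiple of the characteristic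
function of `(0,1)`. -/
theorem partialAverage_mem_of_phiFin (hI : IsInitialInterval I) (h01 : Ioo 0 1 ⊆ I)
    (hE : E.IsFullySymmetric) {x : L0 I} (hx : x ∈ E.carrier) (hx0 : 0 ≤ x) (hx1 : x ∈ L1set I)
    (h : phiFin hI.measurableSet E x = 0) : partialAverage 𝒜 x ∈ QPrime E x := by
  refine partialAverage_mem_QPrime hI hE hx hx0 fun ε hε => ?_
  -- If `x = 0`, nothing shows that the characteristic function of `(0,1)` belongs to `E`, so this
  -- case is separate.
  by_cases hX : rearrInt x 1 = 0
  · have h0 := lintegral_eq_zero_of_rearrInt one_pos hX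
    have hle : E.extNorm (periodL0 𝒜 hI x 1) ≤ 0 := by
      simpa using extNorm_le_sum hI hE (∅ : Finset ℕ) (c := fun _ => 1) (a := fun _ => x)
        (fun _ _ => one_pos) (y := periodL0 𝒜 hI x 1) fun t _ => by
          refine (rearrInt_periodL0_le hI x 1 t).trans ?_
          rw [lintegral_periodENN hI x one_ne_zero, Finset.sum_empty, nonpos_iff_eq_zero,
            ENNReal.tsum_eq_zero]
          refine fun k => le_antisymm ((lintegral_first_cell_le x _ _).trans ?_) zero_le
          rw [← h0]
          exact lintegral_mono_set (𝒜.subset k)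
    exact ⟨1, one_ne_zero, hle.trans_lt (by simpa using hε)⟩
  obtain ⟨d, hd, hdlt⟩ := exists_ofReal_mul_lt
    (extNorm_lt_top (indL0_one_mem hI hE hx hX)).ne (half_pos hε)
  obtain ⟨n, hlt, hn, hq⟩ := ((exists_nat_of_limsup_eq_zero h (half_pos hε)).and
    ((eventually_ne_atTop 0).and ((tendsto_lintegral_periodENN (𝒜 := 𝒜) hI hx1).eventually
      (gt_mem_nhds (show 0 < ENNReal.ofReal d by simpa using hd))))).exists
  have hn' : (0 : ℝ) < n := by positivity
  refine ⟨n, hn, lt_of_le_of_lt (b := ENNReal.ofReal (n : ℝ)⁻¹ *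
    E.extNorm (dilatedRearrFin hI.measurableSet n x) + ENNReal.ofReal d * E.extNorm (indL0 I 1))
    ?_ ?_⟩
  · refine extNorm_le_mul_add hI hE (inv_pos.2 hn') hd fun t ht => ?_
    rcases le_total t 1 with h1 | h1
    · refine le_add_right ?_
      rw [ENNReal.ofReal_inv_of_pos hn']
      refine ENNReal.le_inv_mul_of_mul_le (by simpa using hn) ENNReal.ofReal_ne_top ?_
      rw [rearrInt_eq, ← lintegral_const_mul _ (rearr_antitone _).measurable]
      refine setLIntegral_le_rearrInt hI (fun u hu hn => ?_) ?_
      · rw [rearr_eq_zero_of_notMem hI _ hu hn, mul_zero]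
      · filter_upwards [mag_dilatedRearrFin hI (E.subset_S0 x hx) hn',
          ae_restrict_mem hI.measurableSet] with u hu huI hut
        rw [hu, indicator_of_mem (mem_Icc.2 ⟨(hI.pos u huI).le, hut.le.trans h1⟩)]
        exact mul_rearr_periodL0_le hI x hn u
    · refine le_add_left ((rearrInt_periodL0_le hI x n t).trans (hq.le.trans ?_))
      have := ofReal_min_le_rearrInt_indL0 hI h01 t
      rw [min_eq_right h1, ENNReal.ofReal_one] at this
      exact le_mul_of_one_le_right' this
  · rw [ENNReal.ofReal_inv_of_pos hn', ← add_halves ε, ENNReal.ofReal_add (half_pos hε).le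
      (half_pos hε).le]
    exact ENNReal.add_lt_add hlt hdlt

end SymmetricSpace

/-! ### Nested superlevel sets of prescribed measure -/

section TopSets

variable {I : Set ℝ}

/-- Lower sets of the line are totally ordered by inclusion, which later makes the selected top sets
nested. The whole line is needed when the full measure is reached by no half-line. -/
theorem exists_lowerSet_volume_inter_eq {C : Set ℝ} (hC : C ⊆ Ioi 0) {v : ℝ≥0∞}
    (hv : v ≤ volume C) : ∃ S : Set ℝ, IsLowerSet S ∧ MeasurableSet S ∧ volume (C ∩ S) = v := by
  rcases hv.lt_or_eq with h | h
  · obtain ⟨ρ, hρ⟩ := exists_volume_inter_Iio_eq hC h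
    exact ⟨Iio ρ, isLowerSet_Iio ρ, measurableSet_Iio, hρ⟩
  · exact ⟨univ, isLowerSet_univ, MeasurableSet.univ, by rw [inter_univ, h]⟩

/-- The points of `I` where `|x| > s`, and those points of `S` where `|x| = s`. -/
def topSet (x : L0 I) (s : ℝ≥0∞) (S : Set ℝ) : Set ℝ :=
  I ∩ ({u | s < ‖x u‖ₑ} ∪ {u | ‖x u‖ₑ = s} ∩ S)

theorem measurableSet_topSet (hI : MeasurableSet I) (x : L0 I) (s : ℝ≥0∞) {S : Set ℝ}
    (hS : MeasurableSet S) : MeasurableSet (topSet x s S) :=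
  hI.inter ((measurableSet_lt measurable_const (measurable_mag x)).union
    ((measurable_mag x (measurableSet_singleton s)).inter hS))

/-- The extra condition excludes `x*(t) = x*(∞) > 0`. In that case `|x|` may approach `x*(∞)` from
below without reaching it, and `{|x| ≥ x*(t)}` may even be null. -/
theorem ofReal_le_volume_rearr_le {x : L0 I} {t : ℝ}
    (htI : ENNReal.ofReal t ≤ volume I)
    (h : rearr x t = 0 ∨ ∃ t', rearr x t' < rearr x t) :
    ENNReal.ofReal t ≤ volume.restrict I {u | rearr x t ≤ ‖x u‖ₑ} := by
  rcases h with h | ⟨t', ht'⟩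
  · simpa [h] using htI
  · obtain ⟨v, hv, hvs, hvt⟩ := exists_seq_strictMono_tendsto' ht'
    have hset : {u | rearr x t ≤ ‖x u‖ₑ} = ⋂ n, {u | v n < ‖x u‖ₑ} := by
      ext u
      simp only [mem_ofPred_eq, mem_iInter]
      exact ⟨fun hu n => (hvs n).2.trans_le hu, fun hu => le_of_tendsto' hvt fun n => (hu n).le⟩
    have hanti : Antitone fun n => {u | v n < ‖x u‖ₑ} := fun m n hmn u hu =>
      lt_of_le_of_lt (hv.monotone hmn) hu
    rw [hset, hanti.measure_iInter
      (fun n => (measurableSet_lt measurable_const (measurable_mag x)).nullMeasurableSet)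
      ⟨0, ((decr_le_iff.1 (hvs 0).1.le).trans_lt ENNReal.ofReal_lt_top).ne⟩]
    exact le_iInf fun n => (lt_decr_iff.1 (hvs n).2).le

theorem exists_volume_topSet_eq (hI : IsInitialInterval I) {x : L0 I} {t : ℝ}
    (htI : ENNReal.ofReal t ≤ volume I) (h : rearr x t = 0 ∨ ∃ t', rearr x t' < rearr x t) :
    ∃ S, IsLowerSet S ∧ MeasurableSet S ∧ volume (topSet x (rearr x t) S) = ENNReal.ofReal t := by
  have hm1 : MeasurableSet {u | rearr x t < ‖x u‖ₑ} :=
    measurableSet_lt measurable_const (measurable_mag x)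
  have hm2 : MeasurableSet {u | ‖x u‖ₑ = rearr x t} :=
    measurable_mag x (measurableSet_singleton _)
  have h1 : volume (I ∩ {u | rearr x t < ‖x u‖ₑ}) ≤ ENNReal.ofReal t := by
    have := measure_decr_lt_le (volume.restrict I) (fun u => ‖x u‖ₑ) t
    rwa [← rearr_eq_decr, Measure.restrict_apply hm1, inter_comm] at this
  have hd : ∀ S, Disjoint (I ∩ {u | rearr x t < ‖x u‖ₑ}) (I ∩ {u | ‖x u‖ₑ = rearr x t} ∩ S) :=
    fun S => Set.disjoint_left.2 fun u hu hu' => ne_of_gt hu.2 hu'.1.2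
  have h2 : ENNReal.ofReal t - volume (I ∩ {u | rearr x t < ‖x u‖ₑ}) ≤
      volume (I ∩ {u | ‖x u‖ₑ = rearr x t}) := by
    rw [tsub_le_iff_left]
    refine (ofReal_le_volume_rearr_le htI h).trans ?_
    rw [Measure.restrict_apply' hI.measurableSet]
    refine (measure_mono fun u hu => ?_).trans (measure_union_le _ _)
    rcases (show rearr x t ≤ ‖x u‖ₑ from hu.1).lt_or_eq with h | h
    · exact Or.inl ⟨hu.2, h⟩
    · exact Or.inr ⟨hu.2, h.symm⟩
  obtain ⟨S, hS, hSm, hv⟩ := exists_lowerSet_volume_inter_eq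
    (fun u hu => hI.pos u hu.1) h2
  refine ⟨S, hS, hSm, ?_⟩
  rw [topSet, inter_union_distrib_left, ← inter_assoc,
    measure_union (hd S) ((hI.measurableSet.inter hm2).inter hSm), hv, add_tsub_cancel_of_le h1]

theorem topSet_subset_topSet {x : L0 I} {s s' : ℝ≥0∞} (S S' : Set ℝ) (h : s' < s) :
    topSet x s S ⊆ topSet x s' S' := by
  rintro u ⟨hu, hu' | hu'⟩
  · exact ⟨hu, Or.inl (h.trans hu')⟩
  · exact ⟨hu, Or.inl (h.trans_eq (show ‖x u‖ₑ = s from hu'.1).symm)⟩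

theorem exists_topSets (hI : IsInitialInterval I) {x : L0 I} {V : Set ℝ}
    (h0 : ∀ t ∈ V, 0 < t) (htI : ∀ t ∈ V, ENNReal.ofReal t ≤ volume I)
    (h : ∀ t ∈ V, rearr x t = 0 ∨ ∃ t', rearr x t' < rearr x t) :
    ∃ D : ℝ → Set ℝ, (∀ t ∈ V, MeasurableSet (D t) ∧ D t ⊆ I ∧ volume (D t) = ENNReal.ofReal t ∧
      (∀ u ∈ D t, rearr x t ≤ ‖x u‖ₑ) ∧ ∀ u ∈ I \ D t, ‖x u‖ₑ ≤ rearr x t) ∧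
      ∀ t ∈ V, ∀ t' ∈ V, t ≤ t' → D t ⊆ D t' := by
  have hex : ∀ t, ∃ S, t ∈ V → IsLowerSet S ∧ MeasurableSet S ∧
      volume (topSet x (rearr x t) S) = ENNReal.ofReal t := fun t => by
    by_cases ht : t ∈ V
    · obtain ⟨S, hS⟩ := exists_volume_topSet_eq hI (htI t ht) (h t ht)
      exact ⟨S, fun _ => hS⟩
    · exact ⟨∅, fun h => absurd h ht⟩
  choose S hS using hex
  refine ⟨fun t => topSet x (rearr x t) (S t), fun t ht => ⟨measurableSet_topSet hI.measurableSet x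
    _ (hS t ht).2.1, inter_subset_left, (hS t ht).2.2, ?_, ?_⟩, fun t ht t' ht' htt' => ?_⟩
  · rintro u ⟨-, hu | hu⟩
    · exact le_of_lt hu
    · exact (show ‖x u‖ₑ = rearr x t from hu.1).ge
  · intro u hu
    by_contra! hlt
    exact hu.2 ⟨hu.1, Or.inl hlt⟩
  · rcases htt'.eq_or_lt with rfl | hlt
    · exact subset_rfl
    rcases (rearr_antitone x htt').lt_or_eq with hr | hr
    · exact topSet_subset_topSet _ _ hr
    · simp only [hr]
      have hmono : ∀ A B : Set ℝ, A ⊆ B → topSet x (rearr x t) A ⊆ topSet x (rearr x t) B :=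
        fun A B hAB => inter_subset_inter_right _ (union_subset_union_right _
          (inter_subset_inter_right _ hAB))
      -- Both sets cut the same level set by comparable lower sets; the order opposite to the one
      -- wanted would contradict the strict inequality between the measures.
      rcases (hS t ht).1.total (hS t' ht').1 with hsub | hsub
      · exact hmono _ _ hsub
      · have := measure_mono (μ := volume) (hmono _ _ hsub)
        rw [(hS t ht).2.2] at this
        have h' := (hS t' ht').2.2
        rw [hr] at h'
        rw [h'] at this
        exact absurd this (not_le.2 ((ENNReal.ofReal_lt_ofReal_iff (h0 t' ht')).2 hlt))

theorem setLIntegral_topSet (hI : MeasurableSet I) {x : L0 I} {t : ℝ} {D : Set ℝ}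
    (hDm : MeasurableSet D) (hDI : D ⊆ I) (hv : volume D = ENNReal.ofReal t)
    (h1 : ∀ u ∈ D, rearr x t ≤ ‖x u‖ₑ) (h2 : ∀ u ∈ I \ D, ‖x u‖ₑ ≤ rearr x t) :
    ∫⁻ u in D, ‖x u‖ₑ = rearrInt x t := by
  have h3 : exc x (rearr x t) = ∫⁻ u in D, (‖x u‖ₑ - rearr x t) := by
    rw [exc, excess, ← lintegral_inter_add_sdiff _ I hDm, inter_eq_right.2 hDI,
      setLIntegral_eq_zero (hI.diff hDm) (fun u hu => tsub_eq_zero_of_le (h2 u hu)), add_zero]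
  have h4 : rearr x t * ENNReal.ofReal t = ∫⁻ _ in D, rearr x t := by simp [hv]
  rw [rearrInt, decrInt_eq (aemeasurable_mag x), ← rearr_eq_decr, h4]
  change _ = exc x (rearr x t) + _
  rw [h3, ← lintegral_add_right _ measurable_const]
  exact setLIntegral_congr_fun hDm fun u hu => (tsub_add_cancel_of_le (h1 u hu)).symm

end TopSets

/-! ### Levels of an increasing function -/

section Levels

/-- A sequence `ℓ i` in `V` with `X (ℓ i) = 4 ^ i`, except that `ℓ i` is the greatest element of
`V` where `X` does not reach the value `4 ^ i`. -/
structure IsLevelSeq (X : ℝ → ℝ) (V : Set ℝ) (ℓ : ℤ → ℝ) : Prop where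
  mem : ∀ i, ℓ i ∈ V
  mono : Monotone ℓ
  le : ∀ i, X (ℓ i) ≤ 4 ^ i
  eq_or : ∀ i, X (ℓ i) = 4 ^ i ∨ ∀ t ∈ V, t ≤ ℓ i

theorem exists_isLevelSeq {X : ℝ → ℝ} {V : Set ℝ} (hX : Monotone X) (hX0 : X 0 = 0)
    (hXc : ∀ t ∈ V, ContinuousOn X (Icc 0 t)) (hV0 : ∀ t ∈ V, 0 < t)
    (hV : ∀ t ∈ V, ∀ t', 0 < t' → t' ≤ t → t' ∈ V)
    (h : (∃ T ∈ V, ∀ t ∈ V, t ≤ T) ∨ ∀ v, ∃ t ∈ V, v < X t) : ∃ ℓ, IsLevelSeq X V ℓ := by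
  have hex : ∀ i : ℤ, ∃ l ∈ V, X l ≤ 4 ^ i ∧ (X l = 4 ^ i ∨ ∀ t ∈ V, t ≤ l) := by
    intro i
    by_cases hi : ∃ t ∈ V, (4 : ℝ) ^ i < X t
    · obtain ⟨t, ht, hlt⟩ := hi
      have hpos : (0 : ℝ) < 4 ^ i := by positivity
      obtain ⟨l, hl, hXl⟩ := intermediate_value_Icc (hV0 t ht).le (hXc t ht)
        (show (4 : ℝ) ^ i ∈ Icc (X 0) (X t) from ⟨by rw [hX0]; exact hpos.le, hlt.le⟩)
      refine ⟨l, hV t ht l (lt_of_le_of_ne hl.1 ?_) hl.2, hXl.le, Or.inl hXl⟩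
      rintro rfl
      rw [hX0] at hXl
      exact hpos.ne hXl
    · push Not at hi
      rcases h with ⟨T, hT, hmax⟩ | h
      · exact ⟨T, hT, hi T hT, Or.inr hmax⟩
      · obtain ⟨t, ht, hlt⟩ := h (4 ^ i)
        exact absurd (hi t ht) (not_le.2 hlt)
  choose ℓ hmem hle heq using hex
  refine ⟨ℓ, hmem, monotone_int_of_le_succ fun i => ?_, hle, heq⟩
  rcases heq (i + 1) with h1 | h1
  · by_contra! hlt
    have h2 := (hX hlt.le).trans (hle i)
    rw [h1, zpow_add_one₀ (by norm_num)] at h2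
    have hpos : (0 : ℝ) < 4 ^ i := by positivity
    linarith
  · exact h1 _ (hmem i)

/-- Start from `i` with `4^i < X(t / R^(J+1)) ≤ 4^(i+1)`. Either `J + 1` consecutive ratios of the
levels are below `R`, and then `X` gains the factor `4^J` before reaching `t`; or there is a long
gap before `t`, and at the first one `key` bounds `4^i` by `4 G(t)`. -/
theorem IsLevelSeq.le_add {X G : ℝ → ℝ} {V : Set ℝ} {ℓ : ℤ → ℝ} (hℓ : IsLevelSeq X V ℓ)
    (hX : Monotone X) (hG : Monotone G) (hG0 : ∀ t, 0 ≤ G t) (hX0 : ∀ t, 0 ≤ X t)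
    (hV0 : ∀ t ∈ V, 0 < t) {R : ℝ} (hR1 : 1 < R)
    (key : ∀ i, R * ℓ i ≤ ℓ (i + 1) → X (ℓ i) = 4 ^ i → X (ℓ i) ≤ 4 * G (R * ℓ i)) (J : ℕ) {t : ℝ}
    (ht : t ∈ V) : X (t / R ^ (J + 1)) ≤ 16 * G t + (1 / 4) ^ J * X t := by
  have hR := hR1.le
  have hR0 : 0 < R := one_pos.trans_le hR
  have hnn : 0 ≤ 16 * G t + (1 / 4) ^ J * X t :=
    add_nonneg (mul_nonneg (by norm_num) (hG0 t)) (mul_nonneg (by positivity) (hX0 t))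
  rcases (hX0 (t / R ^ (J + 1))).eq_or_lt with h0 | h0
  · rw [← h0]; exact hnn
  obtain ⟨i, hi1, hi2⟩ := exists_mem_Ioc_zpow h0 (show (1 : ℝ) < 4 by norm_num)
  rw [zpow_add_one₀ (by norm_num)] at hi2
  have hst : t / R ^ (J + 1) ≤ t := div_le_self (hV0 t ht).le (one_le_pow₀ hR)
  have hval : ∀ k : ℤ, ℓ k < t → X (ℓ k) = 4 ^ k := fun k hk =>
    (hℓ.eq_or k).resolve_right fun h => absurd (h t ht) (not_le.2 hk)
  have hli : ℓ i < t / R ^ (J + 1) := by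
    by_contra! hle
    have := (hX hle).trans (hℓ.le i)
    linarith
  have hpow : ∀ k ≤ J + 1, (∀ m < k, ℓ (i + m + 1) < R * ℓ (i + m)) →
      ℓ (i + k) ≤ R ^ k * ℓ i := by
    intro k
    induction k with
    | zero => intro _ _; simp
    | succ k ih =>
      intro hk hm
      have h1 := ih (by omega) fun m hmk => hm m (by omega)
      have h2 := hm k (by omega)
      push_cast
      rw [← add_assoc]
      calc ℓ (i + k + 1) ≤ R * ℓ (i + k) := h2.le
        _ ≤ R * (R ^ k * ℓ i) := by gcongr
        _ = R ^ (k + 1) * ℓ i := by ring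
  rw [lt_div_iff₀ (by positivity)] at hli
  by_cases hall : ∀ m < J + 1, ℓ (i + m + 1) < R * ℓ (i + m)
  · have h1 : ℓ (i + (J + 1 : ℕ)) < t := by
      refine (hpow (J + 1) le_rfl hall).trans_lt ?_
      rwa [mul_comm]
    have h2 := hval _ h1
    have h3 := hX h1.le
    rw [h2, zpow_add₀ (by norm_num), zpow_natCast, pow_succ] at h3
    have h4 : X (t / R ^ (J + 1)) ≤ (1 / 4) ^ J * X t := by
      calc X (t / R ^ (J + 1)) ≤ 4 ^ i * 4 := hi2
        _ = (1 / 4) ^ J * (4 ^ i * (4 ^ J * 4)) := by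
            rw [one_div, inv_pow]
            field_simp
        _ ≤ _ := by gcongr
    have := hG0 t
    linarith
  · classical
    have hex : ∃ m, m < J + 1 ∧ R * ℓ (i + m) ≤ ℓ (i + m + 1) := by
      push Not at hall
      exact hall
    obtain ⟨hm1, hm2⟩ := Nat.find_spec hex
    set m := Nat.find hex
    have hmin : ∀ k < m, ℓ (i + k + 1) < R * ℓ (i + k) := fun k hk => by
      have := Nat.find_min hex hk
      push Not at this
      exact this (by omega)
    -- All ratios before the first long gap are below `R`, so the left end of the gap, even
    -- multiplied by `R`, does not exceed `t`. Hence it is not the greatest element of `V` and `X`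
    -- takes its exact value there.
    have h1 : R * ℓ (i + m) ≤ t := by
      have hℓ0 := hV0 _ (hℓ.mem i)
      calc R * ℓ (i + m) ≤ R * (R ^ m * ℓ i) := by
            have := hpow m (by omega) hmin
            gcongr
        _ = R ^ (m + 1) * ℓ i := by ring
        _ ≤ R ^ (J + 1) * ℓ i := by
            have := pow_le_pow_right₀ hR (show m + 1 ≤ J + 1 by omega)
            gcongr
        _ ≤ t := by rw [mul_comm]; exact hli.le
    have h2 : X (ℓ (i + m)) = 4 ^ (i + m : ℤ) := by
      refine (hℓ.eq_or _).resolve_right fun h => ?_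
      have h3 := (h1.trans (h t ht)).trans_eq (one_mul (ℓ (i + m))).symm
      exact absurd (le_of_mul_le_mul_right h3 (hV0 _ (hℓ.mem _))) (not_le.2 hR1)
    have h3 := key _ hm2 h2
    have h4 : (4 : ℝ) ^ i ≤ X (ℓ (i + m)) := by
      rw [h2]
      exact zpow_le_zpow_right₀ (by norm_num) (by omega)
    have h5 := hG h1
    have h6 : 0 ≤ (1 / 4) ^ J * X t := mul_nonneg (by positivity) (hX0 t)
    linarith

end Levels

/-! ### Averages close to convex combinations of equimeasurable functions -/

section ConvexCombinations

variable {I : Set ℝ}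

/-- Let `U` be the union of the sets `{v i > x*(τ)}`, of measure at most `card s * τ`. Each `v i`
carries its whole excess over `x*(τ)` on `U`, so the convex combination has at least this mass
there, whatever the weights. On `U` it is bounded by `|y|` plus the difference, and `y` is estimated
separately on `D` and off `D`. -/
theorem exc_le_of_convexCombination {x y : L0 I} {ι : Type*} (s : Finset ι)
    {c : ι → ℝ} {v : ι → L0 I} (hc : ∀ i ∈ s, 0 ≤ c i) (hc1 : ∑ i ∈ s, c i = 1)
    (hv0 : ∀ i ∈ s, 0 ≤ v i) (hv : ∀ i ∈ s, rearr (v i) = rearr x) {D : Set ℝ} {a τ : ℝ}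
    {β : ℝ≥0∞} (hDm : MeasurableSet D) (hD : volume.restrict I D ≤ ENNReal.ofReal a)
    (hβ : ∀ᵐ u ∂(volume.restrict I), u ∉ D → ‖y u‖ₑ ≤ β) :
    exc x (rearr x τ) ≤ rearrInt y a + β * ENNReal.ofReal (s.card * τ) +
      rearrInt (y - ∑ i ∈ s, c i • v i) (s.card * τ) := by
  set w := ∑ i ∈ s, c i • v i with hw
  set U : Set ℝ := ⋃ i ∈ s, {u | rearr x τ < ‖v i u‖ₑ} with hU
  set μ := volume.restrict I
  have hUm : MeasurableSet U := Finset.measurableSet_biUnion s fun i _ =>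
    measurableSet_lt measurable_const (measurable_mag (v i))
  have hUv : μ U ≤ ENNReal.ofReal (s.card * τ) := by
    refine (measure_biUnion_finset_le s _).trans ?_
    rw [ENNReal.ofReal_mul (Nat.cast_nonneg _), ENNReal.ofReal_natCast, ← nsmul_eq_mul]
    refine Finset.sum_le_card_nsmul s _ _ fun i hi => ?_
    rw [measure_lt_eq_of_rearr_eq (hv i hi)]
    exact measure_decr_lt_le _ _ _
  have h1 : ∀ i ∈ s, exc x (rearr x τ) ≤ ∫⁻ u in U, ‖v i u‖ₑ ∂μ := fun i hi => by
    rw [← rearr_eq_iff_exc (hv i hi), exc, excess, ← lintegral_indicator hUm]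
    refine lintegral_mono fun u => ?_
    by_cases hu : u ∈ U
    · rw [indicator_of_mem hu]
      exact tsub_le_self
    · rw [indicator_of_notMem hu]
      refine (tsub_eq_zero_of_le ?_).le
      by_contra! hlt
      exact hu (mem_biUnion (x := i) hi hlt)
  have h2 : exc x (rearr x τ) ≤ ∫⁻ u in U, ‖w u‖ₑ ∂μ := by
    calc exc x (rearr x τ) = ∑ i ∈ s, ENNReal.ofReal (c i) * exc x (rearr x τ) := by
          rw [← Finset.sum_mul, ← ENNReal.ofReal_sum_of_nonneg hc, hc1, ENNReal.ofReal_one, one_mul]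
      _ ≤ ∑ i ∈ s, ENNReal.ofReal (c i) * ∫⁻ u in U, ‖v i u‖ₑ ∂μ := by
          gcongr with i hi
          exact h1 i hi
      _ = ∫⁻ u in U, ∑ i ∈ s, ENNReal.ofReal (c i) * ‖v i u‖ₑ ∂μ := by
          rw [lintegral_finsetSum _ fun i _ => (measurable_mag (v i)).const_mul _]
          exact Finset.sum_congr rfl fun i _ => (lintegral_const_mul _ (measurable_mag (v i))).symm
      _ = ∫⁻ u in U, ‖w u‖ₑ ∂μ := by
          refine lintegral_congr_ae (ae_restrict_of_ae ?_)
          have hall : ∀ᵐ u ∂μ, ∀ i ∈ s, 0 ≤ v i u :=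
            (Finset.eventually_all s).2 fun i hi => nonneg_iff_ae.1 (hv0 i hi)
          filter_upwards [hall, coeFn_sum_smul s c v] with u h3 h4
          rw [h4, Real.enorm_eq_ofReal (Finset.sum_nonneg fun i hi =>
            mul_nonneg (hc i hi) (h3 i hi)), ENNReal.ofReal_sum_of_nonneg fun i hi =>
            mul_nonneg (hc i hi) (h3 i hi)]
          refine Finset.sum_congr rfl fun i hi => ?_
          rw [ENNReal.ofReal_mul (hc i hi), Real.enorm_eq_ofReal (h3 i hi)]
  have h3 : ∫⁻ u in U, ‖w u‖ₑ ∂μ ≤ ∫⁻ u in U, ‖y u‖ₑ ∂μ + ∫⁻ u in U, ‖(y - w : L0 I) u‖ₑ ∂μ := by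
    rw [← lintegral_add_left (measurable_mag y)]
    refine lintegral_mono_ae (ae_restrict_of_ae ?_)
    filter_upwards [AEEqFun.coeFn_sub y w] with u hu
    rw [hu, Pi.sub_apply]
    calc ‖w u‖ₑ = ‖y u - (y u - w u)‖ₑ := by rw [sub_sub_cancel]
      _ ≤ _ := enorm_sub_le
  have h4 : ∫⁻ u in U, ‖y u‖ₑ ∂μ ≤ rearrInt y a + β * ENNReal.ofReal (s.card * τ) := by
    rw [← lintegral_inter_add_sdiff _ U hDm]
    refine add_le_add ?_ ?_
    · exact (lintegral_mono_set inter_subset_right).trans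
        (setLIntegral_le_decrInt (aemeasurable_mag y) hD)
    · calc ∫⁻ u in U \ D, ‖y u‖ₑ ∂μ ≤ ∫⁻ _ in U \ D, β ∂μ := by
            refine lintegral_mono_ae ?_
            filter_upwards [ae_restrict_of_ae hβ, ae_restrict_mem (hUm.diff hDm)] with u hu hm
            exact hu hm.2
        _ = β * μ (U \ D) := by simp
        _ ≤ _ := by
            gcongr
            exact (measure_mono sdiff_subset).trans hUv
  exact h2.trans (h3.trans (add_le_add h4 (setLIntegral_le_decrInt (aemeasurable_mag _) hUv)))

theorem enorm_partialAverage_le_of_family {𝒜 : AveragingFamily I} {x : L0 I} {D : Set ℝ}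
    {β : ℝ≥0∞} (h1 : ∀ k, 𝒜.sets k ⊆ D ∨ ∫⁻ u in 𝒜.sets k, ‖x u‖ₑ ≤ β * volume (𝒜.sets k))
    (h2 : ∀ u ∈ I, u ∉ D → u ∉ ⋃ k, 𝒜.sets k → ‖x u‖ₑ ≤ β) (hI : MeasurableSet I) :
    ∀ᵐ u ∂(volume.restrict I), u ∉ D → ‖partialAverage 𝒜 x u‖ₑ ≤ β := by
  filter_upwards [partialAverage_coe 𝒜 x, ae_restrict_mem hI,
    ae_restrict_of_ae (ae_notMem_null_sets 𝒜)] with u hu huI h0 huD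
  rw [hu]
  by_cases hk : u ∈ ⋃ k, 𝒜.sets k
  · obtain ⟨k, hk⟩ := mem_iUnion.1 hk
    rw [partialAverageFun_of_mem 𝒜 x hk]
    have h3 := (h1 k).resolve_left fun h => huD (h hk)
    exact (ENNReal.mul_le_mul_iff_left (fun h => h0 k h hk) (𝒜.finite k).ne).1
      ((enorm_average_mul_le x (𝒜.finite k).ne).trans h3)
  · rw [partialAverageFun_of_notMem 𝒜 x hk]
    exact h2 u huI huD hk

end ConvexCombinations

/-! ### Continuity of the integral of the rearrangement -/

section Continuity

variable {I : Set ℝ}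

/-- The integral of the decreasing rearrangement over `(0,t)`, as a real number. -/
def realInt (x : L0 I) (t : ℝ) : ℝ := (rearrInt x t).toReal

theorem realInt_nonneg (x : L0 I) (t : ℝ) : 0 ≤ realInt x t := ENNReal.toReal_nonneg

theorem ofReal_realInt {x : L0 I} (hx : ∀ t, rearrInt x t < ∞) (t : ℝ) :
    ENNReal.ofReal (realInt x t) = rearrInt x t := ENNReal.ofReal_toReal (hx t).ne

theorem realInt_zero (x : L0 I) : realInt x 0 = 0 := by
  rw [realInt, rearrInt, decrInt_of_nonpos _ _ le_rfl, ENNReal.toReal_zero]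

theorem monotone_realInt {x : L0 I} (hx : ∀ t, rearrInt x t < ∞) : Monotone (realInt x) :=
  fun _ b h => ENNReal.toReal_mono (hx b).ne (decrInt_mono _ _ h)

theorem continuousOn_realInt {x : L0 I} (hx : ∀ t, rearrInt x t < ∞) (t : ℝ) :
    ContinuousOn (realInt x) (Icc 0 t) := by
  have hint : IntegrableOn (fun u => (rearr x u).toReal) (Ioc 0 t) := by
    rw [integrableOn_congr_set_ae Ioo_ae_eq_Ioc.symm]
    exact integrable_toReal_of_lintegral_ne_top (rearr_antitone x).measurable.aemeasurable
      (hx t).ne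
  have hcont := intervalIntegral.continuousOn_primitive (a := 0) (b := t)
    (f := fun u => (rearr x u).toReal) (μ := volume)
    (by rwa [integrableOn_Icc_iff_integrableOn_Ioc])
  refine hcont.congr fun b hb => ?_
  simp only
  rw [realInt, rearrInt_eq, setLIntegral_congr Ioo_ae_eq_Ioc, integral_toReal
    (rearr_antitone x).measurable.aemeasurable]
  have hfin : ∫⁻ u in Ioc 0 b, rearr x u ≠ ∞ := by
    rw [← setLIntegral_congr Ioo_ae_eq_Ioc]
    exact (hx b).ne
  exact ae_lt_top (rearr_antitone x).measurable hfin

end Continuity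

/-! ### Averaging over blocks between level sets -/

section Blocks

variable {I : Set ℝ}

/-- An increasing two-sided sequence of superlevel sets of `|x|`, of measures `ℓ i`. -/
structure IsTopSystem (x : L0 I) (ℓ : ℤ → ℝ) (D : ℤ → Set ℝ) : Prop where
  pos : ∀ i, 0 < ℓ i
  measurable : ∀ i, MeasurableSet (D i)
  subset : ∀ i, D i ⊆ I
  volume_eq : ∀ i, volume (D i) = ENNReal.ofReal (ℓ i)
  mono : Monotone D
  enorm_le : ∀ i, ∀ u ∈ I, u ∉ D i → ‖x u‖ₑ ≤ rearr x (ℓ i)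
  integral_eq : ∀ i, ∫⁻ u in D i, ‖x u‖ₑ = rearrInt x (ℓ i)

variable {x : L0 I} {ℓ : ℤ → ℝ} {D : ℤ → Set ℝ}

/-- The differences `D (2 j + e + 1) \ D (2 j + e - 1)`, enumerated by natural numbers. -/
def blockFamily (h : IsTopSystem x ℓ D) (e : ℤ) : AveragingFamily I where
  sets k := D (2 * (Denumerable.eqv ℤ).symm k + e + 1) \ D (2 * (Denumerable.eqv ℤ).symm k + e - 1)
  subset k := sdiff_subset.trans (h.subset _)
  measurable k := (h.measurable _).diff (h.measurable _)
  finite k := (measure_mono sdiff_subset).trans_lt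
    ((h.volume_eq _).trans_lt ENNReal.ofReal_lt_top)
  disjoint := by
    have key : ∀ i j : ℤ, i < j → Disjoint (D (2 * i + e + 1) \ D (2 * i + e - 1))
        (D (2 * j + e + 1) \ D (2 * j + e - 1)) := fun i j hij =>
      Set.disjoint_left.2 fun u hu hu' => hu'.2 (h.mono (by omega) hu.1)
    intro k k' hk
    rcases lt_trichotomy ((Denumerable.eqv ℤ).symm k) ((Denumerable.eqv ℤ).symm k') with h1 | h1 | h1
    · exact key _ _ h1
    · exact absurd ((Denumerable.eqv ℤ).symm.injective h1) hk
    · exact (key _ _ h1).symm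

theorem rearr_le_div {t : ℝ} (ht : 0 < t) (hX : ∀ t, rearrInt x t < ∞) :
    rearr x t ≤ ENNReal.ofReal (realInt x t / t) := by
  have h := decr_mul_le_decrInt (volume.restrict I) (fun u => ‖x u‖ₑ) t
  rw [ENNReal.ofReal_div_of_pos ht, ofReal_realInt hX,
    ENNReal.le_div_iff_mul_le (Or.inl (by simpa using ht)) (Or.inl ENNReal.ofReal_ne_top)]
  exact h

/-- Earlier blocks lie in `D (2 j + e - 1)`. The `j`-th block has measure at least `L / 2` and mass
at most `X(L)`, which explains the factor `2`. Everything else lies outside `D (2 j + e + 1)`, where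
`x ≤ x*(L) ≤ X(L) / L`. -/
theorem IsTopSystem.enorm_partialAverage_le (h : IsTopSystem x ℓ D) (hI : MeasurableSet I)
    (hX : ∀ t, rearrInt x t < ∞) (j e : ℤ) (hℓ : 2 * ℓ (2 * j + e - 1) ≤ ℓ (2 * j + e + 1)) :
    ∀ᵐ u ∂(volume.restrict I), u ∉ D (2 * j + e - 1) → ‖partialAverage (blockFamily h e) x u‖ₑ ≤
      ENNReal.ofReal (2 * realInt x (ℓ (2 * j + e + 1)) / ℓ (2 * j + e + 1)) := by
  set L := ℓ (2 * j + e + 1) with hL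
  have hL0 : 0 < L := h.pos _
  have hX0 := realInt_nonneg x L
  have hle : rearr x L ≤ ENNReal.ofReal (2 * realInt x L / L) :=
    (rearr_le_div hL0 hX).trans (ENNReal.ofReal_le_ofReal (by gcongr; linarith))
  refine enorm_partialAverage_le_of_family (fun k => ?_) (fun u hu hD hk => ?_) hI
  · change D _ \ D _ ⊆ _ ∨ ∫⁻ u in D _ \ D _, ‖x u‖ₑ ≤ _ * volume (D _ \ D _)
    set m := (Denumerable.eqv ℤ).symm k
    rcases lt_trichotomy m j with hm | hm | hm
    · exact Or.inl (sdiff_subset.trans (h.mono (by omega)))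
    · right
      rw [hm]
      have h1 : ENNReal.ofReal (L / 2) ≤ volume (D (2 * j + e + 1) \ D (2 * j + e - 1)) := by
        rw [measure_sdiff (h.mono (by omega)) (h.measurable _).nullMeasurableSet
          (by rw [h.volume_eq]; exact ENNReal.ofReal_ne_top), h.volume_eq, h.volume_eq,
          ← ENNReal.ofReal_sub _ (h.pos _).le]
        exact ENNReal.ofReal_le_ofReal (by linarith)
      calc ∫⁻ u in D (2 * j + e + 1) \ D (2 * j + e - 1), ‖x u‖ₑ
          ≤ ∫⁻ u in D (2 * j + e + 1), ‖x u‖ₑ := lintegral_mono_set sdiff_subset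
        _ = ENNReal.ofReal (realInt x L) := by rw [h.integral_eq, ofReal_realInt hX]
        _ = ENNReal.ofReal (2 * realInt x L / L) * ENNReal.ofReal (L / 2) := by
            rw [← ENNReal.ofReal_mul (by positivity)]
            congr 1
            field_simp
        _ ≤ _ := by gcongr
    · right
      calc ∫⁻ u in D (2 * m + e + 1) \ D (2 * m + e - 1), ‖x u‖ₑ
          ≤ ∫⁻ _ in D (2 * m + e + 1) \ D (2 * m + e - 1),
            ENNReal.ofReal (2 * realInt x L / L) := by
            refine setLIntegral_mono measurable_const fun u hu => le_trans ?_ hle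
            exact h.enorm_le _ u (h.subset _ hu.1) fun hu' => hu.2 (h.mono (by omega) hu')
        _ = _ := by simp
  · refine le_trans (h.enorm_le (2 * j + e + 1) u hu fun hu' => hk ?_) hle
    refine mem_iUnion.2 ⟨Denumerable.eqv ℤ j, ?_⟩
    change u ∈ D (2 * (Denumerable.eqv ℤ).symm (Denumerable.eqv ℤ j) + e + 1) \
      D (2 * (Denumerable.eqv ℤ).symm (Denumerable.eqv ℤ j) + e - 1)
    rw [Equiv.symm_apply_apply]
    exact ⟨hu', hD⟩

/-- With `r = ℓ i` and `L = ℓ (i + 1)`, three terms take at most a quarter of `X(r)` each: the part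
of `x*` on `(0,r)` below `x*(16 r)`, the mass `X(ℓ (i - 1))`, and the mass of the average off `D (i
- 1)` on a set of measure at most `16 n r`. The last quarter must come from the difference. -/
theorem IsTopSystem.realInt_le (h : IsTopSystem x ℓ D) (hI : IsInitialInterval I)
    (hX : ∀ t, rearrInt x t < ∞) {V : Set ℝ} (hℓ : IsLevelSeq (realInt x) V ℓ) {ι : Type*}
    (s : Finset ι) {c : ι → ℝ} {v : ι → L0 I} (hc : ∀ i ∈ s, 0 ≤ c i) (hc1 : ∑ i ∈ s, c i = 1)
    (hv0 : ∀ i ∈ s, 0 ≤ v i) (hv : ∀ i ∈ s, rearr (v i) = rearr x) (e : ℤ)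
    (hG : ∀ t, rearrInt (partialAverage (blockFamily h e) x - ∑ i ∈ s, c i • v i) t < ∞) {n : ℕ}
    (hn : s.card ≤ n) (hn1 : 1 ≤ n) {i : ℤ} (hi : ∃ j, i = 2 * j + e)
    (hR : 512 * n * ℓ i ≤ ℓ (i + 1)) (hXi : realInt x (ℓ i) = 4 ^ i) : realInt x (ℓ i) ≤
      4 * realInt (partialAverage (blockFamily h e) x - ∑ i ∈ s, c i • v i) (512 * n * ℓ i) := by
  obtain ⟨j, rfl⟩ := hi
  set y := partialAverage (blockFamily h e) x
  set G := realInt (y - ∑ i ∈ s, c i • v i) with hGdef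
  set r := ℓ (2 * j + e) with hr
  set L := ℓ (2 * j + e + 1) with hL
  have hr0 : 0 < r := h.pos _
  have hL0 : 0 < L := h.pos _
  have hn' : (1 : ℝ) ≤ n := by exact_mod_cast hn1
  have hcn : (s.card : ℝ) ≤ n := by exact_mod_cast hn
  have hnr : r ≤ n * r := le_mul_of_one_le_left hr0.le hn'
  have hlow : ℓ (2 * j + e - 1) ≤ r := hℓ.mono (by omega)
  -- `τ = 16 r` makes `r x*(τ) ≤ X(L) / 16 ≤ X(r) / 4`, since `X(L) ≤ 4 X(r)`.
  have h1 := exc_le_of_convexCombination (x := x) (y := y) (τ := 16 * r) s hc hc1 hv0 hv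
    (h.measurable (2 * j + e - 1))
    ((Measure.restrict_apply_le _ _).trans (h.volume_eq (2 * j + e - 1)).le)
    (h.enorm_partialAverage_le hI.measurableSet hX j e (by nlinarith))
  have h2 := decrInt_le_excess_add (aemeasurable_mag x) (rearr x (16 * r)) r
  have h3 : rearr x (16 * r) ≤ ENNReal.ofReal (realInt x L / (16 * r)) :=
    (rearr_le_div (by positivity) hX).trans (ENNReal.ofReal_le_ofReal (by
      have := monotone_realInt hX (show 16 * r ≤ L by nlinarith)
      gcongr))
  have h4 : rearrInt y (ℓ (2 * j + e - 1)) ≤ rearrInt x (ℓ (2 * j + e - 1)) :=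
    partialAverage_submajorized _ hI.measurableSet x _ (h.pos _).le
  have hXL := hℓ.le (2 * j + e + 1)
  have hXl := hℓ.le (2 * j + e - 1)
  rw [zpow_add_one₀ (by norm_num), ← hXi] at hXL
  rw [zpow_sub_one₀ (by norm_num), ← hXi] at hXl
  have hXL0 := realInt_nonneg x L
  have hX0 := realInt_nonneg x r
  have hXl0 := realInt_nonneg x (ℓ (2 * j + e - 1))
  have hGn : 0 ≤ G (s.card * (16 * r)) := realInt_nonneg _ _
  have h5 : ENNReal.ofReal (realInt x r) ≤ ENNReal.ofReal (realInt x (ℓ (2 * j + e - 1)) +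
      2 * realInt x L / L * (s.card * (16 * r)) + G (s.card * (16 * r)) +
      realInt x L / (16 * r) * r) := by
    rw [ENNReal.ofReal_add (by positivity) (by positivity),
      ENNReal.ofReal_add (by positivity) hGn, ENNReal.ofReal_add hXl0 (by positivity),
      ENNReal.ofReal_mul (by positivity), ENNReal.ofReal_mul (p := realInt x L / (16 * r))
        (by positivity), ofReal_realInt hX, ofReal_realInt hX, hGdef, ofReal_realInt hG]
    refine h2.trans (add_le_add (h1.trans ?_) (by gcongr))
    gcongr
  rw [ENNReal.ofReal_le_ofReal_iff (by positivity)] at h5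
  have h6 : G (s.card * (16 * r)) ≤ G (512 * n * r) := monotone_realInt hG (by nlinarith)
  -- The left side is at most `128 n r X(r) / L`; the constant `512 = 4 * 128` in the gap condition
  -- makes this at most `X(r) / 4`.
  have h7 : 2 * realInt x L / L * (s.card * (16 * r)) ≤ realInt x r / 4 := by
    rw [div_mul_eq_mul_div, div_le_iff₀ hL0]
    have e1 : 2 * realInt x L * (s.card * (16 * r)) ≤
        2 * (realInt x r * 4) * (n * (16 * r)) := by gcongr
    have e2 := mul_le_mul_of_nonneg_left hR (by positivity : 0 ≤ realInt x r / 4)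
    linarith
  have h8 : realInt x L / (16 * r) * r ≤ realInt x r / 4 := by
    have : realInt x L / (16 * r) * r = realInt x L / 16 := by field_simp
    linarith
  linarith

end Blocks

/-! ### The domination inequality that drives necessity. -/

namespace SymmetricSpace

variable {I : Set ℝ} {E : SymmetricSpace I}

theorem exists_convexCombination (hI : IsInitialInterval I) {x y : L0 I}
    (hx0 : 0 ≤ x) (hy : y ∈ QPrime E x) {ε : ℝ} (hε : 0 < ε) :
    ∃ (ι : Type) (s : Finset ι) (c : ι → ℝ) (v : ι → L0 I), (∀ i ∈ s, 0 ≤ c i) ∧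
      ∑ i ∈ s, c i = 1 ∧ (∀ i ∈ s, 0 ≤ v i) ∧ (∀ i ∈ s, rearr (v i) = rearr x) ∧
      y - ∑ i ∈ s, c i • v i ∈ E.carrier ∧
      E.extNorm (y - ∑ i ∈ s, c i • v i) < ENNReal.ofReal ε := by
  rw [QPrime_eq] at hy
  obtain ⟨w, hw, hlt⟩ := hy.2 ε hε
  rw [convexHull_eq] at hw
  obtain ⟨ι, s, c, v, hc, hc1, hv, rfl⟩ := hw
  rw [Finset.centerMass_eq_of_sum_1 _ _ hc1] at hlt
  exact ⟨ι, s, c, v, hc, hc1, fun i hi => (rearr_eq_of_mem_orbitSet hI hx0 (hv i hi)).1,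
    fun i hi => (rearr_eq_of_mem_orbitSet hI hx0 (hv i hi)).2,
    extNorm_ne_top_iff.1 (hlt.trans ENNReal.ofReal_lt_top).ne, hlt⟩

/-- Two averaging families are needed: the blocks centred at even and at odd levels, so that every
long gap is detected by one of them. The ratio `R` depends on the number of terms of the convex
combinations, so `s₀` depends on `ε`, but `J` is chosen only from `ε` and the norm of `x`. -/
theorem exists_dominating (hI : IsInitialInterval I) (hE : E.IsFullySymmetric) {x : L0 I}
    (hx : x ∈ E.carrier) (hx0 : 0 ≤ x)
    (h : ∀ 𝒜 : AveragingFamily I, partialAverage 𝒜 x ∈ QPrime E x) {V : Set ℝ}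
    (hV0 : ∀ t ∈ V, 0 < t) (hVd : ∀ t ∈ V, ∀ t', 0 < t' → t' ≤ t → t' ∈ V)
    (hVI : ∀ t ∈ V, ENNReal.ofReal t ≤ volume I)
    (hVx : ∀ t ∈ V, rearr x t = 0 ∨ ∃ t', rearr x t' < rearr x t)
    (hVm : (∃ T ∈ V, ∀ t ∈ V, t ≤ T) ∨ ∀ v, ∃ t ∈ V, v < realInt x t) {ε : ℝ} (hε : 0 < ε) :
    ∃ g, E.extNorm g < ENNReal.ofReal ε ∧ ∃ s₀ : ℝ, 0 < s₀ ∧ ∀ s, s₀ ≤ s → ∀ t ∈ V,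
      rearrInt x (t / s) ≤ rearrInt g t := by
  have hX := rearrInt_lt_top hI hE hx
  obtain ⟨ℓ, hℓ⟩ := exists_isLevelSeq (monotone_realInt hX) (realInt_zero x)
    (fun t _ => continuousOn_realInt hX t) hV0 hVd hVm
  obtain ⟨D, hD, hDm⟩ := exists_topSets hI hV0 hVI hVx
  have hS : IsTopSystem x ℓ fun i => D (ℓ i) :=
    { pos := fun i => hV0 _ (hℓ.mem i)
      measurable := fun i => (hD _ (hℓ.mem i)).1
      subset := fun i => (hD _ (hℓ.mem i)).2.1
      volume_eq := fun i => (hD _ (hℓ.mem i)).2.2.1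
      mono := fun i j hij => hDm _ (hℓ.mem i) _ (hℓ.mem j) (hℓ.mono hij)
      enorm_le := fun i u hu hu' => (hD _ (hℓ.mem i)).2.2.2.2 u ⟨hu, hu'⟩
      integral_eq := fun i => by
        obtain ⟨h1, h2, h3, h4, h5⟩ := hD _ (hℓ.mem i)
        exact setLIntegral_topSet hI.measurableSet h1 h2 h3 h4 h5 }
  have hε' : 0 < ε / 64 := by positivity
  obtain ⟨ι, s, c, v, hc, hc1, hv0, hv, hmem, hlt⟩ :=
    exists_convexCombination hI hx0 (h (blockFamily hS 0)) hε'
  obtain ⟨ι', s', c', v', hc', hc1', hv0', hv', hmem', hlt'⟩ :=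
    exists_convexCombination hI hx0 (h (blockFamily hS 1)) hε'
  have hG := rearrInt_lt_top hI hE hmem
  have hG' := rearrInt_lt_top hI hE hmem'
  set a := partialAverage (blockFamily hS 0) x - ∑ i ∈ s, c i • v i
  set b := partialAverage (blockFamily hS 1) x - ∑ i ∈ s', c' i • v' i
  -- One number bounds both cardinalities; the summand `1` ensures `n ≥ 1`, hence `R > 1`.
  set n : ℕ := s.card + s'.card + 1
  set R : ℝ := 512 * n with hRdef
  have hn : (1 : ℝ) ≤ n := by exact_mod_cast Nat.le_add_left 1 _
  have hR : 1 < R := by rw [hRdef]; linarith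
  obtain ⟨d, hd, hdlt⟩ := exists_ofReal_mul_lt (extNorm_lt_top hx).ne (half_pos hε)
  obtain ⟨J, hJ⟩ := exists_pow_lt_of_lt_one hd (show (1 / 4 : ℝ) < 1 by norm_num)
  -- The weights `16` are those of `IsLevelSeq.le_add`, and `d` exceeds `(1/4)^J`. The norm is less
  -- than `16 ε/64 + 16 ε/64 + ε/2 = ε`.
  obtain ⟨g, hg, hgle⟩ := exists_extNorm_le_sum (E := E) hI Finset.univ (c := ![16, 16, d])
    (a := ![a, b, x]) (fun i _ => by fin_cases i <;> simp [hd])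
    (fun i _ => by fin_cases i <;> simp [hx, hmem, hmem'])
  simp only [Fin.sum_univ_three, Matrix.cons_val] at hg hgle
  refine ⟨g, hg.trans_lt ?_, R ^ (J + 1), by positivity, fun σ hσ t ht => ?_⟩
  · have h1 : ENNReal.ofReal ε = ENNReal.ofReal 16 * ENNReal.ofReal (ε / 64) +
        ENNReal.ofReal 16 * ENNReal.ofReal (ε / 64) + ENNReal.ofReal (ε / 2) := by
      rw [← ENNReal.ofReal_mul (by norm_num), ← ENNReal.ofReal_add (by positivity) (by positivity),
        ← ENNReal.ofReal_add (by positivity) (by positivity)]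
      congr 1
      ring
    rw [h1]
    refine ENNReal.add_lt_add_of_le_of_lt ?_ (by gcongr) hdlt
    refine (ENNReal.add_lt_top.2 ⟨?_, ?_⟩).ne
    · exact ENNReal.mul_lt_top ENNReal.ofReal_lt_top (extNorm_lt_top hmem)
    · exact ENNReal.mul_lt_top ENNReal.ofReal_lt_top (extNorm_lt_top hmem')
  · have hts : t / σ ≤ t / R ^ (J + 1) := by
      have := (hV0 t ht).le
      gcongr
    refine le_trans (decrInt_mono _ _ hts) (le_trans ?_ (hgle t))
    have key := hℓ.le_add (G := fun t => realInt a t + realInt b t) (monotone_realInt hX)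
      (fun p q hpq => add_le_add (monotone_realInt hG hpq) (monotone_realInt hG' hpq))
      (fun t => add_nonneg (realInt_nonneg _ _) (realInt_nonneg _ _)) (realInt_nonneg x) hV0 hR
      (fun i hi hXi => ?_) J ht
    · change rearrInt x (t / R ^ (J + 1)) ≤ _
      have h2 : realInt x (t / R ^ (J + 1)) ≤ 16 * realInt a t + 16 * realInt b t +
          d * realInt x t := by
        have := mul_le_mul_of_nonneg_right hJ.le (realInt_nonneg x t)
        linarith
      have ha := realInt_nonneg a t
      have hb := realInt_nonneg b t
      have hx' := realInt_nonneg x t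
      rw [← ofReal_realInt hX, ← ofReal_realInt hX t, ← ofReal_realInt hG, ← ofReal_realInt hG',
        ← ENNReal.ofReal_mul (by norm_num), ← ENNReal.ofReal_mul (by norm_num),
        ← ENNReal.ofReal_mul hd.le, ← ENNReal.ofReal_add (by positivity) (by positivity),
        ← ENNReal.ofReal_add (by positivity) (by positivity)]
      exact ENNReal.ofReal_le_ofReal h2
    · rcases Int.even_or_odd' i with ⟨j, hj | hj⟩
      · have := hS.realInt_le hI hX hℓ s hc hc1 hv0 hv 0 hG (n := n) (by omega) (by omega)
          ⟨j, by omega⟩ hi hXi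
        refine this.trans ?_
        have := realInt_nonneg b (R * ℓ i)
        linarith
      · have := hS.realInt_le hI hX hℓ s' hc' hc1' hv0' hv' 1 hG' (n := n) (by omega) (by omega)
          ⟨j, by omega⟩ hi hXi
        refine this.trans ?_
        have := realInt_nonneg a (R * ℓ i)
        linarith

end SymmetricSpace

/-! ### Vanishing of the dilation functionals -/

section Dilations

variable {I : Set ℝ}

theorem limsup_eq_zero_of_le {F : ℝ → ℝ≥0∞}
    (h : ∀ ε : ℝ, 0 < ε → ∀ᶠ s in atTop, F s ≤ ENNReal.ofReal ε) : limsup F atTop = 0 := by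
  refine le_antisymm (ENNReal.le_of_forall_pos_le_add fun ε hε _ => ?_) zero_le
  rw [zero_add, ← ENNReal.ofReal_coe_nnreal]
  exact limsup_le_of_le (h := h ε (by exact_mod_cast hε))

theorem exists_lt_realInt {x : L0 I} (hx : x ∉ L1set I) (hX : ∀ t, rearrInt x t < ∞) (v : ℝ) :
    ∃ t, 0 < t ∧ v < realInt x t := by
  have h1 : ∫⁻ t in Ioi (0 : ℝ), rearr x t = ∞ := by
    rw [mem_L1set_iff, not_lt, top_le_iff, lintegral_eq_exc_zero, exc,
      excess_eq_lintegral_decr (aemeasurable_mag x)] at hx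
    rw [rearr_eq_decr]
    simpa using hx
  have hU : Ioi (0 : ℝ) = ⋃ n : ℕ, Ioo (0 : ℝ) n := by
    ext t
    simp only [mem_Ioi, mem_iUnion, mem_Ioo]
    exact ⟨fun ht => (exists_nat_gt t).imp fun n hn => ⟨ht, hn⟩, fun ⟨_, hn⟩ => hn.1⟩
  have hmono : Monotone fun n : ℕ => Ioo (0 : ℝ) n := fun m n hmn =>
    Ioo_subset_Ioo_right (by exact_mod_cast hmn)
  rw [hU, setLIntegral_iUnion_of_directed _ hmono.directed_le] at h1
  obtain ⟨n, hn⟩ := lt_iSup_iff.1 ((ENNReal.ofReal_lt_top (r := |v|)).trans_eq h1.symm)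
  rw [← rearrInt_eq, ← ofReal_realInt hX, ENNReal.ofReal_lt_ofReal_iff_of_nonneg (abs_nonneg v)]
    at hn
  refine ⟨n, ?_, (le_abs_self v).trans_lt hn⟩
  by_contra! hle
  rw [realInt, rearrInt, decrInt_of_nonpos _ _ hle, ENNReal.toReal_zero] at hn
  exact absurd hn (not_lt.2 (abs_nonneg v))

theorem rearrInf_mul_le_rearrInt (x : L0 I) (t : ℝ) :
    rearrInf x * ENNReal.ofReal t ≤ rearrInt x t := by
  refine le_trans ?_ (decr_mul_le_decrInt (volume.restrict I) (fun u => ‖x u‖ₑ) t)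
  gcongr
  exact iInf_le _ t

theorem rearrInf_eq_zero_of_mem_L1set {x : L0 I} (hx : x ∈ L1set I) : rearrInf x = 0 := by
  by_contra h0
  have hA := mem_L1set_iff.1 hx
  have h1 : rearrInf x * ∞ ≤ ∫⁻ u in I, ‖x u‖ₑ := by
    have : Tendsto (fun t : ℝ => rearrInf x * ENNReal.ofReal t) atTop (𝓝 (rearrInf x * ∞)) :=
      ENNReal.Tendsto.const_mul ENNReal.tendsto_ofReal_atTop (Or.inr (by
        exact ((iInf_le _ 1).trans_lt (rearr_lt_top_of_rearrInt one_pos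
          ((rearrInt_le_lintegral x 1).trans_lt hA))).ne))
    exact le_of_tendsto' this fun t =>
      (rearrInf_mul_le_rearrInt x t).trans (rearrInt_le_lintegral x t)
  rw [ENNReal.mul_top h0] at h1
  exact absurd hA (not_lt.2 h1)

theorem exists_rearr_lt_of_rearrInf_lt {x : L0 I} {t : ℝ} (h : rearrInf x < rearr x t) :
    ∃ t', rearr x t' < rearr x t := iInf_lt_iff.1 h

theorem eventually_realInt_div_le {x : L0 I} (hX : ∀ t, rearrInt x t < ∞) {T : ℝ} (hT : 0 < T)
    {q : ℝ} (hq : 0 < q) : ∀ᶠ s in atTop, realInt x (T / s) ≤ q := by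
  have h1 : Tendsto (realInt x) (𝓝[Icc 0 T] 0) (𝓝 0) := by
    have := continuousOn_realInt hX T 0 ⟨le_rfl, hT.le⟩
    rwa [ContinuousWithinAt, realInt_zero] at this
  have h2 : Tendsto (fun s : ℝ => T / s) atTop (𝓝[Icc 0 T] 0) := by
    refine tendsto_nhdsWithin_iff.2 ⟨tendsto_const_nhds.div_atTop tendsto_id, ?_⟩
    filter_upwards [eventually_ge_atTop 1] with s hs
    exact ⟨by positivity, div_le_self hT.le hs⟩
  exact (h1.comp h2).eventually (ge_mem_nhds hq)

/-- Beyond `T` the function `t ↦ ∫₀^{t/s} x*` grows at most linearly, with slope at most its mean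
over `(0,T)`. The linear term becomes small as `s` grows. -/
theorem rearrInt_div_le_add {x g : L0 I} (hX : ∀ t, rearrInt x t < ∞) {T s : ℝ} (hT : 0 < T)
    (hs : 0 < s) (h : ∀ t ∈ Ioc 0 T, rearrInt x (t / s) ≤ rearrInt g t) {t : ℝ} (ht : 0 ≤ t) :
    rearrInt x (t / s) ≤ rearrInt g t + ENNReal.ofReal (realInt x (T / s) / T * t) := by
  rcases ht.eq_or_lt with rfl | ht
  · rw [zero_div, rearrInt, decrInt_of_nonpos _ _ le_rfl]
    exact zero_le
  rcases le_total t T with h1 | h1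
  · exact (h t ⟨ht, h1⟩).trans le_self_add
  · have h2 := decrInt_add_le (volume.restrict I) (fun u => ‖x u‖ₑ) (T / s) ((t - T) / s)
    rw [← add_div, add_sub_cancel] at h2
    refine h2.trans (add_le_add ((h T ⟨hT, le_rfl⟩).trans (decrInt_mono _ _ h1)) ?_)
    refine (mul_le_mul_left (rearr_le_div (div_pos hT hs) hX) _).trans ?_
    have hXn := realInt_nonneg x (T / s)
    rw [← ENNReal.ofReal_mul (by positivity)]
    refine ENNReal.ofReal_le_ofReal ?_
    calc realInt x (T / s) / (T / s) * ((t - T) / s) = realInt x (T / s) / T * (t - T) := by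
          field_simp
      _ ≤ _ := by gcongr; linarith

end Dilations

/-! ### Necessity of (ii), case by case. -/

namespace SymmetricSpace

variable {I : Set ℝ} {E : SymmetricSpace I}

theorem inv_mul_extNorm_le (hI : IsInitialInterval I) (hE : E.IsFullySymmetric)
    {z g h : L0 I} {s q ε : ℝ} (hs : 0 < s) (hq : 0 < q)
    (hg : E.extNorm g < ENNReal.ofReal (ε / 2))
    (hh : ENNReal.ofReal q * E.extNorm h < ENNReal.ofReal (ε / 2)) (hle : ∀ t, 0 ≤ t →
      rearrInt z t ≤ ENNReal.ofReal s * (rearrInt g t + ENNReal.ofReal q * rearrInt h t)) :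
    (ENNReal.ofReal s)⁻¹ * E.extNorm z ≤ ENNReal.ofReal ε := by
  have hε : 0 < ε / 2 := ENNReal.ofReal_pos.1 (zero_le.trans_lt hg)
  rw [ENNReal.inv_mul_le_iff (by simpa using hs) ENNReal.ofReal_ne_top]
  refine (extNorm_le_mul_add hI hE hs (mul_pos hs hq) (a := g) (b := h) fun t ht => ?_).trans ?_
  · refine (hle t ht).trans_eq ?_
    rw [ENNReal.ofReal_mul hs.le]
    ring
  · rw [ENNReal.ofReal_mul hs.le, mul_assoc, ← mul_add, ← add_halves ε,
      ENNReal.ofReal_add hε.le hε.le]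
    gcongr

/-- The mean of `z*` over `(0,t)` decreases in `t`, so the characteristic function of `(0,N)`,
multiplied by the mean of `z*` over `(0,N)`, is submajorized by `z`. -/
theorem extNorm_indL0_le (hI : IsInitialInterval I) (hE : E.IsFullySymmetric) {z : L0 I}
    (hZ : ∀ t, rearrInt z t < ∞) {N : ℝ} (hN : 0 < N) (h0 : 0 < realInt z N) :
    E.extNorm (indL0 I N) ≤ ENNReal.ofReal (N / realInt z N) * E.extNorm z := by
  refine extNorm_le_mul hI hE (div_pos hN h0) fun t ht => ?_
  refine (rearrInt_indL0_le hI N t).trans ?_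
  rw [← ofReal_realInt hZ, ← ENNReal.ofReal_mul (by positivity)]
  refine ENNReal.ofReal_le_ofReal ?_
  rw [div_mul_eq_mul_div, le_div_iff₀ h0]
  rcases le_total t N with h1 | h1
  · rw [min_eq_left h1]
    have := ofReal_mul_rearrInt_le z ht h1
    rw [← ofReal_realInt hZ, ← ofReal_realInt hZ, ← ENNReal.ofReal_mul ht,
      ← ENNReal.ofReal_mul hN.le,
      ENNReal.ofReal_le_ofReal_iff (mul_nonneg hN.le (realInt_nonneg _ _))] at this
    exact this
  · rw [min_eq_right h1]
    have := monotone_realInt hZ h1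
    gcongr

theorem phi_eq_zero_of_Ioo {E : SymmetricSpace (Ioo (0 : ℝ) 1)} (hE : E.IsFullySymmetric)
    {x : L0 (Ioo (0 : ℝ) 1)} (hx : x ∈ E.carrier) (hx0 : 0 ≤ x)
    (h : ∀ 𝒜, partialAverage 𝒜 x ∈ QPrime E x) : phi measurableSet_Ioo E x = 0 := by
  have hI := isInitialInterval_Ioo
  have hz : ∀ (z : L0 (Ioo (0 : ℝ) 1)) (t : ℝ), 1 ≤ t → rearr z t = 0 := fun z t ht =>
    rearr_eq_zero_of_notMem hI z (one_pos.trans_le ht) fun h => absurd h.2 (not_lt.2 ht)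
  refine limsup_eq_zero_of_le fun ε hε => ?_
  obtain ⟨g, hg, s₀, hs₀, hdom⟩ := exists_dominating hI hE hx hx0 h (V := Ioc 0 1)
    (fun t ht => ht.1) (fun t ht t' h0 h1 => mem_Ioc.2 ⟨h0, h1.trans ht.2⟩)
    (fun t ht => by
      rw [Real.volume_Ioo]
      exact ENNReal.ofReal_le_ofReal (by linarith [ht.2]))
    (fun t _ => by
      by_cases h0 : rearr x t = 0
      · exact Or.inl h0
      · exact Or.inr ⟨1, by rw [hz x 1 le_rfl]; exact pos_iff_ne_zero.2 h0⟩)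
    (Or.inl ⟨1, mem_Ioc.2 ⟨one_pos, le_rfl⟩, fun t ht => ht.2⟩) (half_pos hε)
  filter_upwards [eventually_ge_atTop s₀] with s hs
  have hs0 := hs₀.trans_le hs
  have hSx := E.subset_S0 x hx
  refine inv_mul_extNorm_le hI hE hs0 one_pos hg (h := 0) (by
    rw [extNorm_zero, mul_zero]; simpa using hε) fun t ht => ?_
  have key : ∀ t ∈ Ioc (0 : ℝ) 1, rearrInt (dilatedRearr measurableSet_Ioo s x) t ≤
      ENNReal.ofReal s * rearrInt g t := fun t ht =>
    (rearrInt_dilatedRearr_le hI hSx hs0 t).trans (by gcongr; exact hdom s hs t ht)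
  refine le_trans ?_ (mul_le_mul_right le_self_add _)
  rcases ht.eq_or_lt with rfl | ht
  · rw [rearrInt, decrInt_of_nonpos _ _ le_rfl]
    exact zero_le
  rcases le_total t 1 with h1 | h1
  · exact key t ⟨ht, h1⟩
  · have h2 := decrInt_add_le (volume.restrict (Ioo (0 : ℝ) 1))
      (fun u => ‖dilatedRearr measurableSet_Ioo s x u‖ₑ) 1 (t - 1)
    rw [add_sub_cancel, ← rearr_eq_decr, hz _ 1 le_rfl, zero_mul, add_zero] at h2
    refine h2.trans ((key 1 ⟨one_pos, le_rfl⟩).trans ?_)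
    gcongr
    exact decrInt_mono _ _ h1

section HalfLine

variable {E : SymmetricSpace (Ioi (0 : ℝ))} {x : L0 (Ioi (0 : ℝ))}

theorem exists_dominating_Ioc (hE : E.IsFullySymmetric) (hx : x ∈ E.carrier) (hx0 : 0 ≤ x)
    (h : ∀ 𝒜, partialAverage 𝒜 x ∈ QPrime E x) {T : ℝ} (hT : 0 < T)
    (hTx : rearrInf x = 0 ∨ rearrInf x < rearr x T) {ε : ℝ} (hε : 0 < ε) :
    ∃ g, E.extNorm g < ENNReal.ofReal ε ∧ ∃ s₀ : ℝ, 0 < s₀ ∧ ∀ s, s₀ ≤ s → ∀ t ∈ Ioc 0 T,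
      rearrInt x (t / s) ≤ rearrInt g t := by
  refine exists_dominating isInitialInterval_Ioi hE hx hx0 h (V := Ioc 0 T)
    (fun t ht => ht.1) (fun t ht t' h0 h1 => mem_Ioc.2 ⟨h0, h1.trans ht.2⟩) (fun t _ => by simp) (fun t ht => ?_)
    (Or.inl ⟨T, mem_Ioc.2 ⟨hT, le_rfl⟩, fun t ht => ht.2⟩) hε
  rcases hTx with h0 | h0
  · rcases eq_or_ne (rearr x t) 0 with h1 | h1
    · exact Or.inl h1
    · exact Or.inr (exists_rearr_lt_of_rearrInf_lt (by rw [h0]; exact pos_iff_ne_zero.2 h1))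
  · exact Or.inr (exists_rearr_lt_of_rearrInf_lt (h0.trans_le (rearr_antitone x ht.2)))

theorem phiFin_eq_zero (hE : E.IsFullySymmetric) (hx : x ∈ E.carrier) (hx0 : 0 ≤ x)
    (hx1 : x ∈ L1set (Ioi (0 : ℝ))) (h : ∀ 𝒜, partialAverage 𝒜 x ∈ QPrime E x) :
    phiFin measurableSet_Ioi E x = 0 := by
  have hI := isInitialInterval_Ioi
  refine limsup_eq_zero_of_le fun ε hε => ?_
  obtain ⟨g, hg, s₀, hs₀, hdom⟩ := exists_dominating_Ioc hE hx hx0 h one_pos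
    (Or.inl (rearrInf_eq_zero_of_mem_L1set hx1)) (half_pos hε)
  filter_upwards [eventually_ge_atTop s₀] with s hs
  have hs0 := hs₀.trans_le hs
  refine inv_mul_extNorm_le hI hE hs0 one_pos hg (h := 0) (by
    rw [extNorm_zero, mul_zero]; simpa using hε) fun t ht => ?_
  refine le_trans ?_ (mul_le_mul_right le_self_add _)
  rcases ht.eq_or_lt with rfl | ht
  · rw [rearrInt, decrInt_of_nonpos _ _ le_rfl]
    exact zero_le
  refine (rearrInt_dilatedRearrFin_le hI (E.subset_S0 x hx) hs0 t).trans ?_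
  gcongr
  exact (hdom s hs _ ⟨lt_min ht one_pos, min_le_right _ _⟩).trans
    (decrInt_mono _ _ (min_le_left _ _))

theorem phi_eq_zero_of_eventually (hE : E.IsFullySymmetric) (hx : x ∈ E.carrier)
    (H : ∀ ε : ℝ, 0 < ε → ∃ (g h : L0 (Ioi (0 : ℝ))) (q : ℝ), 0 < q ∧
      E.extNorm g < ENNReal.ofReal ε ∧ ENNReal.ofReal q * E.extNorm h < ENNReal.ofReal ε ∧
      ∀ᶠ s in atTop, ∀ t, 0 ≤ t →
        rearrInt x (t / s) ≤ rearrInt g t + ENNReal.ofReal q * rearrInt h t) :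
    phi measurableSet_Ioi E x = 0 := by
  refine limsup_eq_zero_of_le fun ε hε => ?_
  obtain ⟨g, h, q, hq, hg, hh, hev⟩ := H _ (half_pos hε)
  filter_upwards [hev, eventually_gt_atTop 0] with s hs hs0
  refine inv_mul_extNorm_le isInitialInterval_Ioi hE hs0 hq hg hh fun t ht => ?_
  refine (rearrInt_dilatedRearr_le isInitialInterval_Ioi (E.subset_S0 x hx) hs0 t).trans ?_
  gcongr
  exact hs t ht

/-- `X` is unbounded and `x*(∞) = 0`, so levels and top sets exist on all of `(0,∞)` and no
remainder has to be treated. -/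
theorem phi_eq_zero_of_notMem_L1set (hE : E.IsFullySymmetric) (hx : x ∈ E.carrier) (hx0 : 0 ≤ x)
    (h : ∀ 𝒜, partialAverage 𝒜 x ∈ QPrime E x) (hx1 : x ∉ L1set (Ioi (0 : ℝ)))
    (hinf : rearrInf x = 0) : phi measurableSet_Ioi E x = 0 := by
  have hX := rearrInt_lt_top isInitialInterval_Ioi hE hx
  refine phi_eq_zero_of_eventually hE hx fun ε hε => ?_
  obtain ⟨g, hg, s₀, hs₀, hdom⟩ := exists_dominating isInitialInterval_Ioi hE hx hx0 h
    (V := Ioi 0) (fun t ht => ht) (fun t _ t' h0 _ => h0) (fun t _ => by simp) (fun t _ => by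
      rcases eq_or_ne (rearr x t) 0 with h1 | h1
      · exact Or.inl h1
      · exact Or.inr (exists_rearr_lt_of_rearrInf_lt (by rw [hinf]; exact pos_iff_ne_zero.2 h1)))
    (Or.inr fun v => exists_lt_realInt hx1 hX v) hε
  refine ⟨g, 0, 1, one_pos, hg, by rw [extNorm_zero, mul_zero]; simpa using hε, ?_⟩
  filter_upwards [eventually_ge_atTop s₀] with s hs t ht
  refine le_trans ?_ le_self_add
  rcases ht.eq_or_lt with rfl | ht
  · rw [zero_div, rearrInt, decrInt_of_nonpos _ _ le_rfl]
    exact zero_le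
  · exact hdom s hs t ht

/-- Domination holds only up to some `T` with `x*(T) > x*(∞)`. The linear remainder beyond `T` is
absorbed by `q X(t) ≥ q x*(∞) t`. If there is no such `T`, then `x*` is constant on `(0,∞)` and `X(t
/ s) = X(t) / s`. -/
theorem phi_eq_zero_of_rearrInf_ne_zero (hE : E.IsFullySymmetric) (hx : x ∈ E.carrier)
    (hx0 : 0 ≤ x) (h : ∀ 𝒜, partialAverage 𝒜 x ∈ QPrime E x) (hinf : rearrInf x ≠ 0) :
    phi measurableSet_Ioi E x = 0 := by
  have hX := rearrInt_lt_top isInitialInterval_Ioi hE hx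
  refine phi_eq_zero_of_eventually hE hx fun ε hε => ?_
  obtain ⟨q, hq, hqlt⟩ := exists_ofReal_mul_lt (extNorm_lt_top hx).ne hε
  by_cases hT : ∃ T, 0 < T ∧ rearrInf x < rearr x T
  · obtain ⟨T, hT, hTx⟩ := hT
    obtain ⟨g, hg, s₀, hs₀, hdom⟩ := exists_dominating_Ioc hE hx hx0 h hT (Or.inr hTx) hε
    refine ⟨g, x, q, hq, hg, hqlt, ?_⟩
    have hc : 0 < (rearrInf x).toReal := ENNReal.toReal_pos hinf (rearrInf_lt_top hx).ne
    filter_upwards [eventually_ge_atTop s₀,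
      eventually_realInt_div_le hX hT (q := q * (rearrInf x).toReal * T) (by positivity)]
      with s hs hsq t ht
    refine (rearrInt_div_le_add hX hT (hs₀.trans_le hs) (hdom s hs) ht).trans ?_
    gcongr
    refine le_trans ?_ (mul_le_mul_right (rearrInf_mul_le_rearrInt x t) _)
    rw [← ENNReal.ofReal_toReal (rearrInf_lt_top hx).ne, ← ENNReal.ofReal_mul hc.le,
      ← ENNReal.ofReal_mul hq.le, ← mul_assoc]
    refine ENNReal.ofReal_le_ofReal ?_
    gcongr
    rwa [div_le_iff₀ hT]
  · push Not at hT
    have heq : ∀ t, rearrInt x t = rearrInf x * ENNReal.ofReal t := fun t => by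
      refine le_antisymm ?_ (rearrInf_mul_le_rearrInt x t)
      calc rearrInt x t ≤ ∫⁻ _ in Ioo 0 t, rearrInf x :=
            setLIntegral_mono measurable_const fun u hu => hT u hu.1
        _ = _ := by simp
    refine ⟨0, x, q, hq, by rw [extNorm_zero]; simpa using hε, hqlt, ?_⟩
    filter_upwards [eventually_ge_atTop q⁻¹, eventually_gt_atTop 0] with s hs hs0 t ht
    refine le_trans ?_ le_add_self
    rw [heq, heq, mul_left_comm, ← ENNReal.ofReal_mul hq.le]
    gcongr
    rw [div_le_iff₀ hs0]
    have : 1 ≤ q * s := by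
      have := mul_le_mul_of_nonneg_left hs hq.le
      rwa [mul_inv_cancel₀ hq.ne'] at this
    nlinarith

/-- The remainder beyond `T = 1` is bounded both by a small linear term and by the total mass, hence
by `A / N` times the characteristic function of `(0,N)`. Comparison with some `z ∈ E` outside `L₁`
makes its norm at most `A ‖z‖ / ∫₀ᴺ z*`, which is small for large `N`. -/
theorem phi_eq_zero_of_mem_L1set (hE : E.IsFullySymmetric)
    (hEL : ¬ (E.carrier : Set (L0 (Ioi (0 : ℝ)))) ⊆ L1set (Ioi (0 : ℝ))) (hx : x ∈ E.carrier)
    (hx0 : 0 ≤ x) (h : ∀ 𝒜, partialAverage 𝒜 x ∈ QPrime E x) (hx1 : x ∈ L1set (Ioi (0 : ℝ))) :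
    phi measurableSet_Ioi E x = 0 := by
  have hI := isInitialInterval_Ioi
  have hX := rearrInt_lt_top hI hE hx
  obtain ⟨z, hz, hz1⟩ := not_subset.1 hEL
  have hZ := rearrInt_lt_top hI hE hz
  refine phi_eq_zero_of_eventually hE hx fun ε hε => ?_
  -- The summand `1` keeps `A` positive when `x = 0`.
  set A : ℝ := (∫⁻ u in Ioi (0 : ℝ), ‖x u‖ₑ).toReal + 1 with hA
  have hA0 : 0 < A := by positivity
  have hXA : ∀ t, rearrInt x t ≤ ENNReal.ofReal A := fun t =>
    (rearrInt_le_lintegral x t).trans ((ENNReal.ofReal_toReal (mem_L1set_iff.1 hx1).ne).symm.le.trans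
      (ENNReal.ofReal_le_ofReal (by linarith)))
  obtain ⟨d, hd, hdlt⟩ := exists_ofReal_mul_lt (extNorm_lt_top hz).ne hε
  obtain ⟨N, hN, hNz⟩ := exists_lt_realInt hz1 hZ (A / d)
  have hZ0 : 0 < realInt z N := lt_trans (by positivity) hNz
  obtain ⟨g, hg, s₀, hs₀, hdom⟩ := exists_dominating_Ioc hE hx hx0 h one_pos
    (Or.inl (rearrInf_eq_zero_of_mem_L1set hx1)) hε
  refine ⟨g, indL0 _ N, A / N, by positivity, hg, lt_of_le_of_lt ?_ hdlt, ?_⟩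
  · refine (mul_le_mul_right (extNorm_indL0_le hI hE hZ hN hZ0) _).trans ?_
    rw [← mul_assoc, ← ENNReal.ofReal_mul (by positivity)]
    gcongr
    rw [show A / N * (N / realInt z N) = A / realInt z N by field_simp, div_le_iff₀ hZ0]
    rw [div_lt_iff₀ hd] at hNz
    linarith
  · filter_upwards [eventually_ge_atTop s₀,
      eventually_realInt_div_le hX one_pos (q := A / N) (by positivity)] with s hs hsq t ht
    have hind := ofReal_min_le_rearrInt_indL0 hI (b := N) (fun u hu => hu.1) t
    rcases le_total t N with h1 | h1
    · refine (rearrInt_div_le_add hX one_pos (hs₀.trans_le hs) (hdom s hs) ht).trans ?_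
      rw [min_eq_left h1] at hind
      gcongr
      rw [div_one, ENNReal.ofReal_mul (realInt_nonneg _ _)]
      gcongr
    · refine le_trans (hXA _) (le_add_left ?_)
      rw [min_eq_right h1] at hind
      refine le_trans (le_of_eq ?_) (mul_le_mul_right hind _)
      rw [← ENNReal.ofReal_mul (by positivity), div_mul_cancel₀ _ hN.ne']

end HalfLine

end SymmetricSpace

theorem mainTheorem7 :
    (∀ E : SymmetricSpace (Ioo (0 : ℝ) 1), E.IsFullySymmetric →
      ∀ x ∈ E.carrier, 0 ≤ x →
        ((∀ 𝒜 : AveragingFamily (Ioo (0 : ℝ) 1), partialAverage 𝒜 x ∈ QPrime E x) ↔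
          phi measurableSet_Ioo E x = 0)) ∧
    (∀ E : SymmetricSpace (Ioi (0 : ℝ)), E.IsFullySymmetric →
      ¬ ((E.carrier : Set (L0 (Ioi (0 : ℝ)))) ⊆ L1set (Ioi (0 : ℝ))) →
      ∀ x ∈ E.carrier, 0 ≤ x →
        ((∀ 𝒜 : AveragingFamily (Ioi (0 : ℝ)), partialAverage 𝒜 x ∈ QPrime E x) ↔
          phi measurableSet_Ioi E x = 0)) ∧
    (∀ E : SymmetricSpace (Ioi (0 : ℝ)), E.IsFullySymmetric →
      (E.carrier : Set (L0 (Ioi (0 : ℝ)))) ⊆ L1set (Ioi (0 : ℝ)) →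
      ∀ x ∈ E.carrier, 0 ≤ x →
        ((∀ 𝒜 : AveragingFamily (Ioi (0 : ℝ)), partialAverage 𝒜 x ∈ QPrime E x) ↔
          phiFin measurableSet_Ioi E x = 0)) := by
  refine ⟨fun E hE x hx hx0 => ⟨fun h => SymmetricSpace.phi_eq_zero_of_Ioo hE hx hx0 h,
    fun h _ => SymmetricSpace.partialAverage_mem_of_phi isInitialInterval_Ioo hE hx hx0 h⟩,
    fun E hE hEL x hx hx0 => ⟨fun h => ?_,
    fun h _ => SymmetricSpace.partialAverage_mem_of_phi isInitialInterval_Ioi hE hx hx0 h⟩,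
    fun E hE hEL x hx hx0 => ⟨fun h => SymmetricSpace.phiFin_eq_zero hE hx hx0 (hEL hx) h,
    fun h _ => SymmetricSpace.partialAverage_mem_of_phiFin isInitialInterval_Ioi
      Ioo_subset_Ioi_self hE hx hx0 (hEL hx) h⟩⟩
  by_cases hx1 : x ∈ L1set (Ioi (0 : ℝ))
  · exact SymmetricSpace.phi_eq_zero_of_mem_L1set hE hEL hx hx0 h hx1
  by_cases hinf : rearrInf x = 0
  · exact SymmetricSpace.phi_eq_zero_of_notMem_L1set hE hx hx0 h hx1 hinf
  · exact SymmetricSpace.phi_eq_zero_of_rearrInf_ne_zero hE hx hx0 h hinf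

end
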